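/- **Setting.** Let $\mathcal C$ be an abelian category with enough projectives in which every object has finite projective dimension, let $n\ge 1$, and let $W\colon \mathrm{id}_{\mathcal C}\to\mathrm{id}_{\mathcal C}$ be a natural transformation. Let $\mathrm{MF}=\mathrm{MF}^n(\mathcal C,W)$ be the category of $n$-step matrix factorizations: an object is a family $(M_i)_{i\in\mathbb Z/n}$ of objects of $\mathcal C$ with morphisms $d_i\colon M_i\to M_{i+1}$ such that every composite of $n$ consecutive ones, $M_i\to M_{i+1}\to\dots\to M_{i+n}=M_i$, equals $W_{M_i}$; morphisms are families of morphisms commuting with the $d_i$. Write $\mathrm{MF}_{ex}$ for $\mathrm{MF}$ with the exact structure whose short exact sequences are those that split in each component; it is a Frobenius category. Let $\mathrm{ProjInj}$ be its class of projective-injective objects, $\mathrm{Stab}(\mathrm{MF}_{ex})$ its stable category with Happel's triangulated structure, $D^b(\mathrm{MF}_{ex})$ and $D^-(\mathrm{MF}_{ex})$ its bounded and bounded-above derived categories (cohomological indexing), and $K^b(\mathrm{ProjInj})\subseteq D^b(\mathrm{MF}_{ex})$ the full subcategory of the objects isomorphic to bounded complexes of projective-injectives. Let $\mathrm{MF}_{proj}\subseteq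 \mathrm{MF}$ consist of the factorizations with projective components, again with the componentwise split exact structure; $\mathrm{Stab}(\mathrm{MF}_{proj})$ is the stable category of matrix factorizations considered by Tribone. Let $\mathcal K\subseteq D^b(\mathrm{MF}_{ex})$ be the full subcategory of the objects isomorphic to bounded complexes that are acyclic in the abelian sense, i.e. each of whose $n$ component complexes is exact in $\mathcal C$. Let $\mathcal P\subseteq D^b(\mathrm{MF}_{ex})$ (that is, $K^-(\mathrm{Proj}_{\mathrm{MF}_{ab}})\cap D^b(\mathrm{MF}_{ex})$) be the full subcategory of the objects that are isomorphic in $D^-(\mathrm{MF}_{ex})$ to a bounded-above complex of projective objects of the abelian category $\mathrm{MF}$. The functor $X\mapsto X[0]$ induces a functor $$\iota\colon \mathrm{Stab}(\mathrm{MF}_{ex})\to D^b(\mathrm{MF}_{ex})/K^b(\mathrm{ProjInj}),$$ which is a triangulated equivalence (claim 2 below); for a full subcategory $\mathcal A\subseteq D^b(\mathrm{MF}_{ex})$ let $\mathrm{Tot}(\mathcal A)\subseteq \mathrm{Stab}(\mathrm{MF}_{ex})$ be the full subcategory of the objects $M$ such that $\iota(M)$ is isomorphic to the image of an object of $\mathcal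 A$. The absolute derived category is the Verdier quotient $D^{abs}\mathrm{MF}^n(\mathcal C,W):=\mathrm{Stab}(\mathrm{MF}_{ex})/\mathrm{Tot}(\mathcal K)$. A semiorthogonal decomposition $\mathcal T=\langle \mathcal A_1,\mathcal A_2\rangle$ of a triangulated category means: $\mathcal A_1,\mathcal A_2$ are full triangulated subcategories, $\mathrm{Hom}(X_2,X_1)=0$ for all $X_1\in\mathcal A_1$, $X_2\in\mathcal A_2$, and the smallest strictly full triangulated subcategory of $\mathcal T$ containing $\mathcal A_1$ and $\mathcal A_2$ is $\mathcal T$. **Proposition.** In this setting: 1. There is a semiorthogonal decomposition $D^b(\mathrm{MF}_{ex})=\langle \mathcal K,\ \mathcal P\rangle$. 2. The functor $\iota\colon \mathrm{Stab}(\mathrm{MF}_{ex})\to D^b(\mathrm{MF}_{ex})/K^b(\mathrm{ProjInj})$ is a triangulated equivalence. 3. The functor $\mathrm{Stab}(\mathrm{MF}_{proj})\to \mathrm{Stab}(\mathrm{MF}_{ex})$ induced by the inclusion is triangulated and fully faithful. 4. Its essential image, again denoted $\mathrm{Stab}(\mathrm{MF}_{proj})$, is $\mathrm{Tot}(\mathcal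 P)$. 5. The decomposition in (1) descends to a semiorthogonal decomposition $$\mathrm{Stab}(\mathrm{MF}_{ex})=\langle \mathrm{Tot}(\mathcal K),\ \mathrm{Stab}(\mathrm{MF}_{proj})\rangle .$$ 6. Consequently the composite $\mathrm{Stab}(\mathrm{MF}_{proj})\to\mathrm{Stab}(\mathrm{MF}_{ex})\to D^{abs}\mathrm{MF}^n(\mathcal C,W)$ is a triangulated equivalence. -/

import Mathlib

open CategoryTheory Category Limits Preadditive ZeroObject Pretriangulated
universe v u v' u'

namespace MatFac
set_option linter.unusedSectionVars false

section Exact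
variable {E : Type u} [Category.{v} E] [Preadditive E]

/-- `f` is an admissible monomorphism for the class `𝓔` of short sequences. -/
def Inflation (𝓔 : ObjectProperty (ShortComplex E)) {X Y : E} (f : X ⟶ Y) : Prop :=
  ∃ (Z : E) (g : Y ⟶ Z) (w : f ≫ g = 0), 𝓔 (ShortComplex.mk f g w)

/-- `g` is an admissible epimorphism for the class `𝓔` of short sequences. -/
def Deflation (𝓔 : ObjectProperty (ShortComplex E)) {Y Z : E} (g : Y ⟶ Z) : Prop :=
  ∃ (X : E) (f : X ⟶ Y) (w : f ≫ g = 0), 𝓔 (ShortComplex.mk f g w)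

variable (E) in
/-- An exact structure on an additive category: an isomorphism-closed class of kernel-cokernel
pairs (the admissible short exact sequences) satisfying Quillen's axioms. -/
structure ExactStructure where
  /-- the admissible short exact sequences -/
  conflation : ObjectProperty (ShortComplex E)
  of_iso : ∀ {S T : ShortComplex E}, (S ≅ T) → conflation S → conflation T
  isKernel : ∀ {S : ShortComplex E}, conflation S →
    Nonempty (IsLimit (KernelFork.ofι S.f S.zero))
  isCokernel : ∀ {S : ShortComplex E}, conflation S →
    Nonempty (IsColimit (CokernelCofork.ofπ S.g S.zero))
  id_inflation : ∀ X : E, Inflation conflation (𝟙 X)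
  id_deflation : ∀ X : E, Deflation conflation (𝟙 X)
  comp_inflation : ∀ {X Y Z : E} (f : X ⟶ Y) (g : Y ⟶ Z),
    Inflation conflation f → Inflation conflation g → Inflation conflation (f ≫ g)
  comp_deflation : ∀ {X Y Z : E} (f : X ⟶ Y) (g : Y ⟶ Z),
    Deflation conflation f → Deflation conflation g → Deflation conflation (f ≫ g)
  pushout : ∀ {X Y X' : E} (f : X ⟶ Y) (a : X ⟶ X'), Inflation conflation f →
    ∃ (Y' : E) (b : Y ⟶ Y') (f' : X' ⟶ Y'), IsPushout f a b f' ∧ Inflation conflation f'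
  pullback : ∀ {Y Z Z' : E} (g : Y ⟶ Z) (c : Z' ⟶ Z), Deflation conflation g →
    ∃ (Y' : E) (b : Y' ⟶ Y) (g' : Y' ⟶ Z'), IsPullback b g' g c ∧ Deflation conflation g'

namespace ExactStructure
variable (S : ExactStructure E)

/-- `X ⟶ Y ⟶ Z` is an admissible short exact sequence. -/
def Conf {X Y Z : E} (f : X ⟶ Y) (g : Y ⟶ Z) : Prop :=
  ∃ w : f ≫ g = 0, S.conflation (ShortComplex.mk f g w)

/-- Projective objects of an exact category: lifting against admissible epimorphisms. -/
def IsProjective (P : E) : Prop :=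
  ∀ ⦃Y Z : E⦄ (g : Y ⟶ Z), Deflation S.conflation g → ∀ u : P ⟶ Z, ∃ v : P ⟶ Y, v ≫ g = u

/-- Injective objects of an exact category: extension along admissible monomorphisms. -/
def IsInjective (I : E) : Prop :=
  ∀ ⦃X Y : E⦄ (f : X ⟶ Y), Inflation S.conflation f → ∀ u : X ⟶ I, ∃ v : Y ⟶ I, f ≫ v = u

/-- The projective-injective objects. -/
def ProjInj : ObjectProperty E := fun P => S.IsProjective P ∧ S.IsInjective P

/-- Frobenius categories: enough projectives and injectives, and these classes coincide. -/
class IsFrobenius : Prop where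
  enoughInjectives : ∀ X : E, ∃ (I : E) (f : X ⟶ I), S.IsInjective I ∧ Inflation S.conflation f
  enoughProjectives : ∀ X : E, ∃ (P : E) (g : P ⟶ X), S.IsProjective P ∧ Deflation S.conflation g
  projective_iff_injective : ∀ X : E, S.IsProjective X ↔ S.IsInjective X

variable {S}

lemma Conf.zero {X Y Z : E} {f : X ⟶ Y} {g : Y ⟶ Z} (h : S.Conf f g) : f ≫ g = 0 := h.1

lemma Conf.inflation {X Y Z : E} {f : X ⟶ Y} {g : Y ⟶ Z} (h : S.Conf f g) :
    Inflation S.conflation f := ⟨_, g, h.1, h.2⟩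

lemma Conf.deflation {X Y Z : E} {f : X ⟶ Y} {g : Y ⟶ Z} (h : S.Conf f g) :
    Deflation S.conflation g := ⟨_, f, h.1, h.2⟩

lemma Conf.mono {X Y Z : E} {f : X ⟶ Y} {g : Y ⟶ Z} (h : S.Conf f g) : Mono f :=
  mono_of_isLimit_fork (S.isKernel h.2).some

lemma Conf.epi {X Y Z : E} {f : X ⟶ Y} {g : Y ⟶ Z} (h : S.Conf f g) : Epi g :=
  epi_of_isColimit_cofork (S.isCokernel h.2).some

lemma Conf.lift {X Y Z : E} {f : X ⟶ Y} {g : Y ⟶ Z} (h : S.Conf f g) {W : E} (k : W ⟶ Y)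
    (hk : k ≫ g = 0) : ∃ l : W ⟶ X, l ≫ f = k :=
  ⟨_, ((KernelFork.IsLimit.lift' (S.isKernel h.2).some k hk).2)⟩

lemma Conf.desc {X Y Z : E} {f : X ⟶ Y} {g : Y ⟶ Z} (h : S.Conf f g) {W : E} (k : Y ⟶ W)
    (hk : f ≫ k = 0) : ∃ l : Z ⟶ W, g ≫ l = k :=
  ⟨_, ((CokernelCofork.IsColimit.desc' (S.isCokernel h.2).some k hk).2)⟩

lemma Conf.of_iso {X Y Z X' Y' Z' : E} {f : X ⟶ Y} {g : Y ⟶ Z} {f' : X' ⟶ Y'} {g' : Y' ⟶ Z'}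
    (h : S.Conf f g) (a : X ≅ X') (b : Y ≅ Y') (c : Z ≅ Z') (h₁ : a.hom ≫ f' = f ≫ b.hom)
    (h₂ : b.hom ≫ g' = g ≫ c.hom) : S.Conf f' g' := by
  have w : f' ≫ g' = 0 := by
    rw [← cancel_epi a.hom, reassoc_of% h₁, h₂, reassoc_of% h.1, zero_comp, comp_zero]
  exact ⟨w, S.of_iso (ShortComplex.isoMk a b c h₁ h₂) h.2⟩

/-- Pushing out an admissible sequence. -/
lemma Conf.pushout {X Y Z : E} {f : X ⟶ Y} {g : Y ⟶ Z} (h : S.Conf f g) {X' : E} (a : X ⟶ X') :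
    ∃ (Y' : E) (b : Y ⟶ Y') (f' : X' ⟶ Y') (g' : Y' ⟶ Z),
      IsPushout f a b f' ∧ S.Conf f' g' ∧ b ≫ g' = g := by
  obtain ⟨Y', b, f', hp, Z'', g'', w, hc⟩ := S.pushout f a h.inflation
  have hc' : S.Conf f' g'' := ⟨w, hc⟩
  let g' : Y' ⟶ Z := hp.desc g 0 (by simp [h.zero])
  have hb : b ≫ g' = g := by simp [g']
  have hf : f' ≫ g' = 0 := by simp [g']
  obtain ⟨z, hz⟩ := h.desc (b ≫ g'') (by rw [hp.w_assoc, w, comp_zero])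
  obtain ⟨z', hz'⟩ := hc'.desc g' hf
  have := h.epi
  have := hc'.epi
  have e₁ : z ≫ z' = 𝟙 _ := by
    rw [← cancel_epi g, reassoc_of% hz, hz', hb, comp_id]
  have e₂ : z' ≫ z = 𝟙 _ := by
    rw [← cancel_epi g'', reassoc_of% hz', comp_id]
    apply hp.hom_ext
    · rw [reassoc_of% hb, hz]
    · rw [reassoc_of% hf, zero_comp, w]
  exact ⟨Y', b, f', g', hp, hc'.of_iso (Iso.refl _) (Iso.refl _) ⟨z', z, e₂, e₁⟩
    (by simp) (by simp [hz']), hb⟩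

variable [HasZeroObject E] [HasBinaryBiproducts E]

lemma projInj_zero : S.ProjInj (0 : E) :=
  ⟨fun _ _ _ _ _ => ⟨0, (isZero_zero E).eq_of_src _ _⟩,
    fun _ _ _ _ _ => ⟨0, (isZero_zero E).eq_of_tgt _ _⟩⟩

lemma projInj_biprod {P Q : E} (hP : S.ProjInj P) (hQ : S.ProjInj Q) : S.ProjInj (P ⊞ Q) := by
  constructor
  · intro Y Z g hg u
    obtain ⟨v₁, h₁⟩ := hP.1 g hg (biprod.inl ≫ u)
    obtain ⟨v₂, h₂⟩ := hQ.1 g hg (biprod.inr ≫ u)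
    exact ⟨biprod.desc v₁ v₂, by ext <;> simp [h₁, h₂]⟩
  · intro X Y f hf u
    obtain ⟨v₁, h₁⟩ := hP.2 f hf (u ≫ biprod.fst)
    obtain ⟨v₂, h₂⟩ := hQ.2 f hf (u ≫ biprod.snd)
    exact ⟨biprod.lift v₁ v₂, by ext <;> simp [h₁, h₂]⟩

variable (S)

/-- Two morphisms are identified in the stable category when their difference factors through
a projective-injective object. -/
def stableRel : HomRel E := fun X Y f g =>
  ∃ (P : E) (a : X ⟶ P) (b : P ⟶ Y), S.ProjInj P ∧ f - g = a ≫ b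

lemma stableRel_add ⦃X Y : E⦄ (f₁ f₂ g₁ g₂ : X ⟶ Y) (hf : S.stableRel f₁ f₂)
    (hg : S.stableRel g₁ g₂) : S.stableRel (f₁ + g₁) (f₂ + g₂) := by
  obtain ⟨P, a, b, hP, h⟩ := hf
  obtain ⟨Q, c, d, hQ, h'⟩ := hg
  refine ⟨P ⊞ Q, biprod.lift a c, biprod.desc b d, projInj_biprod hP hQ, ?_⟩
  rw [biprod.lift_desc, ← h, ← h']
  abel

instance : Congruence S.stableRel where
  equivalence :=
    { refl := fun f => ⟨0, 0, 0, projInj_zero, by simp⟩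
      symm := by
        rintro f g ⟨P, a, b, hP, h⟩
        exact ⟨P, -a, b, hP, by rw [neg_comp, ← h, neg_sub]⟩
      trans := by
        intro f g k h₁ h₂
        have := S.stableRel_add _ _ _ _ h₁ h₂
        obtain ⟨P, a, b, hP, h⟩ := this
        exact ⟨P, a, b, hP, by rw [← h]; abel⟩ }
  comp_left := by
    rintro X Y Z f g g' ⟨P, a, b, hP, h⟩
    exact ⟨P, f ≫ a, b, hP, by rw [← comp_sub, h, assoc]⟩
  comp_right := by
    rintro X Y Z f f' g ⟨P, a, b, hP, h⟩
    exact ⟨P, a, b ≫ g, hP, by rw [← sub_comp, h, assoc]⟩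

/-- The stable category: same objects, morphisms modulo those factoring through a
projective-injective object. -/
def Stab : Type u := CategoryTheory.Quotient S.stableRel

noncomputable instance : Category S.Stab := inferInstanceAs (Category (CategoryTheory.Quotient S.stableRel))

noncomputable instance : Preadditive S.Stab := CategoryTheory.Quotient.preadditive _ S.stableRel_add

/-- The projection to the stable category. -/
def toStab : E ⥤ S.Stab := CategoryTheory.Quotient.functor S.stableRel

instance : S.toStab.Additive := CategoryTheory.Quotient.functor_additive _ S.stableRel_add
instance : S.toStab.Full := inferInstanceAs (CategoryTheory.Quotient.functor _).Full
instance : S.toStab.EssSurj := inferInstanceAs (CategoryTheory.Quotient.functor _).EssSurj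

lemma toStab_map_eq_iff {X Y : E} (f g : X ⟶ Y) :
    S.toStab.map f = S.toStab.map g ↔ S.stableRel f g :=
  CategoryTheory.Quotient.functor_map_eq_iff _ f g

lemma toStab_map_eq_zero_iff {X Y : E} (f : X ⟶ Y) :
    S.toStab.map f = 0 ↔ ∃ (P : E) (a : X ⟶ P) (b : P ⟶ Y), S.ProjInj P ∧ f = a ≫ b := by
  rw [← S.toStab.map_zero, toStab_map_eq_iff]
  simp [stableRel]

instance : HasZeroObject S.Stab := ⟨S.toStab.obj 0, S.toStab.map_isZero (isZero_zero E)⟩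

/-- Functors out of the stable category. -/
def liftStab {D : Type u'} [Category.{v'} D] [Preadditive D] (F : E ⥤ D) [F.Additive]
    (hF : ∀ P : E, S.ProjInj P → IsZero (F.obj P)) : S.Stab ⥤ D :=
  CategoryTheory.Quotient.lift S.stableRel F (by
    rintro X Y f g ⟨P, a, b, hP, h⟩
    rw [← sub_eq_zero, ← F.map_sub, h, F.map_comp, (hF P hP).eq_of_tgt (F.map a) 0, zero_comp])

end ExactStructure
end Exact

section Susp
variable {E : Type u} [Category.{v} E] [Preadditive E] [HasZeroObject E] [HasBinaryBiproducts E]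

namespace ExactStructure
variable {S : ExactStructure E}

/-- Two compatible maps of sequences ending at stably equal maps on the left are stably equal
on the right, if the middle term of the target is projective-injective. -/
lemma Conf.key {X Y Z X' Y' Z' : E} {f : X ⟶ Y} {g : Y ⟶ Z} {f' : X' ⟶ Y'} {g' : Y' ⟶ Z'}
    (h : S.Conf f g) (w : f' ≫ g' = 0) (hY' : S.ProjInj Y') {a a' : X ⟶ X'} {b b' : Y ⟶ Y'}
    {c c' : Z ⟶ Z'} (h₁ : f ≫ b = a ≫ f') (h₁' : f ≫ b' = a' ≫ f') (h₂ : g ≫ c = b ≫ g')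
    (h₂' : g ≫ c' = b' ≫ g') (ha : S.toStab.map a = S.toStab.map a') :
    S.toStab.map c = S.toStab.map c' := by
  rw [toStab_map_eq_iff] at ha ⊢
  obtain ⟨P, s, t, hP, hst⟩ := ha
  obtain ⟨k, hk⟩ := hP.2 f h.inflation s
  obtain ⟨l, hl⟩ := h.desc (b - b' - k ≫ t ≫ f') (by
    rw [comp_sub, comp_sub, h₁, h₁', reassoc_of% hk, ← sub_comp, hst, assoc, sub_self])
  have := h.epi
  refine ⟨Y', l, g', hY', ?_⟩
  rw [← cancel_epi g, comp_sub, h₂, h₂', reassoc_of% hl, sub_comp, sub_comp, assoc, assoc, w]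
  simp

lemma Conf.exists_map {X Y Z X' Y' Z' : E} {f : X ⟶ Y} {g : Y ⟶ Z} {f' : X' ⟶ Y'} {g' : Y' ⟶ Z'}
    (h : S.Conf f g) (w : f' ≫ g' = 0) (hY' : S.IsInjective Y') (a : X ⟶ X') :
    ∃ (b : Y ⟶ Y') (c : Z ⟶ Z'), f ≫ b = a ≫ f' ∧ g ≫ c = b ≫ g' := by
  obtain ⟨b, hb⟩ := hY' f h.inflation (a ≫ f')
  obtain ⟨c, hc⟩ := h.desc (b ≫ g') (by rw [reassoc_of% hb, w, comp_zero])
  exact ⟨b, c, hb, hc⟩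

/-- The third terms of two admissible sequences with the same first term and projective-injective
middle terms are stably isomorphic. -/
lemma Conf.isIso_toStab_map {X Y Z Y' Z' : E} {f : X ⟶ Y} {g : Y ⟶ Z} {f' : X ⟶ Y'}
    {g' : Y' ⟶ Z'} (h : S.Conf f g) (h' : S.Conf f' g') (hY : S.ProjInj Y) (hY' : S.ProjInj Y')
    {b : Y ⟶ Y'} {c : Z ⟶ Z'} (h₁ : f ≫ b = f') (h₂ : g ≫ c = b ≫ g') :
    IsIso (S.toStab.map c) := by
  obtain ⟨b', c', h₁', h₂'⟩ := h'.exists_map h.zero hY.2 (𝟙 X)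
  refine ⟨S.toStab.map c', ?_, ?_⟩
  · rw [← S.toStab.map_comp, ← S.toStab.map_id]
    exact h.key h.zero hY (a := 𝟙 X) (a' := 𝟙 X) (b := b ≫ b') (b' := 𝟙 Y)
      (by rw [reassoc_of% h₁, h₁']) (by simp) (by rw [reassoc_of% h₂, h₂', assoc]) (by simp) rfl
  · rw [← S.toStab.map_comp, ← S.toStab.map_id]
    exact h'.key h'.zero hY' (a := 𝟙 X) (a' := 𝟙 X) (b := b' ≫ b) (b' := 𝟙 Y')
      (by rw [reassoc_of% h₁', h₁, id_comp]) (by simp)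
      (by rw [reassoc_of% h₂', h₂, assoc]) (by simp) rfl

lemma isZero_toStab_obj {P : E} (hP : S.ProjInj P) : IsZero (S.toStab.obj P) := by
  rw [IsZero.iff_id_eq_zero, ← S.toStab.map_id, toStab_map_eq_zero_iff]
  exact ⟨P, 𝟙 _, 𝟙 _, hP, by simp⟩

lemma Stab.exists_rep (X : S.Stab) : ∃ Y : E, X = S.toStab.obj Y := ⟨X.as, rfl⟩

variable [S.IsFrobenius]

variable (S) in
lemma exists_hull (X : E) : ∃ (I T : E) (i : X ⟶ I) (p : I ⟶ T), S.ProjInj I ∧ S.Conf i p := by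
  obtain ⟨I, i, hI, T, p, w, h⟩ := IsFrobenius.enoughInjectives (S := S) X
  exact ⟨I, T, i, p, ⟨(IsFrobenius.projective_iff_injective I).2 hI, hI⟩, w, h⟩

variable (S) in
lemma exists_cover (X : E) : ∃ (K P : E) (i : K ⟶ P) (p : P ⟶ X), S.ProjInj P ∧ S.Conf i p := by
  obtain ⟨P, p, hP, K, i, w, h⟩ := IsFrobenius.enoughProjectives (S := S) X
  exact ⟨K, P, i, p, ⟨hP, (IsFrobenius.projective_iff_injective P).1 hP⟩, w, h⟩

variable (S)

/-- A chosen injective hull of `X` (in the sense of an admissible monomorphism). -/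
noncomputable def hull (X : E) : E := (S.exists_hull X).choose

/-- The suspension of `X`: the cokernel of the chosen admissible `X ⟶ S.hull X`. -/
noncomputable def cosyzygy (X : E) : E := (S.exists_hull X).choose_spec.choose

/-- The admissible monomorphism into the chosen injective. -/
noncomputable def toHull (X : E) : X ⟶ S.hull X :=
  (S.exists_hull X).choose_spec.choose_spec.choose

/-- The projection from the chosen injective. -/
noncomputable def fromHull (X : E) : S.hull X ⟶ S.cosyzygy X :=
  (S.exists_hull X).choose_spec.choose_spec.choose_spec.choose

lemma projInj_hull (X : E) : S.ProjInj (S.hull X) :=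
  (S.exists_hull X).choose_spec.choose_spec.choose_spec.choose_spec.1

lemma conf_hull (X : E) : S.Conf (S.toHull X) (S.fromHull X) :=
  (S.exists_hull X).choose_spec.choose_spec.choose_spec.choose_spec.2

lemma exists_mapCosyzygy {X Y : E} (a : X ⟶ Y) : ∃ (c : S.cosyzygy X ⟶ S.cosyzygy Y)
    (b : S.hull X ⟶ S.hull Y), S.toHull X ≫ b = a ≫ S.toHull Y ∧
      S.fromHull X ≫ c = b ≫ S.fromHull Y := by
  obtain ⟨b, c, h⟩ := (S.conf_hull X).exists_map (S.conf_hull Y).zero (S.projInj_hull Y).2 a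
  exact ⟨c, b, h⟩

/-- A map induced on suspensions by `a` (unique up to maps factoring through
projective-injectives). -/
noncomputable def mapCosyzygy {X Y : E} (a : X ⟶ Y) : S.cosyzygy X ⟶ S.cosyzygy Y :=
  (S.exists_mapCosyzygy a).choose

/-- An extension of `a` to the chosen injectives. -/
noncomputable def mapHull {X Y : E} (a : X ⟶ Y) : S.hull X ⟶ S.hull Y :=
  (S.exists_mapCosyzygy a).choose_spec.choose

lemma toHull_mapHull {X Y : E} (a : X ⟶ Y) : S.toHull X ≫ S.mapHull a = a ≫ S.toHull Y :=
  (S.exists_mapCosyzygy a).choose_spec.choose_spec.1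

lemma fromHull_mapCosyzygy {X Y : E} (a : X ⟶ Y) :
    S.fromHull X ≫ S.mapCosyzygy a = S.mapHull a ≫ S.fromHull Y :=
  (S.exists_mapCosyzygy a).choose_spec.choose_spec.2

lemma mapCosyzygy_eq {X Y : E} {a a' : X ⟶ Y} {b : S.hull X ⟶ S.hull Y}
    {c : S.cosyzygy X ⟶ S.cosyzygy Y} (h₁ : S.toHull X ≫ b = a ≫ S.toHull Y)
    (h₂ : S.fromHull X ≫ c = b ≫ S.fromHull Y) (h : S.toStab.map a = S.toStab.map a') :
    S.toStab.map c = S.toStab.map (S.mapCosyzygy a') :=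
  (S.conf_hull X).key (S.conf_hull Y).zero (S.projInj_hull Y) h₁ (S.toHull_mapHull a') h₂
    (S.fromHull_mapCosyzygy a') h

/-- The suspension, as a functor to the stable category. -/
noncomputable def preSusp : E ⥤ S.Stab where
  obj X := S.toStab.obj (S.cosyzygy X)
  map a := S.toStab.map (S.mapCosyzygy a)
  map_id X := by
    rw [← S.toStab.map_id]
    exact (S.mapCosyzygy_eq (a := 𝟙 X) (b := 𝟙 _) (by simp) (by simp) rfl).symm
  map_comp {X Y Z} f g := by
    rw [← S.toStab.map_comp]
    exact (S.mapCosyzygy_eq (a := f ≫ g) (b := S.mapHull f ≫ S.mapHull g)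
      (by rw [reassoc_of% (S.toHull_mapHull), toHull_mapHull, assoc])
      (by rw [reassoc_of% (S.fromHull_mapCosyzygy), fromHull_mapCosyzygy, assoc]) rfl).symm

instance : S.preSusp.Additive where
  map_add {X Y f g} := by
    refine Eq.trans ?_ S.toStab.map_add
    exact (S.mapCosyzygy_eq (a := f + g) (b := S.mapHull f + S.mapHull g)
      (by rw [comp_add, toHull_mapHull, toHull_mapHull, add_comp])
      (by rw [comp_add, fromHull_mapCosyzygy, fromHull_mapCosyzygy, add_comp]) rfl).symm

/-- The suspension functor of the stable category. -/
noncomputable def susp : S.Stab ⥤ S.Stab := S.liftStab S.preSusp (fun P hP => by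
  rw [IsZero.iff_id_eq_zero, ← S.preSusp.map_id, ← S.preSusp.map_zero]
  refine S.mapCosyzygy_eq (S.toHull_mapHull _) (S.fromHull_mapCosyzygy _) ?_
  exact (isZero_toStab_obj hP).eq_of_src _ _)

lemma susp_map {X Y : E} (a : X ⟶ Y) :
    S.susp.map (S.toStab.map a) = S.toStab.map (S.mapCosyzygy a) := rfl

lemma susp_map_eq {X Y : E} {a : X ⟶ Y} {b : S.hull X ⟶ S.hull Y}
    {c : S.cosyzygy X ⟶ S.cosyzygy Y} (h₁ : S.toHull X ≫ b = a ≫ S.toHull Y)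
    (h₂ : S.fromHull X ≫ c = b ≫ S.fromHull Y) :
    S.susp.map (S.toStab.map a) = S.toStab.map c :=
  (S.mapCosyzygy_eq h₁ h₂ rfl).symm

instance : S.susp.Additive where
  map_add {X Y f g} := by
    obtain ⟨X, rfl⟩ := Stab.exists_rep X
    obtain ⟨Y, rfl⟩ := Stab.exists_rep Y
    obtain ⟨f, rfl⟩ := S.toStab.map_surjective f
    obtain ⟨g, rfl⟩ := S.toStab.map_surjective g
    rw [← S.toStab.map_add]
    exact S.preSusp.map_add

instance : S.susp.Full where
  map_surjective {X Y} φ := by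
    obtain ⟨X, rfl⟩ := Stab.exists_rep X
    obtain ⟨Y, rfl⟩ := Stab.exists_rep Y
    obtain ⟨u, rfl⟩ := S.toStab.map_surjective (X := S.cosyzygy X) (Y := S.cosyzygy Y) φ
    obtain ⟨e, he⟩ := (S.projInj_hull X).1 (S.fromHull Y) (S.conf_hull Y).deflation
      (S.fromHull X ≫ u)
    obtain ⟨a, ha⟩ := (S.conf_hull Y).lift (S.toHull X ≫ e) (by
      rw [assoc, he, reassoc_of% (S.conf_hull X).zero, zero_comp])
    exact ⟨S.toStab.map a, S.susp_map_eq ha.symm he.symm⟩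

instance : S.susp.Faithful where
  map_injective {X Y} φ ψ h := by
    obtain ⟨X, rfl⟩ := Stab.exists_rep X
    obtain ⟨Y, rfl⟩ := Stab.exists_rep Y
    obtain ⟨f, rfl⟩ := S.toStab.map_surjective φ
    obtain ⟨g, rfl⟩ := S.toStab.map_surjective ψ
    obtain ⟨P, a, b, hP, h⟩ := (S.toStab_map_eq_iff (S.mapCosyzygy f) (S.mapCosyzygy g)).1 h
    obtain ⟨b', hb'⟩ := hP.1 (S.fromHull Y) (S.conf_hull Y).deflation b
    obtain ⟨k, hk⟩ := (S.conf_hull Y).lift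
      (S.mapHull f - S.mapHull g - S.fromHull X ≫ a ≫ b') (by
        rw [sub_comp, sub_comp, ← fromHull_mapCosyzygy, ← fromHull_mapCosyzygy, assoc, assoc, hb',
          ← h, comp_sub, sub_self])
    rw [toStab_map_eq_iff]
    refine ⟨_, S.toHull X, k, S.projInj_hull X, ?_⟩
    have := (S.conf_hull Y).mono
    rw [← cancel_mono (S.toHull Y), assoc, hk, comp_sub, comp_sub, toHull_mapHull, toHull_mapHull,
      reassoc_of% (S.conf_hull X).zero, zero_comp, sub_zero, sub_comp]

instance : S.susp.EssSurj where
  mem_essImage X := by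
    obtain ⟨X, rfl⟩ := Stab.exists_rep X
    obtain ⟨K, P, i, p, hP, h⟩ := S.exists_cover X
    obtain ⟨b, c, h₁, h₂⟩ := (S.conf_hull K).exists_map h.zero hP.2 (𝟙 K)
    have : IsIso (S.toStab.map c) := (S.conf_hull K).isIso_toStab_map h (S.projInj_hull K) hP (h₁.trans (id_comp i)) h₂
    exact ⟨S.toStab.obj K, ⟨show S.toStab.obj (S.cosyzygy K) ≅ S.toStab.obj X from
      asIso (S.toStab.map c)⟩⟩

instance : S.susp.IsEquivalence where

end ExactStructure
end Susp

section Shift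
variable {D : Type u} [Category.{v} D] (T : D ⥤ D)

/-- Sequences of objects indexed by `ℤ` in which each term is the suspension of the
previous one. These carry a strict shift, and are equivalent to `D` if `T` is an equivalence. -/
structure Spectrum where
  X : ℤ → D
  φ : ∀ n m : ℤ, n + 1 = m → (T.obj (X n) ≅ X m)

namespace Spectrum
variable {T}

/-- Morphisms of sequences. -/
@[ext] structure Hom (A B : Spectrum T) where
  f : ∀ n, A.X n ⟶ B.X n
  comm : ∀ n m h, T.map (f n) ≫ (B.φ n m h).hom = (A.φ n m h).hom ≫ f m

instance : Category (Spectrum T) where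
  Hom := Hom
  id A := { f := fun n => 𝟙 _, comm := by simp }
  comp f g :=
    { f := fun n => f.f n ≫ g.f n
      comm := fun n m h => by rw [T.map_comp, assoc, g.comm, reassoc_of% f.comm] }
  id_comp f := by apply Hom.ext; funext; apply id_comp
  comp_id f := by apply Hom.ext; funext; apply comp_id
  assoc f g h := by apply Hom.ext; funext; apply assoc

lemma hom_ext {A B : Spectrum T} {f g : A ⟶ B} (h : ∀ n, f.f n = g.f n) : f = g :=
  Hom.ext (funext h)

@[simp] lemma id_f (A : Spectrum T) (n : ℤ) : Hom.f (𝟙 A) n = 𝟙 _ := rfl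
@[simp] lemma comp_f {A B C : Spectrum T} (f : A ⟶ B) (g : B ⟶ C) (n : ℤ) :
  (f ≫ g).f n = f.f n ≫ g.f n := rfl

/-- Isomorphisms can be checked termwise. -/
def isoMk {A B : Spectrum T} (e : ∀ n, A.X n ≅ B.X n)
    (h : ∀ n m h, T.map (e n).hom ≫ (B.φ n m h).hom = (A.φ n m h).hom ≫ (e m).hom) : A ≅ B where
  hom := ⟨fun n => (e n).hom, h⟩
  inv := ⟨fun n => (e n).inv, fun n m h' => by
    rw [← cancel_epi (T.map (e n).hom), ← T.map_comp_assoc, Iso.hom_inv_id, T.map_id, id_comp,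
      ← assoc, h, assoc, Iso.hom_inv_id, comp_id]⟩
  hom_inv_id := hom_ext (fun n => by simp)
  inv_hom_id := hom_ext (fun n => by simp)

lemma φ_eqToHom (A : Spectrum T) {n m n' m' : ℤ} (h : n + 1 = m) (h' : n' + 1 = m') (e : n = n') :
    T.map (eqToHom (congrArg A.X e)) ≫ (A.φ n' m' h').hom =
      (A.φ n m h).hom ≫ eqToHom (congrArg A.X (by omega)) := by
  subst e h h'
  simp

lemma f_eqToHom {A B : Spectrum T} (f : A ⟶ B) {n m : ℤ} (e : n = m) :
    f.f n ≫ eqToHom (congrArg B.X e) = eqToHom (congrArg A.X e) ≫ f.f m := by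
  subst e
  simp

variable (T) in
/-- Shifting the indices. -/
@[simps] def shift (a : ℤ) : Spectrum T ⥤ Spectrum T where
  obj A := ⟨fun n => A.X (n + a), fun n m h => A.φ (n + a) (m + a) (by omega)⟩
  map f := ⟨fun n => f.f (n + a), fun n m h => f.comm _ _ _⟩

/-- Reindexing along an equality of shifts. -/
def reindex (A : Spectrum T) (s t : ℤ → ℤ) (hs : ∀ n, s n + 1 = s (n + 1))
    (ht : ∀ n, t n + 1 = t (n + 1)) (h : ∀ n, s n = t n) :
    (⟨fun n => A.X (s n), fun n m h => A.φ _ _ (by subst h; exact hs n)⟩ : Spectrum T) ≅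
      ⟨fun n => A.X (t n), fun n m h => A.φ _ _ (by subst h; exact ht n)⟩ :=
  isoMk (fun n => eqToIso (congrArg A.X (h n))) (fun n m h' => by
    dsimp
    exact A.φ_eqToHom _ _ (h n))

/-- Morphisms that are transports along an equality of objects. -/
def IsEqToHom {X Y : D} (f : X ⟶ Y) : Prop := ∃ h : X = Y, f = eqToHom h

lemma IsEqToHom.eq {X Y : D} {f g : X ⟶ Y} (hf : IsEqToHom f) (hg : IsEqToHom g) : f = g :=
  hf.2.trans hg.2.symm

lemma IsEqToHom.comp {X Y Z : D} {f : X ⟶ Y} {g : Y ⟶ Z} (hf : IsEqToHom f) (hg : IsEqToHom g) :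
    IsEqToHom (f ≫ g) := by
  obtain ⟨rfl, rfl⟩ := hf
  obtain ⟨rfl, rfl⟩ := hg
  exact ⟨rfl, by simp⟩

lemma isEqToHom_f {A B : Spectrum T} (h : A = B) (n : ℤ) : IsEqToHom (Hom.f (eqToHom h) n) := by
  subst h
  exact ⟨rfl, rfl⟩

noncomputable instance : HasShift (Spectrum T) ℤ := hasShiftMk _ _
  { F := shift T
    zero := NatIso.ofComponents (fun A => A.reindex (fun n => n + 0) (fun n => n)
      (by intros; omega) (by intros; omega) (by intros; omega))
      (fun f => hom_ext (fun n => f_eqToHom f (by omega)))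
    add := fun a b => NatIso.ofComponents (fun A => A.reindex (fun n => n + (a + b))
      (fun n => n + b + a) (by intros; omega) (by intros; omega) (by intros; omega))
      (fun f => hom_ext (fun n => f_eqToHom f (by dsimp; omega)))
    assoc_hom_app := fun a b c A => hom_ext (fun n =>
      IsEqToHom.eq (IsEqToHom.comp ⟨congrArg A.X (by omega), rfl⟩ ⟨congrArg A.X (by omega), rfl⟩)
        (IsEqToHom.comp (isEqToHom_f _ n) (IsEqToHom.comp ⟨congrArg A.X (by omega), rfl⟩ ⟨congrArg A.X (by omega), rfl⟩)))
    zero_add_hom_app := fun a A => hom_ext (fun n =>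
      IsEqToHom.eq ⟨congrArg A.X (by omega), rfl⟩ (IsEqToHom.comp (isEqToHom_f _ n) ⟨congrArg A.X (by omega), rfl⟩))
    add_zero_hom_app := fun a A => hom_ext (fun n =>
      IsEqToHom.eq ⟨congrArg A.X (by omega), rfl⟩ (IsEqToHom.comp (isEqToHom_f _ n) ⟨congrArg A.X (by omega), rfl⟩)) }

variable (T) in
/-- The term of index `0`. -/
@[simps] def ev : Spectrum T ⥤ D where
  obj A := A.X 0
  map f := f.f 0

instance [T.Faithful] : (ev T).Faithful where
  map_injective {A B f g} h := hom_ext (fun n => by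
    have up : ∀ n : ℤ, f.f n = g.f n → f.f (n + 1) = g.f (n + 1) := fun n hn => by
      rw [← cancel_epi (A.φ n (n + 1) rfl).hom, ← f.comm, ← g.comm, hn]
    have down : ∀ n : ℤ, f.f (n + 1) = g.f (n + 1) → f.f n = g.f n := fun n hn => by
      apply T.map_injective
      rw [← cancel_mono (B.φ n (n + 1) rfl).hom, f.comm, g.comm, hn]
    induction n using Int.induction_on with
    | zero => exact h
    | succ n ih => exact up _ ih
    | pred n ih => exact down _ (by rw [sub_add_cancel]; exact ih))

instance [T.Full] [T.Faithful] : (ev T).Full where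
  map_surjective {A B} := fun (u : A.X 0 ⟶ B.X 0) => by
    let p : ∀ k : ℕ, A.X k ⟶ B.X k := fun k => Nat.rec u
      (fun k f => (A.φ k (k + 1) rfl).inv ≫ T.map f ≫ (B.φ k (k + 1) rfl).hom) k
    let q : ∀ k : ℕ, A.X (Int.negSucc k) ⟶ B.X (Int.negSucc k) := fun k => Nat.rec
      (T.preimage ((A.φ (Int.negSucc 0) 0 rfl).hom ≫ u ≫ (B.φ (Int.negSucc 0) 0 rfl).inv))
      (fun k f => T.preimage ((A.φ (Int.negSucc (k + 1)) (Int.negSucc k) rfl).hom ≫ f ≫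
        (B.φ (Int.negSucc (k + 1)) (Int.negSucc k) rfl).inv)) k
    refine ⟨⟨fun n => match n with
      | .ofNat k => p k
      | .negSucc k => q k, ?_⟩, rfl⟩
    rintro (k | (_ | k)) m rfl
    · change T.map (p k) ≫ (B.φ k (k + 1) rfl).hom = (A.φ k (k + 1) rfl).hom ≫
        (A.φ k (k + 1) rfl).inv ≫ T.map (p k) ≫ (B.φ k (k + 1) rfl).hom
      rw [Iso.hom_inv_id_assoc]
    · change T.map (T.preimage ((A.φ (Int.negSucc 0) 0 rfl).hom ≫ u ≫
        (B.φ (Int.negSucc 0) 0 rfl).inv)) ≫ (B.φ (Int.negSucc 0) 0 rfl).hom =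
        (A.φ (Int.negSucc 0) 0 rfl).hom ≫ u
      rw [T.map_preimage, assoc, assoc, Iso.inv_hom_id, comp_id]
    · change T.map (T.preimage ((A.φ (Int.negSucc (k + 1)) (Int.negSucc k) rfl).hom ≫ q k ≫
        (B.φ (Int.negSucc (k + 1)) (Int.negSucc k) rfl).inv)) ≫
        (B.φ (Int.negSucc (k + 1)) (Int.negSucc k) rfl).hom =
        (A.φ (Int.negSucc (k + 1)) (Int.negSucc k) rfl).hom ≫ q k
      simp

instance [T.EssSurj] : (ev T).EssSurj where
  mem_essImage Y := by
    let p : ℕ → D := fun k => Nat.rec Y (fun _ Z => T.obj Z) k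
    let q : ℕ → D := fun k => Nat.rec (T.objPreimage Y) (fun _ Z => T.objPreimage Z) k
    let X : ℤ → D := fun n => match n with
      | .ofNat k => p k
      | .negSucc k => q k
    have φ : ∀ n m : ℤ, n + 1 = m → Nonempty (T.obj (X n) ≅ X m) := by
      rintro (k | (_ | k)) m rfl
      · exact ⟨Iso.refl _⟩
      · exact ⟨T.objObjPreimageIso Y⟩
      · exact ⟨T.objObjPreimageIso (q k)⟩
    exact ⟨⟨X, fun n m h => (φ n m h).some⟩, ⟨Iso.refl Y⟩⟩

instance [T.IsEquivalence] : (ev T).IsEquivalence where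

/-- Shifting by one is the suspension. -/
noncomputable def shiftOneEv : shiftFunctor (Spectrum T) (1 : ℤ) ⋙ ev T ≅ ev T ⋙ T :=
  NatIso.ofComponents (fun A => (A.φ 0 (0 + 1) rfl).symm) (fun {A B} f => by
    change f.f (0 + 1) ≫ (B.φ 0 (0 + 1) rfl).inv = (A.φ 0 (0 + 1) rfl).inv ≫ T.map (f.f 0)
    rw [Iso.comp_inv_eq, assoc, f.comm, Iso.inv_hom_id_assoc])

end Spectrum

section
variable [T.IsEquivalence]

/-- The iterated suspension functors. -/
noncomputable def iterShift (n : ℤ) : D ⥤ D :=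
  (Spectrum.ev T).inv ⋙ shiftFunctor (Spectrum T) n ⋙ Spectrum.ev T

/-- The action of `ℤ` on `D` generated by an autoequivalence `T`. -/
@[reducible] noncomputable def hasShiftOfEquivalence : HasShift D ℤ :=
  (Functor.FullyFaithful.ofFullyFaithful (Spectrum.ev T).inv).hasShift (iterShift T)
    (fun n => Functor.isoWhiskerLeft ((Spectrum.ev T).inv ⋙ shiftFunctor (Spectrum T) n)
      (Spectrum.ev T).asEquivalence.unitIso.symm)

/-- The shift by one is the given autoequivalence. -/
noncomputable def shiftOneIso :
    letI := hasShiftOfEquivalence T; shiftFunctor D (1 : ℤ) ≅ T :=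
  letI := hasShiftOfEquivalence T
  show iterShift T 1 ≅ T from
    Functor.isoWhiskerLeft (Spectrum.ev T).inv Spectrum.shiftOneEv ≪≫
      Functor.isoWhiskerRight (Spectrum.ev T).asEquivalence.counitIso T

lemma shift_additive [Preadditive D] [T.Additive] (n : ℤ) :
    letI := hasShiftOfEquivalence T; (shiftFunctor D n).Additive := by
  let _ := hasShiftOfEquivalence T
  have h₁ : (shiftFunctor D (1 : ℤ)).Additive := Functor.additive_of_iso (shiftOneIso T).symm
  have h₀ : (shiftFunctor D (0 : ℤ)).Additive := Functor.additive_of_iso (shiftFunctorZero D ℤ).symm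
  have h₂ : (shiftFunctor D (-1 : ℤ)).Additive :=
    have : (shiftEquiv D (1 : ℤ)).functor.Additive := h₁
    (shiftEquiv D (1 : ℤ)).inverse_additive
  induction n using Int.induction_on with
  | zero => exact h₀
  | succ n ih => exact Functor.additive_of_iso (shiftFunctorAdd D (n : ℤ) 1).symm
  | pred n ih => exact Functor.additive_of_iso (shiftFunctorAdd D (-n : ℤ) (-1)).symm

end
end Shift

section Triangles
variable {D : Type u} [Category.{v} D] [Preadditive D] [HasZeroObject D]

/-- A class of distinguished triangles for an autoequivalence `T`, satisfying the axioms
(TR1)-(TR3) of a triangulated category. -/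
structure Triangulation (T : D ⥤ D) where
  dist : ∀ {X Y Z : D}, (X ⟶ Y) → (Y ⟶ Z) → (Z ⟶ T.obj X) → Prop
  of_iso : ∀ {X Y Z X' Y' Z' : D} {f : X ⟶ Y} {g : Y ⟶ Z} {h : Z ⟶ T.obj X} {f' : X' ⟶ Y'}
    {g' : Y' ⟶ Z'} {h' : Z' ⟶ T.obj X'} (a : X ≅ X') (b : Y ≅ Y') (c : Z ≅ Z'),
    dist f g h → f ≫ b.hom = a.hom ≫ f' → g ≫ c.hom = b.hom ≫ g' →
    h ≫ T.map a.hom = c.hom ≫ h' → dist f' g' h'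
  contractible : ∀ X : D, dist (𝟙 X) (0 : X ⟶ 0) 0
  cone : ∀ {X Y : D} (f : X ⟶ Y), ∃ (Z : D) (g : Y ⟶ Z) (h : Z ⟶ T.obj X), dist f g h
  rotate : ∀ {X Y Z : D} {f : X ⟶ Y} {g : Y ⟶ Z} {h : Z ⟶ T.obj X},
    dist f g h → dist g h (-T.map f)
  complete : ∀ {X Y Z X' Y' Z' : D} {f : X ⟶ Y} {g : Y ⟶ Z} {h : Z ⟶ T.obj X} {f' : X' ⟶ Y'}
    {g' : Y' ⟶ Z'} {h' : Z' ⟶ T.obj X'}, dist f g h → dist f' g' h' → ∀ (a : X ⟶ X')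
    (b : Y ⟶ Y'), f ≫ b = a ≫ f' →
    ∃ c : Z ⟶ Z', g ≫ c = b ≫ g' ∧ h ≫ T.map a = c ≫ h'

namespace Triangulation
variable {T : D ⥤ D} (𝓣 : Triangulation T)
  {X Y Z : D} {f : X ⟶ Y} {g : Y ⟶ Z} {h : Z ⟶ T.obj X}

lemma zero₁₂ (H : 𝓣.dist f g h) : f ≫ g = 0 := by
  obtain ⟨c, hc, -⟩ := 𝓣.complete (𝓣.contractible X) H (𝟙 X) f rfl
  rw [← hc, zero_comp]

variable [T.IsEquivalence] [T.Additive]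

lemma contractible' (W : D) : 𝓣.dist (0 : 0 ⟶ W) (𝟙 W) 0 := by
  have H := 𝓣.rotate (𝓣.rotate (𝓣.contractible (T.objPreimage W)))
  let e := T.objObjPreimageIso W
  exact 𝓣.of_iso (Iso.refl _) e ⟨-e.hom, -e.inv, by simp, by simp⟩ H (by simp) (by simp)
    (by simp)

lemma desc (H : 𝓣.dist f g h) {W : D} (y : Y ⟶ W) (hy : f ≫ y = 0) : ∃ w : Z ⟶ W, g ≫ w = y := by
  obtain ⟨c, hc, -⟩ := 𝓣.complete H (𝓣.contractible' W) 0 y (by rw [hy, zero_comp])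
  exact ⟨c, by rw [hc, comp_id]⟩

lemma isIso₃ (H : 𝓣.dist f g h) {X' Y' Z' : D} {f' : X' ⟶ Y'} {g' : Y' ⟶ Z'}
    {h' : Z' ⟶ T.obj X'} (H' : 𝓣.dist f' g' h') (a : X ≅ X') (b : Y ≅ Y') (c : Z ⟶ Z')
    (h₁ : f ≫ b.hom = a.hom ≫ f') (h₂ : g ≫ c = b.hom ≫ g') (h₃ : h ≫ T.map a.hom = c ≫ h') :
    IsIso c := by
  have z₂₃ := 𝓣.zero₁₂ (𝓣.rotate H')
  have z₃₁ : h' ≫ T.map f' = 0 := by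
    have := 𝓣.zero₁₂ (𝓣.rotate (𝓣.rotate H'))
    rwa [comp_neg, neg_eq_zero] at this
  have hepi : ∀ {W : D} (w : Z' ⟶ W), c ≫ w = 0 → w = 0 := fun {W} w hw => by
    obtain ⟨v, rfl⟩ := 𝓣.desc (𝓣.rotate H') w (by
      rw [← cancel_epi b.hom, ← assoc, ← h₂, assoc, hw, comp_zero, comp_zero])
    obtain ⟨t, ht⟩ := 𝓣.desc (𝓣.rotate (𝓣.rotate H)) (T.map a.hom ≫ v) (by
      rw [← assoc, h₃, assoc, hw])
    have : T.map f' ≫ T.map b.inv ≫ (-t) = v := by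
      rw [← cancel_epi (T.map a.hom), ← ht, ← T.map_comp_assoc, ← h₁, ← T.map_comp_assoc, assoc,
        Iso.hom_inv_id, comp_id, comp_neg, neg_comp]
    rw [← this, reassoc_of% z₃₁, zero_comp]
  obtain ⟨r, hr⟩ := 𝓣.desc H' (b.inv ≫ g) (by
    rw [← cancel_epi a.hom, ← assoc, ← h₁, assoc, Iso.hom_inv_id_assoc, 𝓣.zero₁₂ H, comp_zero])
  obtain ⟨v, hv⟩ := 𝓣.desc (𝓣.rotate H) (𝟙 Z - c ≫ r) (by
    rw [comp_sub, comp_id, reassoc_of% h₂, hr, Iso.hom_inv_id_assoc, sub_self])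
  let s := r + h' ≫ T.map a.inv ≫ v
  have hs : c ≫ s = 𝟙 Z := by
    simp only [s]
    rw [comp_add, ← reassoc_of% h₃, ← T.map_comp_assoc, Iso.hom_inv_id, T.map_id, id_comp, hv]
    abel
  refine ⟨s, hs, ?_⟩
  rw [← sub_eq_zero]
  apply hepi
  rw [comp_sub, reassoc_of% hs, comp_id, sub_self]

lemma dist_of_rotate (H : 𝓣.dist g h (-T.map f)) : 𝓣.dist f g h := by
  obtain ⟨Z', g', h', H'⟩ := 𝓣.cone f
  have H₃ := 𝓣.rotate (𝓣.rotate H)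
  have H₃' := 𝓣.rotate (𝓣.rotate (𝓣.rotate H'))
  obtain ⟨c, hc, hc'⟩ := 𝓣.complete H₃' H₃ (𝟙 _) (𝟙 _) (by simp)
  have : IsIso c := 𝓣.isIso₃ H₃' H₃ (Iso.refl _) (Iso.refl _) c (by simp) (by simpa using hc)
    (by simpa using hc')
  obtain ⟨c, rfl⟩ := T.map_surjective c
  have : IsIso c := isIso_of_reflects_iso c T
  refine 𝓣.of_iso (Iso.refl X) (Iso.refl Y) (asIso c) H' (by simp) ?_ ?_
  · apply T.map_injective
    simpa using hc
  · apply T.map_injective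
    simpa using hc'

/-- The pretriangulated structure for the `ℤ`-shift generated by the autoequivalence. -/
@[reducible] noncomputable def pretriangulated :
    letI := hasShiftOfEquivalence T
    haveI := shift_additive T
    Pretriangulated D :=
  letI := hasShiftOfEquivalence T
  haveI := shift_additive T
  { distinguishedTriangles :=
      { t | 𝓣.dist t.mor₁ t.mor₂ (t.mor₃ ≫ (shiftOneIso T).hom.app t.obj₁) }
    isomorphic_distinguished := fun t ht t' e => by
      refine 𝓣.of_iso (Triangle.π₁.mapIso e.symm) (Triangle.π₂.mapIso e.symm)
        (Triangle.π₃.mapIso e.symm) ht e.inv.comm₁ e.inv.comm₂ ?_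
      have := e.inv.comm₃
      change (t.mor₃ ≫ (shiftOneIso T).hom.app t.obj₁) ≫ T.map e.inv.hom₁ =
        e.inv.hom₃ ≫ t'.mor₃ ≫ (shiftOneIso T).hom.app t'.obj₁
      rw [assoc, ← (shiftOneIso T).hom.naturality, reassoc_of% this]
    contractible_distinguished := fun X => by
      change 𝓣.dist (𝟙 X) (0 : X ⟶ 0) (0 ≫ (shiftOneIso T).hom.app X)
      rw [zero_comp]
      exact 𝓣.contractible X
    distinguished_cocone_triangle := fun {X Y} f => by
      obtain ⟨Z, g, h, H⟩ := 𝓣.cone f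
      refine ⟨Z, g, h ≫ (shiftOneIso T).inv.app X, ?_⟩
      change 𝓣.dist f g ((h ≫ (shiftOneIso T).inv.app X) ≫ (shiftOneIso T).hom.app X)
      simpa using H
    rotate_distinguished_triangle := fun t => by
      obtain ⟨X, Y, Z, f, g, h⟩ := t
      have nat := (shiftOneIso T).hom.naturality f
      have key : 𝓣.dist g h ((-(shiftFunctor D (1 : ℤ)).map f) ≫ (shiftOneIso T).hom.app Y) ↔
          𝓣.dist g (h ≫ (shiftOneIso T).hom.app X) (-T.map f) := by
        constructor
        · intro H
          exact 𝓣.of_iso (Iso.refl _) (Iso.refl _) ((shiftOneIso T).app X) H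
            (by simp) (by simp) (by simp [nat])
        · intro H
          exact 𝓣.of_iso (Iso.refl _) (Iso.refl _) ((shiftOneIso T).app X).symm H
            (by simp) (by simp) (by simp [nat])
      change 𝓣.dist f g (h ≫ (shiftOneIso T).hom.app X) ↔
        𝓣.dist g h ((-(shiftFunctor D (1 : ℤ)).map f) ≫ (shiftOneIso T).hom.app Y)
      rw [key]
      exact ⟨𝓣.rotate, 𝓣.dist_of_rotate⟩
    complete_distinguished_triangle_morphism := fun t t' ht ht' a b hab => by
      obtain ⟨c, hc, hc'⟩ := 𝓣.complete ht ht' a b hab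
      refine ⟨c, hc, ?_⟩
      rw [← cancel_mono ((shiftOneIso T).hom.app t'.obj₁), assoc, assoc, ← hc',
        (shiftOneIso T).hom.naturality, assoc] }

end Triangulation
end Triangles

section StabTriangulated
variable {E : Type u} [Category.{v} E] [Preadditive E]

namespace ExactStructure
variable {S : ExactStructure E}

lemma Conf.of_isPushout {X Y Z X' Y' : E} {f : X ⟶ Y} {g : Y ⟶ Z} (h : S.Conf f g)
    {a : X ⟶ X'} {b : Y ⟶ Y'} {f' : X' ⟶ Y'} (hp : IsPushout f a b f') {g' : Y' ⟶ Z}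
    (h₁ : b ≫ g' = g) (h₂ : f' ≫ g' = 0) : S.Conf f' g' := by
  obtain ⟨Y'', b', f'', g'', hp', hc, hg⟩ := h.pushout a
  refine hc.of_iso (Iso.refl _) (hp'.isoIsPushout _ _ hp) (Iso.refl _) (by simp) ?_
  apply hp'.hom_ext
  · simp [h₁, hg]
  · simp [h₂, hc.zero]

lemma Inflation.of_isPushout {X Y X' Y' : E} {f : X ⟶ Y} (h : Inflation S.conflation f)
    {a : X ⟶ X'} {b : Y ⟶ Y'} {f' : X' ⟶ Y'} (hp : IsPushout f a b f') :
    Inflation S.conflation f' := by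
  obtain ⟨Z, g, w, h⟩ := h
  exact (Conf.of_isPushout (S := S) ⟨w, h⟩ hp (g' := hp.desc g 0 (by simp [w])) (by simp)
    (by simp)).inflation

variable [HasZeroObject E] [HasBinaryBiproducts E]

lemma inflation_lift {X Y I : E} (u : X ⟶ Y) {t : X ⟶ I} (ht : Inflation S.conflation t) :
    Inflation S.conflation (biprod.lift u t) := by
  have h₁ : Inflation S.conflation (biprod.lift u (𝟙 X)) := by
    obtain ⟨K, k, w, hk⟩ := S.id_deflation Y
    have hk' : S.Conf k (𝟙 Y) := ⟨w, hk⟩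
    have hk0 : k = 0 := by simpa using w
    have := hk'.mono
    have hK : IsZero K := by
      rw [IsZero.iff_id_eq_zero, ← cancel_mono k, hk0, comp_zero, comp_zero]
    refine Inflation.of_isPushout hk'.inflation (a := (0 : K ⟶ X)) (b := biprod.inl)
      ⟨⟨hK.eq_of_src _ _⟩, ⟨PushoutCocone.IsColimit.mk _
        (fun s => biprod.desc s.inl (s.inr - u ≫ s.inl)) (by simp) (by simp) ?_⟩⟩
    intro s m hm₁ hm₂
    have e : biprod.lift u (𝟙 X) = u ≫ biprod.inl + biprod.inr := by ext <;> simp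
    rw [e, add_comp, assoc, hm₁] at hm₂
    ext
    · simp [hm₁]
    · simp [← hm₂]
  have h₂ : Inflation S.conflation (biprod.map (𝟙 Y) t) := by
    refine Inflation.of_isPushout ht (a := biprod.inr) (b := biprod.inr)
      ⟨⟨by simp⟩, ⟨PushoutCocone.IsColimit.mk _
        (fun s => biprod.desc (biprod.inl ≫ s.inr) s.inl) (by simp) ?_ ?_⟩⟩
    · intro s
      ext
      · simp
      · simpa using s.condition
    · intro s m hm₁ hm₂
      ext
      · simp [← hm₂]
      · simp [← hm₁]
  have e : biprod.lift u t = biprod.lift u (𝟙 X) ≫ biprod.map (𝟙 Y) t := by ext <;> simp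
  rw [e]
  exact S.comp_inflation _ _ h₁ h₂

lemma Conf.isIso_of_projInj {J Q Z : E} {k : J ⟶ Q} {g : Q ⟶ Z} (h : S.Conf k g)
    (hJ : S.ProjInj J) : IsIso (S.toStab.map g) := by
  obtain ⟨r, hr⟩ := hJ.2 k h.inflation (𝟙 J)
  obtain ⟨s, hs⟩ := h.desc (𝟙 Q - r ≫ k) (by rw [comp_sub, reassoc_of% hr, comp_id, sub_self])
  have := h.epi
  have hs' : s ≫ g = 𝟙 Z := by
    rw [← cancel_epi g, reassoc_of% hs, sub_comp, assoc, h.zero, comp_zero, sub_zero, id_comp,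
      comp_id]
  refine ⟨S.toStab.map s, ?_, ?_⟩
  · rw [← S.toStab.map_comp, hs, ← S.toStab.map_id, ← sub_eq_zero, ← S.toStab.map_sub,
      toStab_map_eq_zero_iff]
    exact ⟨J, -r, k, hJ, by simp⟩
  · rw [← S.toStab.map_comp, hs', S.toStab.map_id]

variable [S.IsFrobenius]

variable (S) in
/-- The class in the stable category of a map to the suspension. -/
noncomputable def toSusp {Q A : E} (p : Q ⟶ S.cosyzygy A) : S.toStab.obj Q ⟶ S.susp.obj (S.toStab.obj A) :=
  S.toStab.map p

lemma map_toSusp {Q' Q A : E} (q : Q' ⟶ Q) (p : Q ⟶ S.cosyzygy A) :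
    S.toStab.map q ≫ S.toSusp p = S.toSusp (q ≫ p) := (S.toStab.map_comp q p).symm

lemma toSusp_susp {Q A B : E} (p : Q ⟶ S.cosyzygy A) (a : A ⟶ B) :
    S.toSusp p ≫ S.susp.map (S.toStab.map a) = S.toSusp (p ≫ S.mapCosyzygy a) :=
  (S.toStab.map_comp p (S.mapCosyzygy a)).symm

lemma toSusp_neg {Q A : E} (p : Q ⟶ S.cosyzygy A) : S.toSusp (-p) = -S.toSusp p :=
  S.toStab.map_neg

lemma toSusp_eq {Q A : E} {p q : Q ⟶ S.cosyzygy A} {P : E} (hP : S.ProjInj P) (s : Q ⟶ P)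
    (t : P ⟶ S.cosyzygy A) (h : p - q = s ≫ t) : S.toSusp p = S.toSusp q :=
  (S.toStab_map_eq_iff p q).2 ⟨P, s, t, hP, h⟩

variable (S) in
/-- Standard triangles in the stable category: up to isomorphism `A ⟶ B ⟶ Q ⟶ A[1]`, where
`Q` is the pushout of `u : A ⟶ B` along the chosen admissible `A ⟶ S.hull A`, and `Q ⟶ A[1]` is
the induced map to `S.cosyzygy A`. -/
def StdDist {X Y Z : S.Stab} (f : X ⟶ Y) (g : Y ⟶ Z) (h : Z ⟶ S.susp.obj X) : Prop :=
  ∃ (A B Q : E) (u : A ⟶ B) (i : S.hull A ⟶ Q) (j : B ⟶ Q) (p : Q ⟶ S.cosyzygy A)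
    (a : S.toStab.obj A ≅ X) (b : S.toStab.obj B ≅ Y) (c : S.toStab.obj Q ≅ Z),
    IsPushout (S.toHull A) u i j ∧ i ≫ p = S.fromHull A ∧ j ≫ p = 0 ∧
    S.toStab.map u ≫ b.hom = a.hom ≫ f ∧ S.toStab.map j ≫ c.hom = b.hom ≫ g ∧
    S.toSusp p ≫ S.susp.map a.hom = c.hom ≫ h

lemma exists_cone {A B : E} (u : A ⟶ B) : ∃ (Q : E) (i : S.hull A ⟶ Q) (j : B ⟶ Q)
    (p : Q ⟶ S.cosyzygy A), IsPushout (S.toHull A) u i j ∧ i ≫ p = S.fromHull A ∧ j ≫ p = 0 := by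
  obtain ⟨Q, i, j, p, hp, hc, hi⟩ := (S.conf_hull A).pushout u
  exact ⟨Q, i, j, p, hp, hi, hc.zero⟩

lemma StdDist.rotate {X Y Z : S.Stab} {f : X ⟶ Y} {g : Y ⟶ Z} {h : Z ⟶ S.susp.obj X}
    (H : S.StdDist f g h) : S.StdDist g h (-S.susp.map f) := by
  obtain ⟨A, B, Q, u, i, j, p, a, b, c, hp, hi, hj, h₁, h₂, h₃⟩ := H
  obtain ⟨Q₂, i₂, j₂, p₂, hp₂, hi₂, hj₂⟩ := exists_cone (S := S) j
  have hc : S.Conf j p := (S.conf_hull A).of_isPushout hp hi hj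
  let q : Q₂ ⟶ S.cosyzygy A := hp₂.desc 0 p (by simp [hj])
  have hq₁ : i₂ ≫ q = 0 := by simp [q]
  have hq₂ : j₂ ≫ q = p := by simp [q]
  have hcq : S.Conf i₂ q := hc.of_isPushout hp₂.flip hq₂ hq₁
  have : IsIso (S.toSusp q) := hcq.isIso_of_projInj (S.projInj_hull B)
  refine ⟨B, Q, Q₂, j, i₂, j₂, p₂, b, c, asIso (S.toSusp q) ≪≫ S.susp.mapIso a, hp₂, hi₂, hj₂,
    h₂, ?_, ?_⟩
  · simp only [Iso.trans_hom, asIso_hom, Functor.mapIso_hom]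
    rw [← assoc, map_toSusp, hq₂, h₃]
  · simp only [Iso.trans_hom, asIso_hom, Functor.mapIso_hom]
    rw [comp_neg, assoc, ← S.susp.map_comp, ← h₁, S.susp.map_comp, ← assoc, toSusp_susp,
      ← neg_comp, ← toSusp_neg]
    congr 1
    let e : Q ⟶ S.hull B := hp.desc (S.mapHull u) (S.toHull B) (S.toHull_mapHull u)
    have he : e ≫ S.fromHull B = p ≫ S.mapCosyzygy u := by
      apply hp.hom_ext
      · simp only [e, IsPushout.inl_desc_assoc]
        rw [← fromHull_mapCosyzygy, reassoc_of% hi]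
      · simp only [e, IsPushout.inr_desc_assoc]
        rw [(S.conf_hull B).zero, reassoc_of% hj, zero_comp]
    refine toSusp_eq (S.projInj_hull B) (hp₂.desc (𝟙 _) e (by simp [e])) (S.fromHull B) ?_
    apply hp₂.hom_ext
    · simp [hi₂, reassoc_of% hq₁]
    · simp [hj₂, reassoc_of% hq₂, he]

lemma StdDist.complete {X Y Z X' Y' Z' : S.Stab} {f : X ⟶ Y} {g : Y ⟶ Z}
    {h : Z ⟶ S.susp.obj X} {f' : X' ⟶ Y'} {g' : Y' ⟶ Z'} {h' : Z' ⟶ S.susp.obj X'}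
    (H : S.StdDist f g h) (H' : S.StdDist f' g' h') (α : X ⟶ X') (β : Y ⟶ Y')
    (hαβ : f ≫ β = α ≫ f') :
    ∃ γ : Z ⟶ Z', g ≫ γ = β ≫ g' ∧ h ≫ S.susp.map α = γ ≫ h' := by
  obtain ⟨A, B, Q, u, i, j, p, a, b, c, hp, hi, hj, h₁, h₂, h₃⟩ := H
  obtain ⟨A', B', Q', u', i', j', p', a', b', c', hp', hi', hj', h₁', h₂', h₃'⟩ := H'
  obtain ⟨α₀, hα₀⟩ := S.toStab.map_surjective (a.hom ≫ α ≫ a'.inv)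
  obtain ⟨β₀, hβ₀⟩ := S.toStab.map_surjective (b.hom ≫ β ≫ b'.inv)
  have hrel : S.toStab.map (u ≫ β₀) = S.toStab.map (α₀ ≫ u') := by
    rw [S.toStab.map_comp, S.toStab.map_comp, hα₀, hβ₀, reassoc_of% h₁, reassoc_of% hαβ,
      ← cancel_mono b'.hom]
    simp only [assoc, Iso.inv_hom_id, comp_id, h₁', Iso.inv_hom_id_assoc]
  rw [toStab_map_eq_iff] at hrel
  obtain ⟨P, s, t, hP, hst⟩ := hrel
  obtain ⟨k, hk⟩ := hP.2 (S.toHull A) (S.conf_hull A).inflation s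
  let γ₀ : Q ⟶ Q' := hp.desc (S.mapHull α₀ ≫ i' + k ≫ t ≫ j') (β₀ ≫ j') (by
    rw [comp_add, reassoc_of% (S.toHull_mapHull), reassoc_of% hk, ← reassoc_of% hst, sub_comp, assoc, assoc,
      hp'.w]
    abel)
  have hγ₁ : j ≫ γ₀ = β₀ ≫ j' := by simp [γ₀]
  have hγ₂ : γ₀ ≫ p' = p ≫ S.mapCosyzygy α₀ := by
    apply hp.hom_ext
    · simp only [γ₀, IsPushout.inl_desc_assoc]
      rw [add_comp, assoc, assoc, assoc, hi', hj', comp_zero, comp_zero, add_zero, reassoc_of% hi,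
        fromHull_mapCosyzygy]
    · rw [reassoc_of% hγ₁, hj', reassoc_of% hj, comp_zero, zero_comp]
  refine ⟨c.inv ≫ S.toStab.map γ₀ ≫ c'.hom, ?_, ?_⟩
  · rw [← cancel_epi b.hom, ← reassoc_of% h₂, Iso.hom_inv_id_assoc, ← S.toStab.map_comp_assoc, hγ₁,
      S.toStab.map_comp, hβ₀, assoc, h₂']
    simp
  · rw [← cancel_epi c.hom, ← reassoc_of% h₃, assoc, assoc, Iso.hom_inv_id_assoc, ← h₃',
      ← assoc (S.toStab.map γ₀), map_toSusp, hγ₂, ← toSusp_susp, hα₀, assoc, ← S.susp.map_comp,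
      ← S.susp.map_comp]
    simp

variable (S) in
/-- The triangulation of the stable category of a Frobenius category. -/
noncomputable def triangulation : Triangulation S.susp where
  dist := S.StdDist
  of_iso := by
    rintro X Y Z X' Y' Z' f g h f' g' h' a' b' c'
      ⟨A, B, Q, u, i, j, p, a, b, c, hp, hi, hj, h₁, h₂, h₃⟩ e₁ e₂ e₃
    refine ⟨A, B, Q, u, i, j, p, a ≪≫ a', b ≪≫ b', c ≪≫ c', hp, hi, hj, ?_, ?_, ?_⟩
    · simp [reassoc_of% h₁, e₁]
    · simp [reassoc_of% h₂, e₂]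
    · simp [reassoc_of% h₃, e₃]
  contractible X := by
    obtain ⟨A, rfl⟩ := Stab.exists_rep X
    have hz : IsZero (S.toStab.obj (S.hull A)) := isZero_toStab_obj (S.projInj_hull A)
    refine ⟨A, A, S.hull A, 𝟙 A, 𝟙 _, S.toHull A, S.fromHull A, Iso.refl _, Iso.refl _,
      hz.iso (isZero_zero _), IsPushout.of_vert_isIso ⟨by simp⟩, by simp, (S.conf_hull A).zero,
      by simp, (isZero_zero _).eq_of_tgt _ _, hz.eq_of_src _ _⟩
  cone {X Y} f := by
    obtain ⟨A, rfl⟩ := Stab.exists_rep X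
    obtain ⟨B, rfl⟩ := Stab.exists_rep Y
    obtain ⟨u, rfl⟩ := S.toStab.map_surjective f
    obtain ⟨Q, i, j, p, hp, hi, hj⟩ := exists_cone (S := S) u
    exact ⟨_, S.toStab.map j, S.toSusp p, A, B, Q, u, i, j, p, Iso.refl _, Iso.refl _, Iso.refl _,
      hp, hi, hj, by simp, by simp, by simp⟩
  rotate := StdDist.rotate
  complete := StdDist.complete

noncomputable instance : HasShift S.Stab ℤ := hasShiftOfEquivalence S.susp

instance (n : ℤ) : (shiftFunctor S.Stab n).Additive := shift_additive S.susp n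

/-- The triangulated structure of the stable category of a Frobenius category. -/
noncomputable instance : Pretriangulated S.Stab := S.triangulation.pretriangulated

variable (S) in
/-- The shift by one on the stable category is the suspension. -/
noncomputable def shiftIso : shiftFunctor S.Stab (1 : ℤ) ≅ S.susp := shiftOneIso S.susp

lemma mk_mem_distTriang_iff {X Y Z : S.Stab} (f : X ⟶ Y) (g : Y ⟶ Z) (h : Z ⟶ S.susp.obj X) :
    Triangle.mk f g (h ≫ S.shiftIso.inv.app X) ∈ distTriang S.Stab ↔ S.StdDist f g h := by
  change S.StdDist f g ((h ≫ (shiftOneIso S.susp).inv.app X) ≫ (shiftOneIso S.susp).hom.app X) ↔ _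
  rw [assoc, Iso.inv_hom_id_app, comp_id]

/-- An admissible short exact sequence gives a distinguished triangle. -/
lemma Conf.stdDist {X Y Z : E} {f : X ⟶ Y} {g : Y ⟶ Z} (H : S.Conf f g) {e : Y ⟶ S.hull X}
    {h : Z ⟶ S.cosyzygy X} (he : f ≫ e = S.toHull X) (hh : g ≫ h = e ≫ S.fromHull X) :
    S.StdDist (S.toStab.map f) (S.toStab.map g) (-S.toSusp h) := by
  obtain ⟨Q, i, j, p, hp, hi, hj⟩ := exists_cone (S := S) f
  let c : Q ⟶ Z := hp.desc 0 g (by simp [H.zero])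
  have hc₁ : i ≫ c = 0 := by simp [c]
  have hc₂ : j ≫ c = g := by simp [c]
  have : IsIso (S.toStab.map c) :=
    (H.of_isPushout hp.flip hc₂ hc₁).isIso_of_projInj (S.projInj_hull X)
  refine ⟨X, Y, Q, f, i, j, p, Iso.refl _, Iso.refl _, asIso (S.toStab.map c), hp, hi, hj,
    by simp, ?_, ?_⟩
  · rw [asIso_hom, ← S.toStab.map_comp, hc₂]
    simp
  · rw [asIso_hom, comp_neg, map_toSusp, ← toSusp_neg, Iso.refl_hom, S.susp.map_id, comp_id]
    refine toSusp_eq (S.projInj_hull X) (hp.desc (𝟙 _) e (by simp [he])) (S.fromHull X) ?_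
    apply hp.hom_ext
    · simp [hi, reassoc_of% hc₁]
    · simp [hj, reassoc_of% hc₂, hh]

lemma exists_inflation {X : E} {Y : E} (u : X ⟶ Y) : ∃ (Y' : E) (u' : X ⟶ Y') (r : Y' ⟶ Y),
    Inflation S.conflation u' ∧ u' ≫ r = u ∧ IsIso (S.toStab.map r) := by
  refine ⟨Y ⊞ S.hull X, biprod.lift u (S.toHull X), biprod.fst,
    inflation_lift u (S.conf_hull X).inflation, by simp, S.toStab.map biprod.inl, ?_, ?_⟩
  · rw [← S.toStab.map_comp, ← S.toStab.map_id, eq_comm, toStab_map_eq_iff]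
    refine ⟨_, biprod.snd, biprod.inr, S.projInj_hull X, ?_⟩
    rw [sub_eq_iff_eq_add', biprod.total]
  · rw [← S.toStab.map_comp, biprod.inl_fst, S.toStab.map_id]

instance : IsTriangulated S.Stab := IsTriangulated.mk' (by
  intro X' Y' Z' φ ψ
  obtain ⟨X, rfl⟩ := Stab.exists_rep X'
  obtain ⟨Y₀, rfl⟩ := Stab.exists_rep Y'
  obtain ⟨Z₀, rfl⟩ := Stab.exists_rep Z'
  obtain ⟨f₀, rfl⟩ := S.toStab.map_surjective φ
  obtain ⟨g₀, rfl⟩ := S.toStab.map_surjective ψ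
  obtain ⟨Y, f, r, ⟨A, a, wa, ha⟩, rfl, hr⟩ := exists_inflation (S := S) f₀
  obtain ⟨Z, g, s, ⟨B, b, wb, hb⟩, hgs, hs⟩ := exists_inflation (S := S) (r ≫ g₀)
  have Ca : S.Conf f a := ⟨wa, ha⟩
  have Cb : S.Conf g b := ⟨wb, hb⟩
  obtain ⟨D, d, wd, hd⟩ := S.comp_inflation f g Ca.inflation Cb.inflation
  have Cd : S.Conf (f ≫ g) d := ⟨wd, hd⟩
  have := Ca.epi
  have := Cd.epi
  obtain ⟨m₁, hm₁⟩ := Ca.desc (g ≫ d) (by rw [← assoc, Cd.zero])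
  obtain ⟨m₃, hm₃⟩ := Cd.desc b (by rw [assoc, Cb.zero, comp_zero])
  have hpo : IsPushout g a d m₁ := by
    have hex : ∀ t : PushoutCocone g a, ∃ l, d ≫ l = t.inl := fun t => Cd.desc t.inl (by
      rw [assoc, t.condition, reassoc_of% Ca.zero, zero_comp])
    choose l hl using hex
    refine ⟨⟨hm₁.symm⟩, ⟨PushoutCocone.IsColimit.mk _ l hl ?_ ?_⟩⟩
    · intro t
      rw [← cancel_epi a, reassoc_of% hm₁, hl, t.condition]
    · intro t m h₁ _
      rw [← cancel_epi d, h₁, hl]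
  have Cm : S.Conf m₁ m₃ := Cb.of_isPushout hpo hm₃ (by
    rw [← cancel_epi a, reassoc_of% hm₁, hm₃, Cb.zero, comp_zero])
  obtain ⟨eZ, heZ⟩ := (S.projInj_hull X).2 (f ≫ g) Cd.inflation (S.toHull X)
  obtain ⟨hD, hhD⟩ := Cd.desc (eZ ≫ S.fromHull X) (by
    rw [← assoc, heZ, (S.conf_hull X).zero])
  obtain ⟨eB, heB⟩ := (S.projInj_hull Y).2 g Cb.inflation (S.toHull Y)
  obtain ⟨hB, hhB⟩ := Cb.desc (eB ≫ S.fromHull Y) (by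
    rw [reassoc_of% heB, (S.conf_hull Y).zero])
  obtain ⟨eA, heA⟩ := (S.projInj_hull A).2 m₁ Cm.inflation (S.toHull A)
  obtain ⟨hA, hhA⟩ := Cm.desc (eA ≫ S.fromHull A) (by
    rw [reassoc_of% heA, (S.conf_hull A).zero])
  have T₁₂ := (mk_mem_distTriang_iff _ _ _).2 (Ca.stdDist (e := g ≫ eZ) (h := m₁ ≫ hD)
    (by rw [← assoc, heZ]) (by rw [reassoc_of% hm₁, hhD, assoc]))
  have T₂₃ := (mk_mem_distTriang_iff _ _ _).2 (Cb.stdDist heB hhB)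
  have T₁₃ := (mk_mem_distTriang_iff _ _ _).2 (Cd.stdDist heZ hhD)
  have Tm := (mk_mem_distTriang_iff _ _ _).2 (Cm.stdDist heA hhA)
  rw [S.toStab.map_comp f g] at T₁₃
  refine ⟨_, _, _, _, _, _, S.toStab.map f, S.toStab.map g, Iso.refl _,
    (asIso (S.toStab.map r)).symm, (asIso (S.toStab.map s)).symm, ?_, ?_, _, _, T₁₂, _, _, T₂₃,
    _, _, T₁₃, ⟨⟨S.toStab.map m₁, S.toStab.map m₃, ?_, ?_, ?_, ?_, ?_⟩⟩⟩
  · rw [Iso.symm_hom, asIso_inv, IsIso.comp_inv_eq, Iso.refl_hom, id_comp, S.toStab.map_comp]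
  · rw [Iso.symm_hom, Iso.symm_hom, asIso_inv, asIso_inv, IsIso.comp_inv_eq, assoc,
      IsIso.eq_inv_comp, ← S.toStab.map_comp, ← S.toStab.map_comp, hgs]
  · rw [← S.toStab.map_comp, ← S.toStab.map_comp, hm₁]
  · rw [← assoc, comp_neg, map_toSusp]
  · rw [← S.toStab.map_comp, hm₃]
  · rw [assoc, ← S.shiftIso.inv.naturality, ← assoc, neg_comp, toSusp_susp, ← assoc, comp_neg,
      map_toSusp]
    congr 2
    obtain ⟨k, hk⟩ := Cd.desc (eZ ≫ S.mapHull f - eB) (by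
      rw [comp_sub, ← assoc, heZ, toHull_mapHull, assoc, heB, sub_self])
    refine toSusp_eq (S.projInj_hull Y) k (S.fromHull Y) ?_
    rw [← cancel_epi d, comp_sub, reassoc_of% hhD, reassoc_of% hm₃, hhB, reassoc_of% hk,
      fromHull_mapCosyzygy, sub_comp, assoc]
  · rw [assoc, ← S.shiftIso.inv.naturality, ← assoc, neg_comp, toSusp_susp]
    have : S.toSusp (hB ≫ S.mapCosyzygy a) = S.toSusp hA :=
      Cb.key (S.conf_hull A).zero (S.projInj_hull A) (a := a) (a' := a) (b := eB ≫ S.mapHull a)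
        (b' := d ≫ eA) (by rw [reassoc_of% heB, toHull_mapHull])
        (by rw [← reassoc_of% hm₁, heA]) (by rw [reassoc_of% hhB, fromHull_mapCosyzygy, assoc])
        (by rw [← hm₃, assoc, hhA, assoc]) rfl
    rw [this]
    exact Tm)

end ExactStructure
end StabTriangulated

section MFCat
variable {C : Type u} [Category.{v} C]

/-- The composite `X i ⟶ X (i + 1) ⟶ ⋯ ⟶ X j` of `k` consecutive maps, where `j = i + k`. -/
def dpow {n : ℕ} {X : ZMod n → C} (d : ∀ i, X i ⟶ X (i + 1)) (i : ZMod n) :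
    ∀ (k : ℕ) (j : ZMod n), i + (k : ZMod n) = j → (X i ⟶ X j)
  | 0, _, h => eqToHom (congrArg X (by rw [← h, Nat.cast_zero, add_zero]))
  | k + 1, _, h => dpow d i k _ rfl ≫ d (i + (k : ZMod n)) ≫
      eqToHom (congrArg X (by rw [← h, Nat.cast_succ, add_assoc]))

section
variable {n : ℕ} {X : ZMod n → C} (d : ∀ i, X i ⟶ X (i + 1))

lemma dpow_zero (i : ZMod n) : dpow d i 0 i (by simp) = 𝟙 _ := rfl

lemma dpow_eqToHom (i : ZMod n) (k : ℕ) (j j' : ZMod n) (h : i + (k : ZMod n) = j) (e : j = j') :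
    dpow d i k j h ≫ eqToHom (congrArg X e) = dpow d i k j' (h.trans e) := by
  subst e
  simp

lemma dpow_succ (i : ZMod n) (k : ℕ) (j : ZMod n) (h : i + (k : ZMod n) = j) :
    dpow d i (k + 1) (j + 1) (by rw [← h, Nat.cast_succ, add_assoc]) = dpow d i k j h ≫ d j := by
  subst h
  simp [dpow]

lemma dpow_succ' (i : ZMod n) (k : ℕ) (j : ZMod n) (h : i + 1 + (k : ZMod n) = j) :
    dpow d i (k + 1) j (by rw [← h, Nat.cast_succ, add_assoc, add_comm (k : ZMod n)]) =
      d i ≫ dpow d (i + 1) k j h := by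
  induction k generalizing j with
  | zero =>
    obtain rfl : i + 1 = j := by simpa using h
    rw [dpow_zero, comp_id]
    have := dpow_succ d i 0 i (by simp)
    rw [this, dpow_zero, id_comp]
  | succ k ih =>
    obtain ⟨j, rfl⟩ : ∃ j', j = j' + 1 := ⟨j - 1, by ring⟩
    have hj : i + 1 + (k : ZMod n) = j := by
      rw [Nat.cast_succ, ← add_assoc] at h
      exact add_right_cancel h
    rw [dpow_succ d i (k + 1) j (by rw [← hj, Nat.cast_succ, add_assoc, add_comm (k : ZMod n)]),
      ih j hj, dpow_succ d (i + 1) k j hj, assoc]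

lemma dpow_naturality {Y : ZMod n → C} (d' : ∀ i, Y i ⟶ Y (i + 1)) (f : ∀ i, X i ⟶ Y i)
    (hf : ∀ i, f i ≫ d' i = d i ≫ f (i + 1)) (i : ZMod n) (k : ℕ) (j : ZMod n)
    (h : i + (k : ZMod n) = j) : f i ≫ dpow d' i k j h = dpow d i k j h ≫ f j := by
  induction k generalizing j with
  | zero =>
    obtain rfl : i = j := by simpa using h
    rw [dpow_zero, dpow_zero, id_comp, comp_id]
  | succ k ih =>
    obtain ⟨j, rfl⟩ : ∃ j', j = j' + 1 := ⟨j - 1, by ring⟩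
    have hj : i + (k : ZMod n) = j := by
      rw [Nat.cast_succ, ← add_assoc] at h
      exact add_right_cancel h
    rw [dpow_succ d i k j hj, dpow_succ d' i k j hj, ← assoc, ih j hj, assoc, hf, assoc]

end

/-- Matrix factorizations with `n` steps of `W`: objects `X i` indexed by `ℤ/n` and maps
`X i ⟶ X (i + 1)`, such that every composite of `n` consecutive maps is the action of `W`. -/
structure MF (n : ℕ) (W : 𝟭 C ⟶ 𝟭 C) where
  X : ZMod n → C
  d : ∀ i, X i ⟶ X (i + 1)
  dpow_eq : ∀ i, dpow d i n i (by simp) = W.app (X i)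

namespace MF
variable {n : ℕ} {W : 𝟭 C ⟶ 𝟭 C}

/-- Morphisms of matrix factorizations. -/
@[ext] structure Hom (M N : MF n W) where
  f : ∀ i, M.X i ⟶ N.X i
  comm : ∀ i, f i ≫ N.d i = M.d i ≫ f (i + 1)

instance : Category (MF n W) where
  Hom := Hom
  id M := ⟨fun i => 𝟙 _, fun i => by rw [id_comp, comp_id]⟩
  comp f g := ⟨fun i => f.f i ≫ g.f i, fun i => by rw [assoc, g.comm, ← assoc, f.comm, assoc]⟩
  id_comp f := by apply Hom.ext; funext; apply id_comp
  comp_id f := by apply Hom.ext; funext; apply comp_id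
  assoc f g h := by apply Hom.ext; funext; apply assoc

lemma hom_ext {M N : MF n W} {f g : M ⟶ N} (h : ∀ i, f.f i = g.f i) : f = g :=
  Hom.ext (funext h)

@[simp] lemma id_f (M : MF n W) (i : ZMod n) : Hom.f (𝟙 M) i = 𝟙 _ := rfl
@[simp] lemma comp_f {M N L : MF n W} (f : M ⟶ N) (g : N ⟶ L) (i : ZMod n) :
  (f ≫ g).f i = f.f i ≫ g.f i := rfl

lemma congr_f {M N : MF n W} {f g : M ⟶ N} (h : f = g) (i : ZMod n) : f.f i = g.f i := by rw [h]

lemma dpow_f {M N : MF n W} (f : M ⟶ N) (i : ZMod n) (k : ℕ) (j : ZMod n)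
    (h : i + (k : ZMod n) = j) : f.f i ≫ dpow N.d i k j h = dpow M.d i k j h ≫ f.f j :=
  dpow_naturality M.d N.d f.f f.comm i k j h

/-- Isomorphisms can be checked on components. -/
def isoMk {M N : MF n W} (e : ∀ i, M.X i ≅ N.X i)
    (h : ∀ i, (e i).hom ≫ N.d i = M.d i ≫ (e (i + 1)).hom) : M ≅ N where
  hom := ⟨fun i => (e i).hom, h⟩
  inv := ⟨fun i => (e i).inv, fun i => by rw [Iso.inv_comp_eq, ← assoc, h, assoc,
    Iso.hom_inv_id, comp_id]⟩
  hom_inv_id := hom_ext (fun i => (e i).hom_inv_id)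
  inv_hom_id := hom_ext (fun i => (e i).inv_hom_id)

lemma comp_dpow_eq (M : MF n W) {Y : ZMod n → C} {d : ∀ i, Y i ⟶ Y (i + 1)}
    (f : ∀ i, M.X i ⟶ Y i) (hf : ∀ i, f i ≫ d i = M.d i ≫ f (i + 1)) (i : ZMod n) :
    f i ≫ dpow d i n i (by simp) = f i ≫ W.app (Y i) := by
  rw [dpow_naturality M.d d f hf, M.dpow_eq]
  exact (W.naturality (f i)).symm

lemma dpow_eq_comp (M : MF n W) {Y : ZMod n → C} {d : ∀ i, Y i ⟶ Y (i + 1)}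
    (f : ∀ i, Y i ⟶ M.X i) (hf : ∀ i, f i ≫ M.d i = d i ≫ f (i + 1)) (i : ZMod n) :
    dpow d i n i (by simp) ≫ f i = W.app (Y i) ≫ f i := by
  rw [← dpow_naturality d M.d f hf, M.dpow_eq]
  exact W.naturality (f i)

section
variable [Preadditive C]

instance (M N : MF n W) : Zero (M ⟶ N) := ⟨⟨fun _ => 0, fun i => by rw [zero_comp, comp_zero]⟩⟩
instance (M N : MF n W) : Add (M ⟶ N) := ⟨fun f g => ⟨fun i => f.f i + g.f i, fun i => by
  rw [add_comp, comp_add, f.comm, g.comm]⟩⟩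
instance (M N : MF n W) : Neg (M ⟶ N) := ⟨fun f => ⟨fun i => -f.f i, fun i => by
  rw [neg_comp, comp_neg, f.comm]⟩⟩

@[simp] lemma zero_f (M N : MF n W) (i : ZMod n) : Hom.f (0 : M ⟶ N) i = 0 := rfl
@[simp] lemma add_f {M N : MF n W} (f g : M ⟶ N) (i : ZMod n) : (f + g).f i = f.f i + g.f i := rfl
@[simp] lemma neg_f {M N : MF n W} (f : M ⟶ N) (i : ZMod n) : (-f).f i = -f.f i := rfl

instance (M N : MF n W) : AddCommGroup (M ⟶ N) where
  add_assoc f g h := hom_ext (fun i => add_assoc _ _ _)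
  zero_add f := hom_ext (fun i => zero_add _)
  add_zero f := hom_ext (fun i => add_zero _)
  nsmul := nsmulRec
  zsmul := zsmulRec
  neg_add_cancel f := hom_ext (fun i => neg_add_cancel _)
  add_comm f g := hom_ext (fun i => add_comm _ _)

instance : Preadditive (MF n W) where
  add_comp _ _ _ f g h := hom_ext (fun i => add_comp _ _ _ _ _ _)
  comp_add _ _ _ f g h := hom_ext (fun i => comp_add _ _ _ _ _ _)

variable (W) in
/-- The component functor `M ↦ M.X i`. -/
@[simps] def eval (i : ZMod n) : MF n W ⥤ C where
  obj M := M.X i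
  map f := f.f i

instance (i : ZMod n) : (eval W i).Additive where

@[simp] lemma sub_f {M N : MF n W} (f g : M ⟶ N) (i : ZMod n) : (f - g).f i = f.f i - g.f i :=
  (eval W i).map_sub

variable [HasZeroObject C]

variable (n W) in
/-- The zero factorization. -/
noncomputable def zeroObj : MF n W where
  X _ := 0
  d _ := 0
  dpow_eq _ := (isZero_zero C).eq_of_src _ _

instance : HasZeroObject (MF n W) := ⟨zeroObj n W,
  (IsZero.iff_id_eq_zero _).2 (hom_ext (fun _ => (isZero_zero C).eq_of_src _ _))⟩

variable [HasBinaryBiproducts C]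

/-- The direct sum of two factorizations. -/
noncomputable def sum (M N : MF n W) : MF n W where
  X i := M.X i ⊞ N.X i
  d i := biprod.map (M.d i) (N.d i)
  dpow_eq i := by
    apply biprod.hom_ext'
    · exact M.comp_dpow_eq (fun i => biprod.inl) (fun i => by simp) i
    · exact N.comp_dpow_eq (fun i => biprod.inr) (fun i => by simp) i

/-- The bicone of the direct sum. -/
noncomputable def sumBicone (M N : MF n W) : BinaryBicone M N where
  pt := sum M N
  fst := ⟨fun i => biprod.fst, fun i => by simp [sum]⟩
  snd := ⟨fun i => biprod.snd, fun i => by simp [sum]⟩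
  inl := ⟨fun i => biprod.inl, fun i => by simp [sum]⟩
  inr := ⟨fun i => biprod.inr, fun i => by simp [sum]⟩
  inl_fst := hom_ext (fun i => biprod.inl_fst)
  inl_snd := hom_ext (fun i => biprod.inl_snd)
  inr_fst := hom_ext (fun i => biprod.inr_fst)
  inr_snd := hom_ext (fun i => biprod.inr_snd)

instance : HasBinaryBiproducts (MF n W) where
  has_binary_biproduct M N := HasBinaryBiproduct.mk ⟨_, isBinaryBilimitOfTotal (sumBicone M N)
    (hom_ext (fun _ => biprod.total))⟩

end
end MF
end MFCat

section MFExact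
variable {C : Type u} [Category.{v} C] [Preadditive C]
variable {n : ℕ} {W : 𝟭 C ⟶ 𝟭 C}

namespace MF

variable (n W) in
/-- Short sequences of factorizations that are split in each component. -/
def gradedSplit : ObjectProperty (ShortComplex (MF n W)) :=
  fun S => ∀ i, Nonempty ((S.map (eval W i)).Splitting)

/-- Data splitting the sequences `X i ⟶ Y i ⟶ Q i`. -/
structure SplitData {X Y Q : ZMod n → C} (f : ∀ i, X i ⟶ Y i) (g : ∀ i, Y i ⟶ Q i) where
  r : ∀ i, Y i ⟶ X i
  s : ∀ i, Q i ⟶ Y i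
  fr : ∀ i, f i ≫ r i = 𝟙 _
  sg : ∀ i, s i ≫ g i = 𝟙 _
  tot : ∀ i, r i ≫ f i + g i ≫ s i = 𝟙 _

namespace SplitData
variable {X Y Q : ZMod n → C} {f : ∀ i, X i ⟶ Y i} {g : ∀ i, Y i ⟶ Q i}

lemma fg (σ : SplitData f g) (i : ZMod n) : f i ≫ g i = 0 := by
  have h : f i ≫ (r σ i ≫ f i + g i ≫ s σ i) ≫ g i = f i ≫ 𝟙 _ ≫ g i := by rw [σ.tot]
  rw [add_comp, assoc, assoc, σ.sg, comp_add, reassoc_of% (σ.fr i), comp_id, id_comp] at h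
  simpa using h

lemma sr (σ : SplitData f g) (i : ZMod n) : σ.s i ≫ σ.r i = 0 := by
  have h : σ.s i ≫ (r σ i ≫ f i + g i ≫ s σ i) ≫ σ.r i = σ.s i ≫ 𝟙 _ ≫ σ.r i := by rw [σ.tot]
  rw [add_comp, assoc, assoc, σ.fr, comp_add, reassoc_of% (σ.sg i), comp_id, id_comp] at h
  simpa using h

lemma rf (σ : SplitData f g) (i : ZMod n) : σ.r i ≫ f i = 𝟙 _ - g i ≫ σ.s i :=
  eq_sub_of_add_eq (σ.tot i)

lemma gs (σ : SplitData f g) (i : ZMod n) : g i ≫ σ.s i = 𝟙 _ - σ.r i ≫ f i :=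
  eq_sub_of_add_eq' (σ.tot i)

end SplitData

lemma gradedSplit_mk {M N L : MF n W} {f : M ⟶ N} {g : N ⟶ L} (w : f ≫ g = 0)
    (σ : SplitData f.f g.f) : gradedSplit n W (ShortComplex.mk f g w) := fun i =>
  ⟨{ r := σ.r i, s := σ.s i, f_r := σ.fr i, s_g := σ.sg i, id := σ.tot i }⟩

lemma splitData_of_gradedSplit {S : ShortComplex (MF n W)} (h : gradedSplit n W S) :
    Nonempty (SplitData S.f.f S.g.f) :=
  ⟨⟨fun i => (h i).some.r, fun i => (h i).some.s, fun i => (h i).some.f_r,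
    fun i => (h i).some.s_g, fun i => (h i).some.id⟩⟩

lemma mono_of_f {M N : MF n W} (f : M ⟶ N) (h : ∀ i, Mono (f.f i)) : Mono f where
  right_cancellation g g' e := hom_ext (fun i => by
    rw [← cancel_mono (f.f i)]
    exact congr_f e i)

lemma epi_of_f {M N : MF n W} (f : M ⟶ N) (h : ∀ i, Epi (f.f i)) : Epi f where
  left_cancellation g g' e := hom_ext (fun i => by
    rw [← cancel_epi (f.f i)]
    exact congr_f e i)

lemma SplitData.mono {X Y Q : ZMod n → C} {f : ∀ i, X i ⟶ Y i} {g : ∀ i, Y i ⟶ Q i}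
    (σ : SplitData f g) (i : ZMod n) : Mono (f i) := mono_of_mono_fac (σ.fr i)

lemma SplitData.epi {X Y Q : ZMod n → C} {f : ∀ i, X i ⟶ Y i} {g : ∀ i, Y i ⟶ Q i}
    (σ : SplitData f g) (i : ZMod n) : Epi (g i) := epi_of_epi_fac (σ.sg i)

lemma SplitData.isKernel {M N L : MF n W} {f : M ⟶ N} {g : N ⟶ L} (w : f ≫ g = 0)
    (σ : SplitData f.f g.f) : Nonempty (IsLimit (KernelFork.ofι f w)) := by
  have : Mono f := mono_of_f f σ.mono
  refine ⟨KernelFork.IsLimit.ofι' f w (fun {A} k hk => ?_)⟩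
  have key : ∀ i, (k.f i ≫ σ.r i) ≫ f.f i = k.f i := fun i => by
    have := congr_f hk i
    simp only [comp_f, zero_f] at this
    rw [assoc, σ.rf, comp_sub, comp_id, reassoc_of% this, zero_comp, sub_zero]
  refine ⟨⟨fun i => k.f i ≫ σ.r i, fun i => ?_⟩, hom_ext key⟩
  have := σ.mono (i + 1)
  have e : ((k.f i ≫ σ.r i) ≫ M.d i) ≫ f.f (i + 1) = k.f i ≫ N.d i := by
    rw [assoc, ← f.comm, ← assoc, key]
  have e' : (A.d i ≫ k.f (i + 1) ≫ σ.r (i + 1)) ≫ f.f (i + 1) = A.d i ≫ k.f (i + 1) := by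
    rw [assoc, key]
  rw [← cancel_mono (f.f (i + 1)), e, e', k.comm]

lemma SplitData.isCokernel {M N L : MF n W} {f : M ⟶ N} {g : N ⟶ L} (w : f ≫ g = 0)
    (σ : SplitData f.f g.f) : Nonempty (IsColimit (CokernelCofork.ofπ g w)) := by
  have : Epi g := epi_of_f g σ.epi
  refine ⟨CokernelCofork.IsColimit.ofπ' g w (fun {A} k hk => ?_)⟩
  have key : ∀ i, g.f i ≫ σ.s i ≫ k.f i = k.f i := fun i => by
    have := congr_f hk i
    simp only [comp_f, zero_f] at this
    rw [← assoc, σ.gs, sub_comp, id_comp, assoc, this, comp_zero, sub_zero]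
  refine ⟨⟨fun i => σ.s i ≫ k.f i, fun i => ?_⟩, hom_ext key⟩
  have := σ.epi i
  have e : g.f i ≫ (σ.s i ≫ k.f i) ≫ A.d i = k.f i ≫ A.d i := by rw [← assoc, key]
  have e' : g.f i ≫ L.d i ≫ σ.s (i + 1) ≫ k.f (i + 1) = N.d i ≫ k.f (i + 1) := by
    rw [← assoc, g.comm, assoc, key]
  rw [← cancel_epi (g.f i), e, e', k.comm]

/-- A componentwise split monomorphism is an admissible monomorphism. -/
lemma SplitData.inflation {M N : MF n W} {f : M ⟶ N} {Q : ZMod n → C} {g : ∀ i, N.X i ⟶ Q i}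
    (σ : SplitData f.f g) : Inflation (gradedSplit n W) f := by
  have hg : ∀ i, g i ≫ σ.s i ≫ N.d i ≫ g (i + 1) = N.d i ≫ g (i + 1) := fun i => by
    rw [← assoc, σ.gs, sub_comp, id_comp, assoc, ← assoc (f.f i), f.comm, assoc, σ.fg, comp_zero,
      comp_zero, sub_zero]
  let L : MF n W :=
    { X := Q
      d := fun i => σ.s i ≫ N.d i ≫ g (i + 1)
      dpow_eq := fun i => by
        have := σ.epi i
        rw [← cancel_epi (g i)]
        exact N.comp_dpow_eq g hg i }
  have w : f ≫ (⟨g, hg⟩ : N ⟶ L) = 0 := hom_ext σ.fg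
  exact ⟨L, ⟨g, hg⟩, w, gradedSplit_mk w ⟨σ.r, σ.s, σ.fr, σ.sg, σ.tot⟩⟩

/-- A componentwise split epimorphism is an admissible epimorphism. -/
lemma SplitData.deflation {N L : MF n W} {g : N ⟶ L} {K : ZMod n → C} {f : ∀ i, K i ⟶ N.X i}
    (σ : SplitData f g.f) : Deflation (gradedSplit n W) g := by
  have hf : ∀ i, f i ≫ N.d i = (f i ≫ N.d i ≫ σ.r (i + 1)) ≫ f (i + 1) := fun i => by
    rw [assoc, assoc, σ.rf, comp_sub, comp_id, comp_sub, ← assoc (N.d i) (g.f (i + 1)), ← g.comm,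
      assoc, reassoc_of% (σ.fg i), zero_comp, sub_zero]
  let M : MF n W :=
    { X := K
      d := fun i => f i ≫ N.d i ≫ σ.r (i + 1)
      dpow_eq := fun i => by
        have := σ.mono i
        rw [← cancel_mono (f i)]
        exact N.dpow_eq_comp f hf i }
  have w : (⟨f, hf⟩ : M ⟶ N) ≫ g = 0 := hom_ext σ.fg
  exact ⟨M, ⟨f, hf⟩, w, gradedSplit_mk w ⟨σ.r, σ.s, σ.fr, σ.sg, σ.tot⟩⟩

lemma exists_splitData_of_inflation {M N : MF n W} {f : M ⟶ N}
    (h : Inflation (gradedSplit n W) f) :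
    ∃ (Q : ZMod n → C) (g : ∀ i, N.X i ⟶ Q i), Nonempty (SplitData f.f g) := by
  obtain ⟨L, g, w, h⟩ := h
  exact ⟨L.X, g.f, splitData_of_gradedSplit h⟩

lemma exists_splitData_of_deflation {N L : MF n W} {g : N ⟶ L}
    (h : Deflation (gradedSplit n W) g) :
    ∃ (K : ZMod n → C) (f : ∀ i, K i ⟶ N.X i), Nonempty (SplitData f g.f) := by
  obtain ⟨M, f, w, h⟩ := h
  exact ⟨M.X, f.f, splitData_of_gradedSplit h⟩

variable [HasZeroObject C] [HasBinaryBiproducts C]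

lemma comp_inflation {M N L : MF n W} (f : M ⟶ N) (f' : N ⟶ L)
    (h : Inflation (gradedSplit n W) f) (h' : Inflation (gradedSplit n W) f') :
    Inflation (gradedSplit n W) (f ≫ f') := by
  obtain ⟨Q, g, ⟨σ⟩⟩ := exists_splitData_of_inflation h
  obtain ⟨Q', g', ⟨σ'⟩⟩ := exists_splitData_of_inflation h'
  refine SplitData.inflation (Q := fun i => Q i ⊞ Q' i)
    (g := fun i => biprod.lift (σ'.r i ≫ g i) (g' i))
    ⟨fun i => σ'.r i ≫ σ.r i, fun i => biprod.desc (σ.s i ≫ f'.f i) (σ'.s i), fun i => ?_,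
      fun i => ?_, fun i => ?_⟩
  · rw [comp_f, assoc, reassoc_of% (σ'.fr i), σ.fr]
  · ext
    · simp [reassoc_of% (σ'.fr i), σ.sg]
    · simp [σ'.fg]
    · simp [reassoc_of% (σ'.sr i)]
    · simp [σ'.sg]
  · have e : σ'.r i ≫ (σ.r i ≫ f.f i + g i ≫ σ.s i) ≫ f'.f i + g' i ≫ σ'.s i = 𝟙 _ := by
      rw [σ.tot, id_comp, σ'.tot]
    rw [← e]
    simp [add_assoc]

lemma comp_deflation {M N L : MF n W} (g : M ⟶ N) (g' : N ⟶ L)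
    (h : Deflation (gradedSplit n W) g) (h' : Deflation (gradedSplit n W) g') :
    Deflation (gradedSplit n W) (g ≫ g') := by
  obtain ⟨K, f, ⟨σ⟩⟩ := exists_splitData_of_deflation h
  obtain ⟨K', f', ⟨σ'⟩⟩ := exists_splitData_of_deflation h'
  refine SplitData.deflation (K := fun i => K i ⊞ K' i)
    (f := fun i => biprod.desc (f i) (f' i ≫ σ.s i))
    ⟨fun i => biprod.lift (σ.r i) (g.f i ≫ σ'.r i), fun i => σ'.s i ≫ σ.s i, fun i => ?_,
      fun i => ?_, fun i => ?_⟩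
  · ext
    · simp [σ.fr]
    · simp [reassoc_of% (σ.fg i)]
    · simp [σ.sr]
    · simp [reassoc_of% (σ.sg i), σ'.fr]
  · rw [comp_f, assoc, reassoc_of% (σ.sg i), σ'.sg]
  · have e : σ.r i ≫ f i + g.f i ≫ (σ'.r i ≫ f' i + g'.f i ≫ σ'.s i) ≫ σ.s i = 𝟙 _ := by
      rw [σ'.tot, id_comp, σ.tot]
    rw [← e]
    simp [add_assoc]

lemma exists_pushout {M N M' : MF n W} (f : M ⟶ N) (a : M ⟶ M')
    (h : Inflation (gradedSplit n W) f) :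
    ∃ (N' : MF n W) (b : N ⟶ N') (f' : M' ⟶ N'), IsPushout f a b f' ∧
      Inflation (gradedSplit n W) f' := by
  obtain ⟨L, g, w, h⟩ := h
  obtain ⟨σ⟩ := splitData_of_gradedSplit h
  dsimp at σ
  have sds : ∀ i, σ.s i ≫ N.d i ≫ g.f (i + 1) = L.d i := fun i => by
    rw [← g.comm, reassoc_of% (σ.sg i)]
  let d' : ∀ i, M'.X i ⊞ L.X i ⟶ M'.X (i + 1) ⊞ L.X (i + 1) := fun i =>
    biprod.desc (M'.d i ≫ biprod.inl)
      (σ.s i ≫ N.d i ≫ biprod.lift (σ.r (i + 1) ≫ a.f (i + 1)) (g.f (i + 1)))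
  let b' : ∀ i, N.X i ⟶ M'.X i ⊞ L.X i := fun i => biprod.lift (σ.r i ≫ a.f i) (g.f i)
  have hinl : ∀ i, biprod.inl ≫ d' i = M'.d i ≫ biprod.inl := fun i => by simp [d']
  have hb : ∀ i, b' i ≫ d' i = N.d i ≫ b' (i + 1) := fun i => by
    have e₁ : b' i ≫ d' i = σ.r i ≫ (a.f i ≫ M'.d i) ≫ biprod.inl +
        (g.f i ≫ σ.s i) ≫ N.d i ≫ b' (i + 1) := by simp [b', d']
    have e₂ : f.f (i + 1) ≫ b' (i + 1) = a.f (i + 1) ≫ biprod.inl := by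
      ext
      · simp [b', reassoc_of% (σ.fr (i + 1))]
      · simp [b', σ.fg]
    rw [e₁, σ.gs, sub_comp, id_comp, assoc (σ.r i) (f.f i), ← assoc (f.f i), f.comm, assoc (M.d i),
      e₂, a.comm, assoc (M.d i)]
    abel
  have hs : ∀ i, σ.s i ≫ b' i = biprod.inr := fun i => by
    ext
    · simp [b', reassoc_of% (σ.sr i)]
    · simp [b', σ.sg]
  let N' : MF n W :=
    { X := fun i => M'.X i ⊞ L.X i
      d := d'
      dpow_eq := fun i => by
        apply biprod.hom_ext'
        · exact M'.comp_dpow_eq (fun i => biprod.inl) hinl i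
        · rw [← hs, assoc, assoc]
          congr 1
          exact N.comp_dpow_eq b' hb i }
  let b : N ⟶ N' := ⟨b', hb⟩
  let f' : M' ⟶ N' := ⟨fun i => biprod.inl, hinl⟩
  have w' : f ≫ b = a ≫ f' := hom_ext (fun i => by
    ext
    · simp [b, b', f', reassoc_of% (σ.fr i)]
    · simp [b, b', f', σ.fg])
  have desc : ∀ t : PushoutCocone f a, ∃ l : N' ⟶ t.pt, b ≫ l = t.inl ∧ f' ≫ l = t.inr := by
    intro t
    let l : ∀ i, M'.X i ⊞ L.X i ⟶ t.pt.X i := fun i => biprod.desc (t.inr.f i) (σ.s i ≫ t.inl.f i)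
    have hbl : ∀ i, b' i ≫ l i = t.inl.f i := fun i => by
      have := congr_f t.condition i
      simp only [comp_f] at this
      have e : b' i ≫ l i = σ.r i ≫ a.f i ≫ t.inr.f i + (g.f i ≫ σ.s i) ≫ t.inl.f i := by
        simp [b', l]
      rw [e, ← this, σ.gs, sub_comp, id_comp, assoc]
      abel
    refine ⟨⟨l, fun i => ?_⟩, hom_ext hbl, hom_ext (fun i => by simp [l, f'])⟩
    apply biprod.hom_ext'
    · change biprod.inl ≫ l i ≫ _ = biprod.inl ≫ d' i ≫ l (i + 1)
      rw [reassoc_of% (hinl i)]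
      simp [l, t.inr.comm]
    · change biprod.inr ≫ l i ≫ _ = biprod.inr ≫ d' i ≫ l (i + 1)
      rw [← hs, assoc, assoc, reassoc_of% (hb i), hbl, reassoc_of% (hbl i), t.inl.comm]
  choose l hl using desc
  refine ⟨N', b, f', ⟨⟨w'⟩, ⟨PushoutCocone.IsColimit.mk _ l (fun t => (hl t).1)
    (fun t => (hl t).2) (fun t m h₁ h₂ => hom_ext (fun i => ?_))⟩⟩,
    SplitData.inflation (Q := L.X) (g := fun i => biprod.snd)
      ⟨fun i => biprod.fst, fun i => biprod.inr, fun i => biprod.inl_fst, fun i => biprod.inr_snd,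
        fun i => biprod.total⟩⟩
  apply biprod.hom_ext'
  · exact (congr_f h₂ i).trans (congr_f (hl t).2 i).symm
  · rw [← hs, assoc, assoc]
    congr 1
    exact (congr_f h₁ i).trans (congr_f (hl t).1 i).symm

lemma exists_pullback {N L L' : MF n W} (g : N ⟶ L) (c : L' ⟶ L)
    (h : Deflation (gradedSplit n W) g) :
    ∃ (N' : MF n W) (b : N' ⟶ N) (g' : N' ⟶ L'), IsPullback b g' g c ∧
      Deflation (gradedSplit n W) g' := by
  obtain ⟨M, f, w, h⟩ := h
  obtain ⟨σ⟩ := splitData_of_gradedSplit h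
  dsimp at σ
  let d' : ∀ i, M.X i ⊞ L'.X i ⟶ M.X (i + 1) ⊞ L'.X (i + 1) := fun i =>
    biprod.lift (biprod.desc (f.f i) (c.f i ≫ σ.s i) ≫ N.d i ≫ σ.r (i + 1)) (biprod.snd ≫ L'.d i)
  let b' : ∀ i, M.X i ⊞ L'.X i ⟶ N.X i := fun i => biprod.desc (f.f i) (c.f i ≫ σ.s i)
  have hsnd : ∀ i, biprod.snd ≫ L'.d i = d' i ≫ biprod.snd := fun i => by simp [d']
  have e₂ : ∀ i, b' i ≫ g.f i = biprod.snd ≫ c.f i := fun i => by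
    ext
    · simp [b', σ.fg]
    · simp [b', σ.sg]
  have hb : ∀ i, b' i ≫ N.d i = d' i ≫ b' (i + 1) := fun i => by
    have e₁ : d' i ≫ b' (i + 1) = b' i ≫ N.d i ≫ σ.r (i + 1) ≫ f.f (i + 1) +
        biprod.snd ≫ L'.d i ≫ c.f (i + 1) ≫ σ.s (i + 1) := by simp [b', d', biprod.lift_desc]
    rw [e₁, σ.rf, comp_sub, comp_id, comp_sub, ← assoc (N.d i), ← g.comm, assoc, ← assoc (b' i) (g.f i),
      e₂, ← assoc (L'.d i), ← c.comm]
    simp only [assoc]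
    abel
  have hr : ∀ i, b' i ≫ σ.r i = biprod.fst := fun i => by
    ext
    · simp [b', σ.fr]
    · simp [b', σ.sr]
  let N' : MF n W :=
    { X := fun i => M.X i ⊞ L'.X i
      d := d'
      dpow_eq := fun i => by
        apply biprod.hom_ext
        · rw [← hr, ← assoc, ← assoc]
          congr 1
          exact N.dpow_eq_comp b' hb i
        · exact L'.dpow_eq_comp (fun i => biprod.snd) hsnd i }
  let b : N' ⟶ N := ⟨b', hb⟩
  let g' : N' ⟶ L' := ⟨fun i => biprod.snd, hsnd⟩
  have w' : b ≫ g = g' ≫ c := hom_ext e₂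
  have lift : ∀ t : PullbackCone g c, ∃ l : t.pt ⟶ N', l ≫ b = t.fst ∧ l ≫ g' = t.snd := by
    intro t
    let l : ∀ i, t.pt.X i ⟶ M.X i ⊞ L'.X i := fun i => biprod.lift (t.fst.f i ≫ σ.r i) (t.snd.f i)
    have hbl : ∀ i, l i ≫ b' i = t.fst.f i := fun i => by
      have := congr_f t.condition i
      simp only [comp_f] at this
      have e : l i ≫ b' i = t.fst.f i ≫ σ.r i ≫ f.f i + t.snd.f i ≫ c.f i ≫ σ.s i := by
        simp [b', l, biprod.lift_desc]
      rw [e, ← reassoc_of% this, σ.rf, comp_sub, comp_id]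
      abel
    refine ⟨⟨l, fun i => ?_⟩, hom_ext hbl, hom_ext (fun i => by simp [l, g'])⟩
    apply biprod.hom_ext
    · change (l i ≫ d' i) ≫ _ = _
      rw [← hr, assoc, ← reassoc_of% (hb i), reassoc_of% (hbl i), assoc, reassoc_of% (hbl (i + 1)),
        ← assoc, t.fst.comm, assoc]
    · change (l i ≫ d' i) ≫ _ = _
      rw [assoc, ← hsnd]
      simp [l, t.snd.comm]
  choose l hl using lift
  refine ⟨N', b, g', ⟨⟨w'⟩, ⟨PullbackCone.IsLimit.mk _ l (fun t => (hl t).1)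
    (fun t => (hl t).2) (fun t m h₁ h₂ => hom_ext (fun i => ?_))⟩⟩,
    SplitData.deflation (K := M.X) (f := fun i => biprod.inl)
      ⟨fun i => biprod.fst, fun i => biprod.inr, fun i => biprod.inl_fst, fun i => biprod.inr_snd,
        fun i => biprod.total⟩⟩
  apply biprod.hom_ext
  · rw [← hr, ← assoc, ← assoc]
    congr 1
    exact (congr_f h₁ i).trans (congr_f (hl t).1 i).symm
  · exact (congr_f h₂ i).trans (congr_f (hl t).2 i).symm

variable (n W) in
/-- The graded-split exact structure: a short sequence of factorizations is admissible if it is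
split in each component. -/
def gradedExact : ExactStructure (MF n W) where
  conflation := gradedSplit n W
  of_iso e h i := ⟨(h i).some.ofIso ((eval W i).mapShortComplex.mapIso e)⟩
  isKernel {S} h := (splitData_of_gradedSplit h).some.isKernel S.zero
  isCokernel {S} h := (splitData_of_gradedSplit h).some.isCokernel S.zero
  id_inflation M := SplitData.inflation (Q := fun _ => 0) (g := fun _ => 0)
    ⟨fun _ => 𝟙 _, fun _ => 0, fun _ => id_comp _, fun _ => (isZero_zero C).eq_of_src _ _,
      fun i => by simp⟩
  id_deflation M := SplitData.deflation (K := fun _ => 0) (f := fun _ => 0)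
    ⟨fun _ => 0, fun _ => 𝟙 _, fun _ => (isZero_zero C).eq_of_src _ _, fun _ => id_comp _,
      fun i => by simp⟩
  comp_inflation := comp_inflation
  comp_deflation := comp_deflation
  pushout := exists_pushout
  pullback := exists_pullback

end MF
end MFExact

section MFFrobenius
variable {C : Type u} [Category.{v} C]

lemma val_add_one_of_ne {n : ℕ} [NeZero n] {a : ZMod n} (h : a + 1 ≠ 0) :
    (a + 1).val = a.val + 1 := by
  have h₁ : ((a.val + 1 : ℕ) : ZMod n) = a + 1 := by simp
  have h₂ : a.val + 1 ≠ n := fun e => h (by rw [← h₁, e, ZMod.natCast_self])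
  have h₃ := ZMod.val_lt a
  rw [← h₁, ZMod.val_natCast_of_lt (by omega)]

lemma val_add_one_of_eq {n : ℕ} [NeZero n] {a : ZMod n} (h : a + 1 = 0) : a.val + 1 = n := by
  have h₁ : ((a.val + 1 : ℕ) : ZMod n) = 0 := by simpa using h
  have h₃ := ZMod.val_lt a
  exact le_antisymm h₃ (Nat.le_of_dvd (by omega) ((ZMod.natCast_eq_zero_iff _ _).1 h₁))

lemma dpow_congr {n : ℕ} {X : ZMod n → C} (d : ∀ i, X i ⟶ X (i + 1)) (i : ZMod n) {k k' : ℕ}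
    (j : ZMod n) (e : k = k') (h : i + (k : ZMod n) = j) :
    dpow d i k j h = dpow d i k' j (e ▸ h) := by
  subst e
  rfl

variable [Preadditive C] [HasFiniteBiproducts C] {n : ℕ} [NeZero n] {W : 𝟭 C ⟶ 𝟭 C}

namespace MF

variable (W) in
/-- The action of `W` on `X` if `p` holds, and the identity of `X` otherwise. -/
def actIf (p : Prop) [Decidable p] (X : C) : X ⟶ X := if p then W.app X else 𝟙 X

lemma actIf_pos {p : Prop} [Decidable p] (h : p) (X : C) : actIf W p X = W.app X := if_pos h

lemma actIf_neg {p : Prop} [Decidable p] (h : ¬p) (X : C) : actIf W p X = 𝟙 X := if_neg h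

variable (W) in
/-- The maps of the trivial factorization: on the summand `Y i` the map at the place `i` is the
action of `W`, and all other maps are the identity. -/
noncomputable def trivD (Y : ZMod n → C) (j : ZMod n) : (⨁ Y) ⟶ (⨁ Y) :=
  biproduct.map (fun i => actIf W (i = j) (Y i))

lemma ι_trivD (Y : ZMod n → C) (j i : ZMod n) :
    biproduct.ι Y i ≫ trivD W Y j = actIf W (i = j) (Y i) ≫ biproduct.ι Y i := by
  simp [trivD]

lemma trivD_π (Y : ZMod n → C) (j i : ZMod n) :
    trivD W Y j ≫ biproduct.π Y i = biproduct.π Y i ≫ actIf W (i = j) (Y i) := by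
  simp [trivD]

lemma ι_dpow (Y : ZMod n → C) (j i : ZMod n) (k : ℕ) (hk : k ≤ n) (l : ZMod n)
    (h : j + (k : ZMod n) = l) :
    biproduct.ι Y i ≫ dpow (X := fun _ => ⨁ Y) (trivD W Y) j k l h =
      actIf W ((i - j).val < k) (Y i) ≫ biproduct.ι Y i := by
  induction k generalizing l with
  | zero =>
    obtain rfl : j = l := by simpa using h
    rw [dpow_zero (X := fun _ => ⨁ Y), actIf_neg (by omega), id_comp, comp_id]
  | succ k ih =>
    obtain ⟨l, rfl⟩ : ∃ l', l = l' + 1 := ⟨l - 1, by ring⟩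
    have hl : j + (k : ZMod n) = l := by
      rw [Nat.cast_succ, ← add_assoc] at h
      exact add_right_cancel h
    have key : i = l ↔ (i - j).val = k := by
      rw [← hl]
      constructor
      · rintro rfl
        rw [add_sub_cancel_left, ZMod.val_natCast_of_lt (by omega)]
      · intro e
        rw [← e]
        simp
    rw [dpow_succ (X := fun _ => ⨁ Y) (trivD W Y) j k l hl, ← assoc, ih (by omega) l hl, assoc,
      ι_trivD]
    by_cases h₁ : (i - j).val = k
    · rw [actIf_neg (by omega), actIf_pos (key.2 h₁), actIf_pos (by omega), id_comp]
    · rw [actIf_neg (mt key.1 h₁), id_comp]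
      by_cases h₂ : (i - j).val < k
      · rw [actIf_pos h₂, actIf_pos (by omega)]
      · rw [actIf_neg h₂, actIf_neg (by omega)]

lemma dpow_π (Y : ZMod n → C) (j i : ZMod n) (k : ℕ) (hk : k ≤ n) (l : ZMod n)
    (h : j + (k : ZMod n) = l) :
    dpow (X := fun _ => ⨁ Y) (trivD W Y) j k l h ≫ biproduct.π Y i =
      biproduct.π Y i ≫ actIf W ((i - j).val < k) (Y i) := by
  apply biproduct.hom_ext'
  intro i'
  rw [← assoc, ι_dpow Y j i' k hk l h, assoc]
  by_cases e : i' = i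
  · subst e
    rw [biproduct.ι_π_self, comp_id, ← assoc, biproduct.ι_π_self, id_comp]
  · rw [biproduct.ι_π_ne Y e, comp_zero, ← assoc, biproduct.ι_π_ne Y e, zero_comp]

variable (W) in
/-- The direct sum of the trivial factorizations on the objects `Y i`. -/
noncomputable def triv (Y : ZMod n → C) : MF n W where
  X _ := ⨁ Y
  d := trivD W Y
  dpow_eq i := by
    apply biproduct.hom_ext'
    intro j
    rw [ι_dpow Y i j n le_rfl, actIf_pos (ZMod.val_lt _)]
    exact (W.naturality (biproduct.ι Y j)).symm

lemma add_val_sub (i j : ZMod n) : i + ((j - i).val : ZMod n) = j := by simp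

/-- The components of `fromTriv`. -/
noncomputable def fromTrivF {Y : ZMod n → C} (M : MF n W) (t : ∀ i, Y i ⟶ M.X (i + 1))
    (j : ZMod n) : (⨁ Y) ⟶ M.X j :=
  biproduct.desc (fun i => t i ≫ dpow M.d (i + 1) (j - (i + 1)).val j (add_val_sub _ _))

lemma ι_fromTrivF {Y : ZMod n → C} (M : MF n W) (t : ∀ i, Y i ⟶ M.X (i + 1)) (i j : ZMod n) :
    biproduct.ι Y i ≫ fromTrivF M t j =
      t i ≫ dpow M.d (i + 1) (j - (i + 1)).val j (add_val_sub _ _) :=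
  biproduct.ι_desc _ _

lemma fromTrivF_comm {Y : ZMod n → C} (M : MF n W) (t : ∀ i, Y i ⟶ M.X (i + 1)) (j : ZMod n) :
    fromTrivF M t j ≫ M.d j = trivD W Y j ≫ fromTrivF M t (j + 1) := by
  apply biproduct.hom_ext'
  intro i
  rw [← assoc, ← assoc, ι_fromTrivF, ι_trivD, assoc, assoc, ι_fromTrivF, ← dpow_succ]
  by_cases h : i = j
  · subst h
    have e : (i - (i + 1)).val + 1 = n := val_add_one_of_eq (by ring)
    have e' : (i + 1 - (i + 1)).val = 0 := by simp
    rw [actIf_pos rfl, dpow_congr M.d (i + 1) (i + 1) e' (add_val_sub _ _), dpow_zero, comp_id,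
      dpow_congr M.d (i + 1) (i + 1) e, M.dpow_eq]
    exact W.naturality (t i)
  · have e : (j + 1 - (i + 1)).val = (j - (i + 1)).val + 1 := by
      rw [← val_add_one_of_ne]
      · congr 1
        ring
      · intro h'
        apply h
        rw [← sub_eq_zero, ← neg_eq_zero, ← h']
        ring
    rw [actIf_neg h, id_comp, dpow_congr M.d (i + 1) (j + 1) e (add_val_sub _ _)]

/-- Morphisms out of trivial factorizations. -/
noncomputable def fromTriv {Y : ZMod n → C} (M : MF n W) (t : ∀ i, Y i ⟶ M.X (i + 1)) :
    triv W Y ⟶ M := ⟨fromTrivF M t, fromTrivF_comm M t⟩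

/-- The components of `toTriv`. -/
noncomputable def toTrivF {Y : ZMod n → C} (M : MF n W) (t : ∀ i, M.X i ⟶ Y i) (j : ZMod n) :
    M.X j ⟶ ⨁ Y :=
  biproduct.lift (fun i => dpow M.d j (i - j).val i (add_val_sub _ _) ≫ t i)

lemma toTrivF_π {Y : ZMod n → C} (M : MF n W) (t : ∀ i, M.X i ⟶ Y i) (i j : ZMod n) :
    toTrivF M t j ≫ biproduct.π Y i = dpow M.d j (i - j).val i (add_val_sub _ _) ≫ t i :=
  biproduct.lift_π _ _

lemma toTrivF_comm {Y : ZMod n → C} (M : MF n W) (t : ∀ i, M.X i ⟶ Y i) (j : ZMod n) :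
    toTrivF M t j ≫ trivD W Y j = M.d j ≫ toTrivF M t (j + 1) := by
  apply biproduct.hom_ext
  intro i
  rw [assoc, trivD_π, ← assoc, toTrivF_π, assoc, assoc, toTrivF_π, ← assoc (M.d j), ← dpow_succ']
  by_cases h : i = j
  · subst h
    have e : (i - (i + 1)).val + 1 = n := val_add_one_of_eq (by ring)
    have e' : (i - i).val = 0 := by simp
    rw [actIf_pos rfl, dpow_congr M.d i i e' (add_val_sub _ _), dpow_zero, id_comp,
      dpow_congr M.d i i e, M.dpow_eq]
    exact W.naturality (t i)
  · have e : (i - j).val = (i - (j + 1)).val + 1 := by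
      rw [← val_add_one_of_ne]
      · congr 1
        ring
      · intro h'
        apply h
        rw [← sub_eq_zero, ← h']
        ring
    rw [actIf_neg h, comp_id, dpow_congr M.d j i e (add_val_sub _ _)]

/-- Morphisms to trivial factorizations. -/
noncomputable def toTriv {Y : ZMod n → C} (M : MF n W) (t : ∀ i, M.X i ⟶ Y i) :
    M ⟶ triv W Y := ⟨toTrivF M t, toTrivF_comm M t⟩

lemma fromTriv_comp {Y : ZMod n → C} {M N : MF n W} (t : ∀ i, Y i ⟶ M.X (i + 1)) (g : M ⟶ N) :
    fromTriv M t ≫ g = fromTriv N (fun i => t i ≫ g.f (i + 1)) := hom_ext (fun j => by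
  change fromTrivF M t j ≫ g.f j = fromTrivF N _ j
  apply biproduct.hom_ext'
  intro i
  rw [← assoc, ι_fromTrivF, ι_fromTrivF, assoc, assoc, dpow_f])

lemma comp_toTriv {Y : ZMod n → C} {M N : MF n W} (t : ∀ i, N.X i ⟶ Y i) (g : M ⟶ N) :
    g ≫ toTriv N t = toTriv M (fun i => g.f i ≫ t i) := hom_ext (fun j => by
  change g.f j ≫ toTrivF N t j = toTrivF M _ j
  apply biproduct.hom_ext
  intro i
  rw [assoc, toTrivF_π, toTrivF_π, ← assoc, ← assoc, dpow_f])

lemma fromTriv_ι {Y : ZMod n → C} {M : MF n W} (u : triv W Y ⟶ M) :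
    fromTriv M (fun i => biproduct.ι Y i ≫ (show (⨁ Y) ⟶ M.X (i + 1) from u.f (i + 1))) = u :=
  hom_ext (fun j => by
    let u' : ∀ j, (⨁ Y) ⟶ M.X j := u.f
    change fromTrivF M (fun i => biproduct.ι Y i ≫ u' (i + 1)) j = u' j
    apply biproduct.hom_ext'
    intro i
    have h := ZMod.val_lt (j - (i + 1))
    have e : (i - (i + 1)).val + 1 = n := val_add_one_of_eq (by ring)
    have nat := dpow_naturality (X := fun _ => ⨁ Y) (trivD W Y) M.d u' u.comm (i + 1)
      (j - (i + 1)).val j (add_val_sub _ _)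
    rw [ι_fromTrivF, assoc, nat, ← assoc, ι_dpow Y _ _ _ h.le, actIf_neg (by omega), id_comp])

lemma toTriv_π {Y : ZMod n → C} {M : MF n W} (u : M ⟶ triv W Y) :
    toTriv M (fun i => (show M.X i ⟶ ⨁ Y from u.f i) ≫ biproduct.π Y i) = u :=
  hom_ext (fun j => by
    let u' : ∀ j, M.X j ⟶ ⨁ Y := u.f
    change toTrivF M (fun i => u' i ≫ biproduct.π Y i) j = u' j
    apply biproduct.hom_ext
    intro i
    have h := ZMod.val_lt (i - j)
    have nat := dpow_naturality M.d (Y := fun _ => ⨁ Y) (trivD W Y) u' u.comm j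
      (i - j).val i (add_val_sub _ _)
    rw [toTrivF_π, ← assoc, ← nat, assoc, dpow_π Y _ _ _ h.le, actIf_neg (by omega), comp_id])

variable [HasZeroObject C] [HasBinaryBiproducts C]

lemma isProjective_triv (Y : ZMod n → C) : (gradedExact n W).IsProjective (triv W Y) := by
  intro N L g hg u
  obtain ⟨K, f, ⟨σ⟩⟩ := exists_splitData_of_deflation hg
  refine ⟨fromTriv N (fun i => (biproduct.ι Y i ≫ (show (⨁ Y) ⟶ L.X (i + 1) from u.f (i + 1))) ≫
    σ.s (i + 1)), ?_⟩
  rw [fromTriv_comp]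
  simp only [assoc _ (σ.s _), σ.sg, comp_id]
  exact fromTriv_ι u

lemma isInjective_triv (Y : ZMod n → C) : (gradedExact n W).IsInjective (triv W Y) := by
  intro M N f hf u
  obtain ⟨Q, g, ⟨σ⟩⟩ := exists_splitData_of_inflation hf
  refine ⟨toTriv N (fun i => σ.r i ≫ (show M.X i ⟶ ⨁ Y from u.f i) ≫ biproduct.π Y i), ?_⟩
  rw [comp_toTriv]
  simp only [reassoc_of% σ.fr]
  exact toTriv_π u

variable [IsIdempotentComplete C]

lemma inflation_of_retraction {M N : MF n W} (f : M ⟶ N) (r : ∀ i, N.X i ⟶ M.X i)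
    (h : ∀ i, f.f i ≫ r i = 𝟙 _) : Inflation (gradedSplit n W) f := by
  have : ∀ i, ∃ (Q : C) (s : Q ⟶ N.X i) (g : N.X i ⟶ Q), s ≫ g = 𝟙 Q ∧
      g ≫ s = 𝟙 _ - r i ≫ f.f i := fun i =>
    IsIdempotentComplete.idempotents_split _ _ (by simp [reassoc_of% (h i)])
  choose Q s g h₁ h₂ using this
  exact SplitData.inflation ⟨r, s, h, h₁, fun i => by rw [h₂]; abel⟩

lemma deflation_of_section {M N : MF n W} (g : M ⟶ N) (s : ∀ i, N.X i ⟶ M.X i)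
    (h : ∀ i, s i ≫ g.f i = 𝟙 _) : Deflation (gradedSplit n W) g := by
  have : ∀ i, ∃ (Q : C) (f : Q ⟶ M.X i) (r : M.X i ⟶ Q), f ≫ r = 𝟙 Q ∧
      r ≫ f = 𝟙 _ - g.f i ≫ s i := fun i =>
    IsIdempotentComplete.idempotents_split _ _ (by simp [reassoc_of% (h i)])
  choose Q f r h₁ h₂ using this
  exact SplitData.deflation ⟨r, s, h₁, h, fun i => by rw [h₂]; abel⟩

/-- Every factorization embeds in a trivial one. -/
lemma inflation_toTriv (M : MF n W) :
    Inflation (gradedSplit n W) (toTriv (Y := M.X) M (fun i => 𝟙 _)) :=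
  inflation_of_retraction _ (fun i => biproduct.π M.X i) (fun i => by
    refine (toTrivF_π (Y := M.X) M (fun i => 𝟙 _) i i).trans ?_
    have e' : (i - i).val = 0 := by simp
    rw [dpow_congr M.d i i e' (add_val_sub _ _), dpow_zero, comp_id])

/-- Every factorization is a quotient of a trivial one. -/
lemma deflation_fromTriv (M : MF n W) :
    Deflation (gradedSplit n W) (fromTriv (Y := fun i => M.X (i + 1)) M (fun i => 𝟙 _)) :=
  deflation_of_section _ (fun i => eqToHom (congrArg M.X (by ring)) ≫
    biproduct.ι (fun i => M.X (i + 1)) (i - 1)) (fun i => by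
    refine (assoc _ _ _).trans ((_ ≫= ι_fromTrivF (Y := fun i => M.X (i + 1)) M (fun i => 𝟙 _)
      (i - 1) i).trans ?_)
    rw [id_comp]
    obtain ⟨i, rfl⟩ : ∃ j, i = j + 1 := ⟨i - 1, by ring⟩
    have key : ∀ j (h : j = i), eqToHom (congrArg M.X (by rw [h])) ≫
        dpow M.d (j + 1) (i + 1 - (j + 1)).val (i + 1) (add_val_sub _ _) = 𝟙 (M.X (i + 1)) := by
      rintro j rfl
      have e' : (j + 1 - (j + 1)).val = 0 := by simp
      rw [dpow_congr M.d (j + 1) (j + 1) e' (add_val_sub _ _), dpow_zero]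
      simp
    exact key _ (by ring))

lemma exists_retract_of_isInjective {M : MF n W} (h : (gradedExact n W).IsInjective M) :
    ∃ (i : M ⟶ triv W M.X) (p : triv W M.X ⟶ M), i ≫ p = 𝟙 M := by
  obtain ⟨p, hp⟩ := h _ (inflation_toTriv M) (𝟙 M)
  exact ⟨_, p, hp⟩

lemma projInj_of_retract {Y : ZMod n → C} {M : MF n W} (i : M ⟶ triv W Y) (p : triv W Y ⟶ M)
    (h : i ≫ p = 𝟙 M) : (gradedExact n W).ProjInj M := by
  constructor
  · intro N L g hg u
    obtain ⟨v, hv⟩ := isProjective_triv Y g hg (p ≫ u)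
    exact ⟨i ≫ v, by rw [assoc, hv, ← assoc, h, id_comp]⟩
  · intro N L f hf u
    obtain ⟨v, hv⟩ := isInjective_triv Y f hf (u ≫ i)
    exact ⟨v ≫ p, by rw [← assoc, hv, assoc, h, comp_id]⟩

/-- Matrix factorizations with the graded-split exact structure form a Frobenius category. -/
instance : (gradedExact n W).IsFrobenius where
  enoughInjectives M := ⟨_, _, isInjective_triv _, inflation_toTriv M⟩
  enoughProjectives M := ⟨_, _, isProjective_triv _, deflation_fromTriv M⟩
  projective_iff_injective M := by
    constructor
    · intro h
      obtain ⟨i, hi⟩ := h _ (deflation_fromTriv M) (𝟙 M)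
      exact (projInj_of_retract i _ hi).2
    · intro h
      obtain ⟨i, p, hp⟩ := exists_retract_of_isInjective h
      exact (projInj_of_retract i p hp).1

end MF
end MFFrobenius

section MFMap
variable {C : Type u} [Category.{v} C] {D : Type u'} [Category.{v'} D] {n : ℕ}
  {W : 𝟭 C ⟶ 𝟭 C} {V : 𝟭 D ⟶ 𝟭 D}

lemma map_dpow (F : C ⥤ D) {X : ZMod n → C} (d : ∀ i, X i ⟶ X (i + 1)) (i : ZMod n) (k : ℕ)
    (j : ZMod n) (h : i + (k : ZMod n) = j) :
    F.map (dpow d i k j h) = dpow (X := fun i => F.obj (X i)) (fun i => F.map (d i)) i k j h := by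
  induction k generalizing j with
  | zero =>
    obtain rfl : i = j := by simpa using h
    rw [dpow_zero, dpow_zero (X := fun i => F.obj (X i)), F.map_id]
  | succ k ih =>
    obtain ⟨j, rfl⟩ : ∃ j', j = j' + 1 := ⟨j - 1, by ring⟩
    have hj : i + (k : ZMod n) = j := by
      rw [Nat.cast_succ, ← add_assoc] at h
      exact add_right_cancel h
    rw [dpow_succ d i k j hj, dpow_succ (X := fun i => F.obj (X i)) _ i k j hj, F.map_comp, ih j hj]

namespace MF

/-- The functor induced on factorizations by a functor compatible with the actions. -/
@[simps] def mapMF (F : C ⥤ D) (hF : ∀ X, F.map (W.app X) = V.app (F.obj X)) :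
    MF n W ⥤ MF n V where
  obj M :=
    { X := fun i => F.obj (M.X i)
      d := fun i => F.map (M.d i)
      dpow_eq := fun i => by rw [← map_dpow, M.dpow_eq]; exact hF _ }
  map f := ⟨fun i => F.map (f.f i), fun i => by rw [← F.map_comp, f.comm, F.map_comp]⟩
  map_id M := hom_ext (fun i => F.map_id _)
  map_comp f g := hom_ext (fun i => F.map_comp _ _)

variable [Preadditive C] [Preadditive D] (F : C ⥤ D) [F.Additive]
  (hF : ∀ X, F.map (W.app X) = V.app (F.obj X))

instance : (mapMF (n := n) F hF).Additive where
  map_add := hom_ext (fun i => F.map_add)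

variable [HasFiniteBiproducts C] [HasFiniteBiproducts D] [NeZero n]

/-- Trivial factorizations are preserved. -/
noncomputable def mapTriv (Y : ZMod n → C) :
    (mapMF F hF).obj (triv W Y) ≅ triv V (fun i => F.obj (Y i)) :=
  isoMk (fun i => F.mapBiproduct Y) (fun j => by
    apply biproduct.hom_ext
    intro i
    have hπ : (F.mapBiproduct Y).hom ≫ biproduct.π (fun i => F.obj (Y i)) i =
        F.map (biproduct.π Y i) := biproduct.lift_π _ _
    have hV : trivD V (fun i => F.obj (Y i)) j ≫ biproduct.π (fun i => F.obj (Y i)) i = _ :=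
      trivD_π (fun i => F.obj (Y i)) j i
    have e : F.map (actIf W (i = j) (Y i)) = actIf V (i = j) (F.obj (Y i)) := by
      by_cases h : i = j
      · rw [actIf_pos h, actIf_pos h]
        exact hF _
      · rw [actIf_neg h, actIf_neg h, F.map_id]
    refine (assoc _ _ _).trans (((F.mapBiproduct Y).hom ≫= hV).trans ?_)
    refine ((assoc _ _ _).symm.trans (hπ =≫ _)).trans ?_
    refine Eq.trans ?_ ((F.map (trivD W Y j) ≫= hπ).symm.trans (assoc _ _ _).symm)
    rw [← F.map_comp, trivD_π, F.map_comp, e])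

variable [HasZeroObject C] [HasZeroObject D] [HasBinaryBiproducts C] [HasBinaryBiproducts D]
  [IsIdempotentComplete C] [IsIdempotentComplete D]

lemma projInj_map {M : MF n W} (h : (gradedExact n W).ProjInj M) :
    (gradedExact n V).ProjInj ((mapMF F hF).obj M) := by
  obtain ⟨i, p, hp⟩ := exists_retract_of_isInjective h.2
  refine projInj_of_retract ((mapMF F hF).map i ≫ (mapTriv F hF M.X).hom)
    ((mapTriv F hF M.X).inv ≫ (mapMF F hF).map p) ?_
  rw [assoc, Iso.hom_inv_id_assoc, ← (mapMF F hF).map_comp, hp, (mapMF F hF).map_id]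

/-- The functor induced on stable categories. -/
noncomputable def stabMap : (gradedExact n W).Stab ⥤ (gradedExact n V).Stab :=
  (gradedExact n W).liftStab (mapMF F hF ⋙ (gradedExact n V).toStab)
    (fun _ h => ExactStructure.isZero_toStab_obj (projInj_map F hF h))

end MF
end MFMap

section ProjC
variable (C : Type u) [Category.{v} C]

/-- The full subcategory of projective objects. -/
abbrev ProjCat := (isProjective C).FullSubcategory

variable {C} in
/-- The restriction of a natural transformation to the projective objects. -/
def restrictProj (W : 𝟭 C ⟶ 𝟭 C) : 𝟭 (ProjCat C) ⟶ 𝟭 (ProjCat C) where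
  app X := ObjectProperty.homMk (W.app X.obj)
  naturality _ _ f := ObjectProperty.hom_ext _ (W.naturality f.hom)

variable [Abelian C]

instance : HasFiniteBiproducts (ProjCat C) where
  out k := ⟨fun F => by
    have : HasFiniteBiproducts C := Abelian.hasFiniteBiproducts
    let b : Bicone F :=
      { pt := ⟨⨁ (fun j => (F j).obj), ⟨fun f e _ => by
          have : ∀ j, Projective (F j).obj := fun j => (F j).property
          exact ⟨biproduct.desc (fun j => Projective.factorThru
              (biproduct.ι (fun j => (F j).obj) j ≫ f) e),
            biproduct.hom_ext' _ _ (fun j => by simp)⟩⟩⟩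
        π := fun j => ObjectProperty.homMk (biproduct.π (fun j => (F j).obj) j)
        ι := fun j => ObjectProperty.homMk (biproduct.ι (fun j => (F j).obj) j)
        ι_π := fun j j' => by
          apply ObjectProperty.hom_ext
          by_cases h : j = j'
          · subst h
            simp
          · simp [biproduct.ι_π_ne (fun j => (F j).obj) h, h] }
    refine HasBiproduct.mk ⟨b, isBilimitOfTotal b ?_⟩
    apply ObjectProperty.hom_ext
    refine Eq.trans ?_ (biproduct.total (f := fun j => (F j).obj))
    exact (isProjective C).ι.map_sum _ _⟩

instance : IsIdempotentComplete (ProjCat C) where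
  idempotents_split P p hp := by
    obtain ⟨Y, i, e, h₁, h₂⟩ := IsIdempotentComplete.idempotents_split P.obj p.hom
      (congrArg InducedCategory.Hom.hom hp)
    have hY : Projective Y := have := P.property
      Retract.projective (Y := P.obj) ⟨i, e, h₁⟩
    exact ⟨⟨Y, hY⟩, ObjectProperty.homMk i, ObjectProperty.homMk e,
      ObjectProperty.hom_ext _ h₁, ObjectProperty.hom_ext _ h₂⟩

instance : HasZeroObject (ProjCat C) :=
  ⟨⟨0, inferInstance⟩, (IsZero.iff_id_eq_zero _).2
    (ObjectProperty.hom_ext _ ((isZero_zero C).eq_of_src _ _))⟩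

instance : HasBinaryBiproducts (ProjCat C) := hasBinaryBiproducts_of_finite_biproducts _

end ProjC

section Verdier
variable {T : Type u} [Category.{v} T] [HasZeroObject T] [HasShift T ℤ] [Preadditive T]
  [∀ n : ℤ, (shiftFunctor T n).Additive] [Pretriangulated T]

/-- The Verdier quotient of a triangulated category by the thick triangulated subcategory
generated by a class of objects. -/
def VerdierQuot (P : ObjectProperty T) := P.triangEnvelope.trW.Localization

section
variable (P : ObjectProperty T)

noncomputable instance : Category (VerdierQuot P) :=
  inferInstanceAs (Category P.triangEnvelope.trW.Localization)

/-- The quotient functor. -/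
noncomputable def verdierQ : T ⥤ VerdierQuot P := P.triangEnvelope.trW.Q

instance : (verdierQ P).IsLocalization P.triangEnvelope.trW :=
  inferInstanceAs (P.triangEnvelope.trW.Q.IsLocalization P.triangEnvelope.trW)

variable [IsTriangulated T] [P.Nonempty]

noncomputable instance : HasShift (VerdierQuot P) ℤ :=
  inferInstanceAs (HasShift P.triangEnvelope.trW.Localization ℤ)

noncomputable instance : Preadditive (VerdierQuot P) :=
  inferInstanceAs (Preadditive P.triangEnvelope.trW.Localization)

instance : HasZeroObject (VerdierQuot P) :=
  inferInstanceAs (HasZeroObject P.triangEnvelope.trW.Localization)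

instance (n : ℤ) : (shiftFunctor (VerdierQuot P) n).Additive :=
  inferInstanceAs (shiftFunctor P.triangEnvelope.trW.Localization n).Additive

noncomputable instance : Pretriangulated (VerdierQuot P) :=
  inferInstanceAs (Pretriangulated P.triangEnvelope.trW.Localization)

instance : IsTriangulated (VerdierQuot P) :=
  inferInstanceAs (IsTriangulated P.triangEnvelope.trW.Localization)

instance : (verdierQ P).Additive := inferInstanceAs P.triangEnvelope.trW.Q.Additive

noncomputable instance : (verdierQ P).CommShift ℤ :=
  inferInstanceAs (P.triangEnvelope.trW.Q.CommShift ℤ)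

instance : (verdierQ P).IsTriangulated := inferInstanceAs P.triangEnvelope.trW.Q.IsTriangulated

end

/-- A functor between triangulated categories is triangulated if it can be given commutation
isomorphisms with the shifts for which it preserves distinguished triangles. -/
def IsTriangulatedFunctor {T' : Type u'} [Category.{v'} T'] [HasZeroObject T'] [HasShift T' ℤ]
    [Preadditive T'] [∀ n : ℤ, (shiftFunctor T' n).Additive] [Pretriangulated T'] (F : T ⥤ T') :
    Prop :=
  ∃ _ : F.CommShift ℤ, F.IsTriangulated

/-- Two full subcategories `A₁`, `A₂` form a semiorthogonal decomposition `⟨A₁, A₂⟩` of `T`: they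
are triangulated subcategories, there are no non-zero morphisms from `A₂` to `A₁`, and the smallest
(strictly full) triangulated subcategory containing both is `T`. -/
structure IsSemiorthogonalDecomposition (A₁ A₂ : ObjectProperty T) : Prop where
  isTriangulated₁ : A₁.IsTriangulated
  isTriangulated₂ : A₂.IsTriangulated
  orthogonal : ∀ ⦃X₁ X₂ : T⦄, A₁ X₁ → A₂ X₂ → ∀ f : X₂ ⟶ X₁, f = 0
  generate : ∀ B : ObjectProperty T, B.IsTriangulated → B.IsClosedUnderIsomorphisms → A₁ ≤ B →
    A₂ ≤ B → ∀ X : T, B X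

lemma isZero_verdierQ_obj [IsTriangulated T] (P : ObjectProperty T) [P.Nonempty] {X : T}
    (h : P X) : IsZero ((verdierQ P).obj X) := by
  have hW : P.triangEnvelope.trW (0 : 0 ⟶ X) :=
    ObjectProperty.trW.mk _ (contractible_distinguished₁ X) (P.le_triangEnvelope _ h)
  have := Localization.inverts (verdierQ P) _ _ hW
  exact ((verdierQ P).map_isZero (isZero_zero T)).of_iso
    (asIso ((verdierQ P).map (0 : 0 ⟶ X))).symm

end Verdier

section Complexes
variable (E : Type u) [Category.{v} E] [Preadditive E] [HasZeroObject E] [HasBinaryBiproducts E]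

/-- Complexes (with differentials of degree `1`) that vanish in all large degrees. -/
def boundedAbove : ObjectProperty (HomotopyCategory E (.up ℤ)) :=
  fun K => ∃ b : ℤ, ∀ i, b < i → IsZero (K.as.X i)

/-- Complexes with only finitely many non-zero terms. -/
def bounded : ObjectProperty (HomotopyCategory E (.up ℤ)) :=
  fun K => ∃ a b : ℤ, ∀ i, i < a ∨ b < i → IsZero (K.as.X i)

variable {E} in
lemma isTriangulated_of_cone (P : ObjectProperty (HomotopyCategory E (.up ℤ)))
    (h₀ : P ((HomotopyCategory.quotient E (.up ℤ)).obj 0))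
    (h₁ : ∀ (K : CochainComplex E ℤ) (n : ℤ), P ((HomotopyCategory.quotient E (.up ℤ)).obj K) →
      P ((HomotopyCategory.quotient E (.up ℤ)).obj (K⟦n⟧)))
    (h₂ : ∀ (K L : CochainComplex E ℤ) (f : K ⟶ L),
      P ((HomotopyCategory.quotient E (.up ℤ)).obj K) →
      P ((HomotopyCategory.quotient E (.up ℤ)).obj L) →
      P ((HomotopyCategory.quotient E (.up ℤ)).obj (CochainComplex.mappingCone f))) :
    P.IsTriangulated := by
  have i₀ : P.ContainsZero := ⟨⟨_, Functor.map_isZero _ (isZero_zero _), h₀⟩⟩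
  have i₁ : P.IsStableUnderShift ℤ := ⟨fun n => ⟨fun K hK => by
    obtain ⟨K : CochainComplex _ _, rfl⟩ := K.quotient_obj_surjective
    rw [ObjectProperty.prop_shift_iff, HomotopyCategory.shift_quotient_obj]
    exact h₁ K n hK⟩⟩
  have i₂ : P.IsTriangulatedClosed₃ := ⟨fun T hT k₁ k₂ => by
    obtain ⟨f : T.obj₁.as ⟶ T.obj₂.as, hf⟩ :=
      (HomotopyCategory.quotient E (.up ℤ)).map_surjective T.mor₁
    refine ⟨_, h₂ _ _ f k₁ k₂, ⟨Triangle.π₃.mapIso (isoTriangleOfIso₁₂ T _ hT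
      (HomotopyCategory.mappingCone_triangleh_distinguished f) (Iso.refl _) (Iso.refl _) ?_)⟩⟩
    exact (comp_id _).trans (hf.symm.trans (id_comp _).symm)⟩
  have i₃ : P.IsTriangulatedClosed₂ := .of_isTriangulatedClosed₃
  exact { }

instance : (boundedAbove E).IsTriangulated := isTriangulated_of_cone _
  ⟨0, fun i _ => (HomologicalComplex.eval E (.up ℤ) i).map_isZero (isZero_zero _)⟩
  (fun K n ⟨b, hb⟩ => ⟨b - n, fun i hi => hb (i + n) (by lia)⟩)
  (fun K L f ⟨b, hb⟩ ⟨b', hb'⟩ => ⟨max b b', fun i hi =>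
    (CochainComplex.mappingCone.isZero_X_iff f i).2
      ⟨hb _ (by have := le_max_left b b'; lia), hb' _ (by have := le_max_right b b'; lia)⟩⟩)

instance : (bounded E).IsTriangulated := isTriangulated_of_cone _
  ⟨0, 0, fun i _ => (HomologicalComplex.eval E (.up ℤ) i).map_isZero (isZero_zero _)⟩
  (fun K n ⟨a, b, hb⟩ => ⟨a - n, b - n, fun i hi => hb (i + n) (by lia)⟩)
  (fun K L f ⟨a, b, hb⟩ ⟨a', b', hb'⟩ => ⟨min (a - 1) a', max b b', fun i hi =>
    (CochainComplex.mappingCone.isZero_X_iff f i).2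
      ⟨hb _ (by have := le_max_left b b'; have := min_le_left (a - 1) a'; lia),
        hb' _ (by have := le_max_right b b'; have := min_le_right (a - 1) a'; lia)⟩⟩)

lemma bounded_le_boundedAbove : bounded E ≤ boundedAbove E :=
  fun _ ⟨_, b, h⟩ => ⟨b, fun i hi => h i (Or.inr hi)⟩

/-- The homotopy category of bounded above complexes. -/
abbrev Kminus := (boundedAbove E).FullSubcategory

/-- The homotopy category of bounded complexes. -/
abbrev Kb := (bounded E).FullSubcategory

/-- The object `X` as a complex concentrated in degree `0`. -/
noncomputable def singleKb : E ⥤ Kb E :=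
  (bounded E).lift (HomotopyCategory.singleFunctor E 0) (fun X => ⟨0, 0, fun i hi =>
    HomologicalComplex.isZero_single_obj_X _ _ _ _ (by lia)⟩)

instance : (singleKb E).Additive := by
  constructor
  exact ObjectProperty.hom_ext _ ((HomotopyCategory.singleFunctor E 0).map_add)

variable {E}

namespace ExactStructure
variable (S : ExactStructure E)

/-- Acyclic complexes of an exact category: the differentials factor as
`X i ⟶ Z (i + 1) ⟶ X (i + 1)` with admissible short exact sequences `Z i ⟶ X i ⟶ Z (i + 1)`. -/
def Acyclic (K : CochainComplex E ℤ) : Prop :=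
  ∃ (Z : ℤ → E) (j : ∀ i, Z i ⟶ K.X i) (p : ∀ i, K.X i ⟶ Z (i + 1)),
    (∀ i, S.Conf (j i) (p i)) ∧ ∀ i, K.d i (i + 1) = p i ≫ j (i + 1)

lemma acyclic_of_isZero (K : CochainComplex E ℤ) (h : ∀ i, IsZero (K.X i)) : S.Acyclic K := by
  refine ⟨K.X, fun i => 𝟙 _, fun i => 0, fun i => ?_, fun i => (h i).eq_of_src _ _⟩
  obtain ⟨Z, f, w, hc⟩ := S.id_inflation (K.X i)
  have hc' : S.Conf (𝟙 (K.X i)) f := ⟨w, hc⟩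
  have hf : f = 0 := by simpa using w
  have := hc'.epi
  have hZ : IsZero Z := by
    rw [IsZero.iff_id_eq_zero, ← cancel_epi f, hf, zero_comp, zero_comp]
  exact hc'.of_iso (Iso.refl _) (Iso.refl _) (hZ.iso (h _)) (by simp)
    ((h _).eq_of_tgt _ _)

/-- The acyclic complexes in `K⁻(E)`. -/
def acyclicMinus : ObjectProperty (Kminus E) := fun K => S.Acyclic K.obj.as

/-- The acyclic complexes in `K^b(E)`. -/
def acyclicB : ObjectProperty (Kb E) := fun K => S.Acyclic K.obj.as

lemma isZero_zero_X (i : ℤ) : IsZero ((0 : CochainComplex E ℤ).X i) :=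
  (HomologicalComplex.eval E (.up ℤ) i).map_isZero (isZero_zero _)

instance : S.acyclicMinus.Nonempty :=
  ⟨⟨(HomotopyCategory.quotient E (.up ℤ)).obj 0, ⟨0, fun i _ => isZero_zero_X i⟩⟩,
    S.acyclic_of_isZero _ isZero_zero_X⟩

instance : S.acyclicB.Nonempty :=
  ⟨⟨(HomotopyCategory.quotient E (.up ℤ)).obj 0, ⟨0, 0, fun i _ => isZero_zero_X i⟩⟩,
    S.acyclic_of_isZero _ isZero_zero_X⟩

/-- The bounded above derived category `D⁻(E)`. -/
abbrev Dminus := VerdierQuot S.acyclicMinus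

/-- The bounded derived category `D^b(E)`. -/
abbrev Db := VerdierQuot S.acyclicB

/-- The full subcategory `K^b(ProjInj)` of `D^b(E)`: the objects isomorphic to bounded complexes
of projective-injective objects. -/
def perfect : ObjectProperty S.Db := fun Y =>
  ∃ K : Kb E, (∀ i, S.ProjInj (K.obj.as.X i)) ∧ Nonempty (Y ≅ (verdierQ S.acyclicB).obj K)

instance : S.perfect.Nonempty :=
  ⟨_, ⟨(HomotopyCategory.quotient E (.up ℤ)).obj 0, ⟨0, 0, fun i _ => isZero_zero_X i⟩⟩, fun i =>
    ⟨fun _ _ _ _ _ => ⟨0, (isZero_zero_X i).eq_of_src _ _⟩,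
      fun _ _ _ _ _ => ⟨0, (isZero_zero_X i).eq_of_tgt _ _⟩⟩, ⟨Iso.refl _⟩⟩

/-- The quotient `D^b(E) / K^b(ProjInj)`. -/
abbrev Dsing := VerdierQuot S.perfect

/-- The composite `K^b(E) ⥤ D^b(E) ⥤ D^b(E) / K^b(ProjInj)`. -/
noncomputable def toDsing : Kb E ⥤ S.Dsing := verdierQ S.acyclicB ⋙ verdierQ S.perfect

instance : S.toDsing.Additive := by
  unfold toDsing
  infer_instance

lemma isZero_toDsing_obj {K : Kb E} (hK : ∀ i, S.ProjInj (K.obj.as.X i)) :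
    IsZero (S.toDsing.obj K) :=
  isZero_verdierQ_obj S.perfect ⟨K, hK, ⟨Iso.refl _⟩⟩

lemma projInj_of_iso {P Q : E} (e : P ≅ Q) (h : S.ProjInj P) : S.ProjInj Q :=
  ⟨fun _ _ g hg u => by
    obtain ⟨v, hv⟩ := h.1 g hg (e.hom ≫ u)
    exact ⟨e.inv ≫ v, by rw [assoc, hv, Iso.inv_hom_id_assoc]⟩,
  fun _ _ f hf u => by
    obtain ⟨v, hv⟩ := h.2 f hf (u ≫ e.inv)
    exact ⟨v ≫ e.hom, by rw [reassoc_of% hv, Iso.inv_hom_id, comp_id]⟩⟩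

lemma projInj_single {P : E} (hP : S.ProjInj P) (i : ℤ) :
    S.ProjInj (((singleKb E).obj P).obj.as.X i) := by
  change S.ProjInj (((HomologicalComplex.single E (.up ℤ) 0).obj P).X i)
  by_cases h : i = 0
  · subst h
    exact S.projInj_of_iso (HomologicalComplex.singleObjXSelf _ _ _).symm hP
  · exact S.projInj_of_iso ((isZero_zero E).iso
      (HomologicalComplex.isZero_single_obj_X _ _ _ _ h)) projInj_zero

/-- The functor from the stable category to `D^b(E) / K^b(ProjInj)` induced by `X ↦ X[0]`. -/
noncomputable def stabToDsing : S.Stab ⥤ S.Dsing :=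
  S.liftStab (singleKb E ⋙ S.toDsing) (fun _ hP =>
    S.isZero_toDsing_obj (S.projInj_single hP))

end ExactStructure
end Complexes

section Abs
variable {C : Type u} [Category.{v} C] [Abelian C]

instance hasFiniteBiproducts_of_abelian : HasFiniteBiproducts C := Abelian.hasFiniteBiproducts

variable (n : ℕ) [NeZero n] (W : 𝟭 C ⟶ 𝟭 C)

namespace MF

/-- The stable category of matrix factorizations with the graded-split exact structure. -/
abbrev StabMF := (gradedExact n W).Stab

/-- The stable category of matrix factorizations with projective components. -/
abbrev StabProj := (gradedExact n (restrictProj W)).Stab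

/-- The functor of stable categories induced by the inclusion of the projective objects. -/
noncomputable def stabIncl : StabProj n W ⥤ StabMF n W :=
  stabMap (isProjective C).ι (fun _ => rfl)

variable {n W} in
/-- A factorization is projective for the abelian exact structure (in which the admissible
epimorphisms are the morphisms that are epimorphisms in each component). -/
def IsProjectiveAb (P : MF n W) : Prop :=
  ∀ ⦃M N : MF n W⦄ (g : M ⟶ N), (∀ i, Epi (g.f i)) → ∀ u : P ⟶ N, ∃ v : P ⟶ M, v ≫ g = u

variable {n W} in
/-- A complex of factorizations is acyclic in the abelian sense if its components are exact
complexes in `C`. -/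
def AcyclicAb (K : CochainComplex (MF n W) ℤ) : Prop :=
  ∀ i, (((eval W i).mapHomologicalComplex (.up ℤ)).obj K).Acyclic

/-- The subcategory `𝒦` of `D^b(MF)` of acyclic complexes (in the abelian sense). -/
def acyclicDb : ObjectProperty (gradedExact n W).Db := fun Y =>
  ∃ K : Kb (MF n W), AcyclicAb K.obj.as ∧ Nonempty (Y ≅ (verdierQ (gradedExact n W).acyclicB).obj K)

/-- The image `Tot(𝒦)` of the acyclic complexes in the stable category, under the identification
of the latter with `D^b / K^b(ProjInj)`. -/
def totAcyclic : ObjectProperty (StabMF n W) := fun M =>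
  ∃ Y : (gradedExact n W).Db, acyclicDb n W Y ∧
    Nonempty ((gradedExact n W).stabToDsing.obj M ≅ (verdierQ (gradedExact n W).perfect).obj Y)

/-- The subcategory `K⁻(Proj) ∩ D^b(MF)` of `D^b(MF)`: the bounded complexes that are isomorphic
in `D⁻(MF)` to a bounded above complex of factorizations that are projective for the abelian exact
structure. -/
def projDb : ObjectProperty (gradedExact n W).Db := fun Y =>
  ∃ (K : Kb (MF n W)) (P : Kminus (MF n W)), (∀ i, IsProjectiveAb (P.obj.as.X i)) ∧
    Nonempty (Y ≅ (verdierQ (gradedExact n W).acyclicB).obj K) ∧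
    Nonempty ((verdierQ (gradedExact n W).acyclicMinus).obj
      ((ObjectProperty.ιOfLE (bounded_le_boundedAbove (MF n W))).obj K) ≅
      (verdierQ (gradedExact n W).acyclicMinus).obj P)

/-- The image of `K⁻(Proj) ∩ D^b(MF)` in the stable category. -/
def totProj : ObjectProperty (StabMF n W) := fun M =>
  ∃ Y : (gradedExact n W).Db, projDb n W Y ∧
    Nonempty ((gradedExact n W).stabToDsing.obj M ≅ (verdierQ (gradedExact n W).perfect).obj Y)

instance : (totAcyclic n W).Nonempty := by
  refine ⟨(gradedExact n W).toStab.obj 0, _, ⟨(singleKb _).obj 0, fun i j => ?_, ⟨Iso.refl _⟩⟩,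
    ⟨Iso.refl _⟩⟩
  refine ShortComplex.exact_of_isZero_X₂ _ ((eval W i).map_isZero ?_)
  exact (HomologicalComplex.single (MF n W) (.up ℤ) 0 ⋙
    HomologicalComplex.eval _ _ j).map_isZero (isZero_zero _)

/-- The absolute derived category: the quotient of the stable category by `Tot(𝒦)`. -/
abbrev Dabs := VerdierQuot (totAcyclic n W)

/-- The quotient functor to the absolute derived category. -/
noncomputable abbrev toDabs : StabMF n W ⥤ Dabs n W := verdierQ (totAcyclic n W)

end MF
end Abs

end MatFac

open MatFac (IsSemiorthogonalDecomposition IsTriangulatedFunctor)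
open MatFac.MF (gradedExact StabMF stabIncl acyclicDb projDb totAcyclic totProj toDabs)

/-! Every bounded complex is an iterated extension of shifts of its terms (`prop_of_singleKb`), so a
property of `D^b` that is stable under triangles needs to be checked only on objects `M[0]`. A
complex is acyclic for the componentwise split structure exactly when all its components are
contractible (`acyclic_iff`). The acyclic complexes are therefore the common kernel of triangulated
functors to `K(C)`, hence thick, and `Hom(A, B[-j]) = 0` in `D^b` for objects `A`, `B` and `j > 0`
(`orth_singleDb_shift`). This vanishing makes the connecting morphism of an admissible sequence
unique and natural, which is what turns functors on the exact category into triangulated functors on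
the stable one.

The stable category and `D^b/K^b(ProjInj)`: a morphism of the quotient is a fraction `X → Z ← Y`
whose denominator has a cone `W` in the thick closure of the perfect complexes, and for such `W` all
`Hom(A, W[k])` with `k` large vanish. Replacing `X` and `Y` by their cosyzygies lowers the bound on
`k`; once it reaches `0`, the numerator lifts to a morphism `X → Y`, and fullness of the suspension
brings it back (`exists_map_comp_eq`). If `X[0]` dies in the quotient, then `Hom(A, X[k])` vanishes
for large `k`, by dimension shifting already for `k = 1`, so `X` is a summand of its hull; a full
triangulated functor reflecting zero objects is faithful. Essential surjectivity is dévissage.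

The decomposition of `D^b`: let `M` have projective components. A projective resolution of `M` in
the abelian category of factorizations is a quasi-isomorphism between bounded above complexes with
projective components, hence a homotopy equivalence in each component, so `M[0]` lies in `𝒫`
(`projDb_singleDb`). Also `M[0]` is left orthogonal to `𝒦`, by dimension shifting along covers by
trivial factorizations (`leftOrthogonal_singleDb`). Since all projective dimensions are finite, such
`M` and `𝒦` generate `D^b` (`prop_of_projComp`), and orthogonality turns generation into a triangle
`L → X → A` for each `X`. Finally `𝒫 ∩ 𝒦 = 0`, as one sees in `D⁻`; hence `𝒫` is the smallest
isomorphism-closed triangulated subcategory containing the `M[0]` (`projDb_le`), and it inherits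
their orthogonality.

Descent: stable morphisms between factorizations with projective components may be tested against
trivial factorizations with projective components, so `stabIncl` is fully faithful, and minimality
of `𝒫` identifies its image with `Tot(𝒫)`. Orthogonality to `𝒦` survives in the quotient by the same
cosyzygy argument as for fullness (`dsing_map_eq_zero`), and the triangles of `D^b` lift along the
equivalence. The statement on the absolute derived category is the general fact that the quotient by
one component of a semiorthogonal decomposition is the other. -/

open CategoryTheory Category Limits Preadditive ZeroObject Pretriangulated

universe v'' u''

namespace MatFac

/-! ### Functors commuting with the shift by one -/

section CommShiftOfOne
variable {C : Type u} [Category.{v} C] {D : Type u'} [Category.{v'} D] [HasShift C ℤ]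
  [HasShift D ℤ]

namespace Spectrum

/-- The sequence of all shifts of an object. -/
noncomputable def ofObj (Y : D) : Spectrum (shiftFunctor D (1 : ℤ)) where
  X n := Y⟦n⟧
  φ n m h := (shiftFunctorAdd' D n 1 m h).symm.app Y

variable (F : C ⥤ D) (e : shiftFunctor C (1 : ℤ) ⋙ F ≅ F ⋙ shiftFunctor D (1 : ℤ))

/-- The image of the sequence of all shifts of an object. -/
noncomputable def mapOfObj (X : C) : Spectrum (shiftFunctor D (1 : ℤ)) where
  X n := F.obj (X⟦n⟧)
  φ n m h := e.symm.app (X⟦n⟧) ≪≫ F.mapIso ((shiftFunctorAdd' C n 1 m h).symm.app X)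

/-- Compatibility of a family of maps with the shift by one. -/
def IsFamily {X : C} {Y : D} (α : ∀ n : ℤ, F.obj (X⟦n⟧) ⟶ Y⟦n⟧) : Prop :=
  ∀ (n m : ℤ) (h : n + 1 = m), (α n)⟦(1 : ℤ)⟧' ≫ (shiftFunctorAdd' D n 1 m h).inv.app Y =
    e.inv.app (X⟦n⟧) ≫ F.map ((shiftFunctorAdd' C n 1 m h).inv.app X) ≫ α m

/-- A compatible family as a morphism of sequences. -/
noncomputable def IsFamily.hom {X : C} {Y : D} {α : ∀ n : ℤ, F.obj (X⟦n⟧) ⟶ Y⟦n⟧}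
    (h : IsFamily F e α) : mapOfObj F e X ⟶ ofObj Y :=
  ⟨α, fun n m hnm => (h n m hnm).trans (assoc _ _ _).symm⟩

variable {F e}

/-- The shift by one is faithful, so a morphism of sequences is determined by its term of index
zero. All coherence checks below are reduced to index zero in this way. -/
lemma IsFamily.ext {X : C} {Y : D} {α β : ∀ n : ℤ, F.obj (X⟦n⟧) ⟶ Y⟦n⟧}
    (hα : IsFamily F e α) (hβ : IsFamily F e β) (h : α 0 = β 0) (n : ℤ) : α n = β n := by
  have : hα.hom = hβ.hom := (ev (shiftFunctor D (1 : ℤ))).map_injective h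
  exact congr_arg (fun g => Hom.f g n) this

variable (F e) in
lemma exists_isFamily {X : C} {Y : D} (u : F.obj (X⟦(0 : ℤ)⟧) ≅ Y⟦(0 : ℤ)⟧) :
    ∃ α : ∀ n : ℤ, F.obj (X⟦n⟧) ≅ Y⟦n⟧, IsFamily F e (fun n => (α n).hom) ∧ (α 0).hom = u.hom := by
  let θ : mapOfObj F e X ≅ ofObj Y := (ev (shiftFunctor D (1 : ℤ))).preimageIso u
  refine ⟨fun n =>
    { hom := θ.hom.f n
      inv := θ.inv.f n
      hom_inv_id := congr_arg (fun g => Hom.f g n) θ.hom_inv_id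
      inv_hom_id := congr_arg (fun g => Hom.f g n) θ.inv_hom_id }, fun n m h =>
        (θ.hom.comm n m h).trans (assoc _ _ _), ?_⟩
  exact (ev (shiftFunctor D (1 : ℤ))).map_preimage (X := mapOfObj F e X) (Y := ofObj Y) u.hom

lemma IsFamily.comp {X : C} {Y Y' : D} {α : ∀ n : ℤ, F.obj (X⟦n⟧) ⟶ Y⟦n⟧}
    (hα : IsFamily F e α) (f : Y ⟶ Y') : IsFamily F e (fun n => α n ≫ f⟦n⟧') := by
  intro n m h
  have := (shiftFunctorAdd' D n 1 m h).inv.naturality f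
  dsimp at this
  rw [Functor.map_comp, assoc, this, ← assoc, hα n m h]
  simp

lemma IsFamily.precomp {X X' : C} {Y : D} {α : ∀ n : ℤ, F.obj (X⟦n⟧) ⟶ Y⟦n⟧}
    (hα : IsFamily F e α) (f : X' ⟶ X) : IsFamily F e (fun n => F.map (f⟦n⟧') ≫ α n) := by
  intro n m h
  have h₁ := e.inv.naturality (f⟦n⟧')
  have h₂ := (shiftFunctorAdd' C n 1 m h).inv.naturality f
  dsimp at h₁ h₂
  rw [Functor.map_comp, assoc, hα n m h, reassoc_of% h₁, ← F.map_comp_assoc, h₂,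
    F.map_comp_assoc]

/-- This is the right-hand side of the additivity axiom for a commutation with shifts, read as a
family in the second index. The associativity of the shift isomorphisms makes it compatible. -/
lemma IsFamily.shift {X : C} {Y : D} {α : ∀ n : ℤ, F.obj (X⟦n⟧) ⟶ Y⟦n⟧}
    (hα : IsFamily F e α) (a : ℤ) : IsFamily F e (X := X⟦a⟧) (Y := Y⟦a⟧) (fun n =>
      F.map ((shiftFunctorAdd C a n).inv.app X) ≫ α (a + n) ≫
        (shiftFunctorAdd D a n).hom.app Y) := by
  intro n m h
  subst h
  have h₁ := shiftFunctorAdd'_assoc_inv_app a n 1 _ _ _ rfl rfl rfl X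
  have h₂ := shiftFunctorAdd'_assoc_hom_app a n 1 _ _ _ rfl rfl rfl Y
  have h₃ := hα (a + n) _ rfl
  have h₄ := e.inv.naturality ((shiftFunctorAdd C a n).inv.app X)
  have h₅ : ∀ (t : ℤ) (ht : a + (n + 1) = t),
      F.map ((shiftFunctorAdd' C a (n + 1) t ht).inv.app X) ≫
      α t ≫ (shiftFunctorAdd' D a (n + 1) t ht).hom.app Y =
      F.map ((shiftFunctorAdd C a (n + 1)).inv.app X) ≫
      α (a + (n + 1)) ≫ (shiftFunctorAdd D a (n + 1)).hom.app Y := by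
    rintro t rfl
    simp [shiftFunctorAdd'_eq_shiftFunctorAdd]
  dsimp at h₁ h₂ h₃ h₄ ⊢
  rw [← shiftFunctorAdd'_eq_shiftFunctorAdd D, ← cancel_mono
    ((shiftFunctorAdd' D n 1 (n + 1) rfl).hom.app (Y⟦a⟧)), ← h₅ (a + n + 1) (by omega)]
  have h₆ := (shiftFunctorAdd' D n 1 (n + 1) rfl).inv_hom_id_app (Y⟦a⟧)
  dsimp at h₆
  simp only [assoc, h₆, comp_id]
  rw [← h₂, ← F.map_comp_assoc, ← h₁, F.map_comp_assoc]
  have h₇ : (α (a + n))⟦(1 : ℤ)⟧' =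
    e.inv.app (X⟦a + n⟧) ≫ F.map ((shiftFunctorAdd' C (a + n) 1 _ rfl).inv.app X) ≫
      α (a + n + 1) ≫ (shiftFunctorAdd' D (a + n) 1 _ rfl).hom.app Y := by
    rw [← reassoc_of% h₃, Iso.inv_hom_id_app]
    exact (comp_id _).symm
  rw [Functor.map_comp, Functor.map_comp, h₇, assoc, assoc, assoc, reassoc_of% h₄,
    shiftFunctorAdd'_eq_shiftFunctorAdd C (a + n) 1, shiftFunctorAdd'_eq_shiftFunctorAdd C a n]

end Spectrum

/-- A functor commuting with the shift by one commutes with all shifts. -/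
theorem exists_commShift (F : C ⥤ D)
    (e : shiftFunctor C (1 : ℤ) ⋙ F ≅ F ⋙ shiftFunctor D (1 : ℤ)) :
    ∃ _ : F.CommShift ℤ, F.commShiftIso (1 : ℤ) = e := by
  -- The unit axiom forces the term of index zero; `e` then determines all the others.
  have H := fun X : C => Spectrum.exists_isFamily F e
    (F.mapIso ((shiftFunctorZero C ℤ).app X) ≪≫ ((shiftFunctorZero D ℤ).app (F.obj X)).symm)
  choose α hα hα₀ using H
  dsimp at hα₀
  have nat : ∀ {X X' : C} (f : X ⟶ X') (n : ℤ),
      F.map (f⟦n⟧') ≫ (α X' n).hom = (α X n).hom ≫ (F.map f)⟦n⟧' := by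
    intro X X' f n
    refine ((hα X').precomp f).ext ((hα X).comp (F.map f)) ?_ n
    have h₁ := (shiftFunctorZero C ℤ).hom.naturality f
    have h₂ := (shiftFunctorZero D ℤ).inv.naturality (F.map f)
    dsimp at h₁ h₂ ⊢
    rw [hα₀, hα₀, ← F.map_comp_assoc, h₁, F.map_comp_assoc, h₂, assoc]
  let iso : ∀ n : ℤ, shiftFunctor C n ⋙ F ≅ F ⋙ shiftFunctor D n := fun n =>
    NatIso.ofComponents (fun X => α X n) (fun f => nat f n)
  refine ⟨⟨iso, ?_, fun a b => ?_⟩, ?_⟩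
  · ext X
    refine (hα₀ X).trans ?_
    simp
  · ext X
    -- For fixed `a` both sides of the additivity axiom are compatible families in `b`, so it
    -- suffices to compare them at `b = 0`.
    have h := (((hα (X⟦a⟧)).comp (α X a).hom).ext ((hα X).shift a) ?_ b)
    · have h₁ := (shiftFunctorAdd C a b).hom_inv_id_app X
      have h₂ := (shiftFunctorAdd D a b).hom_inv_id_app (F.obj X)
      have h₃ := reassoc_of% h
      dsimp at h₁ h₂
      rw [Functor.CommShift.isoAdd_hom_app]
      dsimp [iso]
      rw [h₃, ← F.map_comp_assoc, h₁, h₂, F.map_id, id_comp]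
      exact (comp_id _).symm
    · have h₅ : ∀ (t : ℤ) (ht : a + 0 = t),
          F.map ((shiftFunctorAdd' C a 0 t ht).inv.app X) ≫
          (α X t).hom ≫ (shiftFunctorAdd' D a 0 t ht).hom.app (F.obj X) =
          F.map ((shiftFunctorAdd C a 0).inv.app X) ≫
          (α X (a + 0)).hom ≫ (shiftFunctorAdd D a 0).hom.app (F.obj X) := by
        rintro t rfl
        simp [shiftFunctorAdd'_eq_shiftFunctorAdd]
      have h₆ := (shiftFunctorZero D ℤ).inv.naturality ((α X a).hom)
      dsimp at h₆
      refine Eq.trans ?_ (h₅ a (by simp))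
      rw [hα₀, shiftFunctorAdd'_add_zero_inv_app, shiftFunctorAdd'_add_zero_hom_app, assoc, ← h₆]
  · ext X
    -- The compatibility between the indices `0` and `1` says that the isomorphism of index one is
    -- `e`.
    have h := hα X 0 1 (by simp)
    dsimp at h
    have h₁ := e.inv.naturality ((shiftFunctorZero C ℤ).hom.app X)
    dsimp at h₁
    rw [shiftFunctorAdd'_zero_add_inv_app, shiftFunctorAdd'_zero_add_inv_app, hα₀] at h
    rw [Functor.map_comp, assoc, ← Functor.map_comp, Iso.inv_hom_id_app, ← reassoc_of% h₁] at h
    have h₂ : 𝟙 _ = e.inv.app X ≫ (α X 1).hom := by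
      rw [← cancel_epi ((shiftFunctor D (1 : ℤ)).map (F.map ((shiftFunctorZero C ℤ).hom.app X))),
        ← h]
      simp
    refine Eq.trans ?_ (comp_id (e.hom.app X))
    refine Eq.trans ?_ (e.hom.app X ≫= h₂.symm)
    exact (e.hom_inv_id_app_assoc X (α X 1).hom).symm

end CommShiftOfOne
end MatFac
namespace MatFac

/-! ### Triangulated functors out of the stable category -/

section DeltaFunctor
variable {E : Type u} [Category.{v} E] [Preadditive E] [HasZeroObject E] [HasBinaryBiproducts E]
  {D : Type u'} [Category.{v'} D] [HasZeroObject D] [HasShift D ℤ]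
  [Preadditive D] [∀ n : ℤ, (shiftFunctor D n).Additive] [Pretriangulated D]

namespace ExactStructure
variable (S : ExactStructure E)

/-- A connecting morphism for the additive functor `F`, natural in admissible short exact
sequences, which turns them into distinguished triangles. -/
structure Connecting (F : E ⥤ D) where
  /-- the connecting morphism -/
  δ : ∀ {X Y Z : E} {f : X ⟶ Y} {g : Y ⟶ Z}, S.Conf f g → (F.obj Z ⟶ (F.obj X)⟦(1 : ℤ)⟧)
  dist : ∀ {X Y Z : E} {f : X ⟶ Y} {g : Y ⟶ Z} (h : S.Conf f g),
    Triangle.mk (F.map f) (F.map g) (δ h) ∈ distTriang D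
  naturality : ∀ {X Y Z X' Y' Z' : E} {f : X ⟶ Y} {g : Y ⟶ Z} {f' : X' ⟶ Y'} {g' : Y' ⟶ Z'}
    (h : S.Conf f g) (h' : S.Conf f' g') (a : X ⟶ X') (b : Y ⟶ Y') (c : Z ⟶ Z'),
    f ≫ b = a ≫ f' → g ≫ c = b ≫ g' → δ h ≫ (F.map a)⟦(1 : ℤ)⟧' = F.map c ≫ δ h'

variable {S} {F : E ⥤ D} [F.Additive] (hF : ∀ P : E, S.ProjInj P → IsZero (F.obj P))

instance liftStab_additive : (S.liftStab F hF).Additive where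
  map_add {X Y f g} := by
    obtain ⟨X, rfl⟩ := Stab.exists_rep X
    obtain ⟨Y, rfl⟩ := Stab.exists_rep Y
    obtain ⟨f, rfl⟩ := S.toStab.map_surjective f
    obtain ⟨g, rfl⟩ := S.toStab.map_surjective g
    rw [← S.toStab.map_add]
    exact F.map_add

namespace Connecting
-- The sign is dictated by `Conf.stdDist`: in the stable category the third morphism of an
-- admissible sequence is minus the induced map to the cosyzygy. Hence the commutation with the
-- suspension has to be minus the connecting morphism.
lemma isIso_δ (d : S.Connecting F) {X Y Z : E} {f : X ⟶ Y} {g : Y ⟶ Z} (h : S.Conf f g) (hY : IsZero (F.obj Y)) :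
    IsIso (-d.δ h) := by
  have : IsIso (d.δ h) := (Triangle.isZero₂_iff_isIso₃ _ (d.dist h)).1 hY
  exact ⟨-inv (d.δ h), by simp, by simp⟩

variable [S.IsFrobenius] (d : S.Connecting F)

/-- The functor on the stable category induced by `F` commutes with the suspension. -/
noncomputable def suspIso : S.susp ⋙ S.liftStab F hF ≅ S.liftStab F hF ⋙ shiftFunctor D (1 : ℤ) :=
  NatIso.ofComponents (fun X =>
    have := d.isIso_δ (S.conf_hull X.as) (hF _ (S.projInj_hull _))
    (asIso (-d.δ (S.conf_hull X.as)) : F.obj (S.cosyzygy X.as) ≅ (F.obj X.as)⟦(1 : ℤ)⟧)) (by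
    intro X Y f
    obtain ⟨X, rfl⟩ := Stab.exists_rep X
    obtain ⟨Y, rfl⟩ := Stab.exists_rep Y
    obtain ⟨f, rfl⟩ := S.toStab.map_surjective f
    change F.map (S.mapCosyzygy f) ≫ (-d.δ (S.conf_hull _)) =
      (-d.δ (S.conf_hull _)) ≫ (F.map f)⟦(1 : ℤ)⟧'
    rw [comp_neg, neg_comp, d.naturality (S.conf_hull _) (S.conf_hull _) f (S.mapHull f)
      (S.mapCosyzygy f) (S.toHull_mapHull f) (S.fromHull_mapCosyzygy f)])

lemma suspIso_hom_app (X : E) :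
    (d.suspIso hF).hom.app (S.toStab.obj X) = -d.δ (S.conf_hull X) := rfl

include hF in
-- The pushout yields the admissible sequence `B ⟶ Q ⟶ S.cosyzygy A`, whose triangle is a rotation
-- of the one wanted. Naturality of the connecting morphism along `u` identifies the third maps, and
-- the sign of the rotation cancels the sign in `-δ`.
lemma dist_of_isPushout {A B Q : E} {u : A ⟶ B} {i : S.hull A ⟶ Q} {j : B ⟶ Q}
    {p : Q ⟶ S.cosyzygy A} (hp : IsPushout (S.toHull A) u i j) (hi : i ≫ p = S.fromHull A)
    (hj : j ≫ p = 0) : Triangle.mk (F.map u) (F.map j) (F.map p ≫ (-d.δ (S.conf_hull A))) ∈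
      distTriang D := by
  have hc : S.Conf j p := (S.conf_hull A).of_isPushout hp hi hj
  have := d.isIso_δ (S.conf_hull A) (hF _ (S.projInj_hull _))
  have hδ := d.naturality (S.conf_hull A) hc u i (𝟙 _) hp.w (by rw [comp_id, hi])
  rw [F.map_id, id_comp] at hδ
  rw [rotate_distinguished_triangle]
  refine isomorphic_distinguished _ (d.dist hc) _ ?_
  refine (Triangle.isoMk _ _ (Iso.refl (F.obj B)) (Iso.refl (F.obj Q))
    (show F.obj (S.cosyzygy A) ≅ (F.obj A)⟦(1 : ℤ)⟧ from asIso (-d.δ (S.conf_hull A))) ?_ ?_ ?_).symm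
  · exact (comp_id _).trans (id_comp _).symm
  · exact (id_comp _).symm
  · change d.δ hc ≫ (𝟙 (F.obj B))⟦(1 : ℤ)⟧' = (-d.δ (S.conf_hull A)) ≫ (-(F.map u)⟦(1 : ℤ)⟧')
    rw [CategoryTheory.Functor.map_id, comp_id, comp_neg, neg_comp, neg_neg, hδ]

include d in
-- Every distinguished triangle of the stable category is by definition isomorphic to one coming
-- from a pushout along a hull, and these are covered by `dist_of_isPushout`.
theorem isTriangulatedFunctor : IsTriangulatedFunctor (S.liftStab F hF) := by
  let L := S.liftStab F hF
  obtain ⟨hc, he⟩ := exists_commShift L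
    (Functor.isoWhiskerRight S.shiftIso L ≪≫ d.suspIso hF)
  refine ⟨hc, ⟨fun T hT => ?_⟩⟩
  have hT' : T = Triangle.mk T.mor₁ T.mor₂ ((T.mor₃ ≫ S.shiftIso.hom.app _) ≫
      S.shiftIso.inv.app _) := by
    rw [assoc, Iso.hom_inv_id_app]
    exact congrArg (Triangle.mk T.mor₁ T.mor₂) (comp_id T.mor₃).symm
  rw [hT', mk_mem_distTriang_iff] at hT
  obtain ⟨A, B, Q, u, i, j, p, a, b, c, hp, hi, hj, h₁, h₂, h₃⟩ := hT
  refine isomorphic_distinguished _ (d.dist_of_isPushout hF hp hi hj) _ ?_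
  refine (Triangle.isoMk _ _ (L.mapIso a) (L.mapIso b) (L.mapIso c) ?_ ?_ ?_).symm
  · exact (L.map_comp _ _).symm.trans ((congrArg L.map h₁).trans (L.map_comp _ _))
  · exact (L.map_comp _ _).symm.trans ((congrArg L.map h₂).trans (L.map_comp _ _))
  · change (F.map p ≫ (-d.δ (S.conf_hull A))) ≫ (L.map a.hom)⟦(1 : ℤ)⟧' =
      L.map c.hom ≫ L.map T.mor₃ ≫ (L.commShiftIso (1 : ℤ)).hom.app T.obj₁
    have h₄ := (d.suspIso hF).hom.naturality a.hom
    rw [he]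
    change L.map (S.susp.map a.hom) ≫ _ = _ ≫ (L.map a.hom)⟦(1 : ℤ)⟧' at h₄
    rw [assoc, ← d.suspIso_hom_app hF]
    refine (F.map p ≫= h₄.symm).trans ?_
    have h₅ := congrArg L.map h₃
    rw [L.map_comp, L.map_comp, L.map_comp, ] at h₅
    refine (assoc _ _ _).symm.trans ((h₅ =≫ _).trans ?_)
    rw [assoc, assoc]
    rfl

end Connecting
end ExactStructure
end DeltaFunctor
end MatFac
namespace MatFac

/-! ### Semiorthogonal decompositions and Verdier quotients -/

section Formal
variable {T : Type u} [Category.{v} T] [HasZeroObject T] [HasShift T ℤ] [Preadditive T]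
  [∀ n : ℤ, (shiftFunctor T n).Additive] [Pretriangulated T]
  {T' : Type u'} [Category.{v'} T'] [HasZeroObject T'] [HasShift T' ℤ] [Preadditive T']
  [∀ n : ℤ, (shiftFunctor T' n).Additive] [Pretriangulated T']
  {T'' : Type u''} [Category.{v''} T''] [HasZeroObject T''] [HasShift T'' ℤ] [Preadditive T'']
  [∀ n : ℤ, (shiftFunctor T'' n).Additive] [Pretriangulated T'']

section Exact
variable {X Y Z : T} {f : X ⟶ Y} {g : Y ⟶ Z} {h : Z ⟶ X⟦(1 : ℤ)⟧}
  (hT : Triangle.mk f g h ∈ distTriang T)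
include hT

lemma dist_comp₁₂ : f ≫ g = 0 := comp_distTriang_mor_zero₁₂ _ hT
lemma dist_comp₃₁ : h ≫ f⟦(1 : ℤ)⟧' = 0 := comp_distTriang_mor_zero₃₁ _ hT

lemma dist_yoneda₂ {W : T} (k : Y ⟶ W) (hk : f ≫ k = 0) : ∃ r : Z ⟶ W, g ≫ r = k := by
  obtain ⟨r, hr⟩ := Triangle.yoneda_exact₂ _ hT k hk
  exact ⟨r, hr.symm⟩

lemma dist_yoneda₃ {W : T} (k : Z ⟶ W) (hk : g ≫ k = 0) : ∃ r : X⟦(1 : ℤ)⟧ ⟶ W, h ≫ r = k := by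
  obtain ⟨r, hr⟩ := Triangle.yoneda_exact₃ _ hT k hk
  exact ⟨r, hr.symm⟩

lemma dist_coyoneda₁ {W : T} (k : W ⟶ X⟦(1 : ℤ)⟧) (hk : k ≫ f⟦(1 : ℤ)⟧' = 0) :
    ∃ r : W ⟶ Z, r ≫ h = k := by
  obtain ⟨r, hr⟩ := Triangle.coyoneda_exact₁ _ hT k hk
  exact ⟨r, hr.symm⟩

lemma dist_coyoneda₂ {W : T} (k : W ⟶ Y) (hk : k ≫ g = 0) : ∃ r : W ⟶ X, r ≫ f = k := by
  obtain ⟨r, hr⟩ := Triangle.coyoneda_exact₂ _ hT k hk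
  exact ⟨r, hr.symm⟩

lemma dist_coyoneda₃ {W : T} (k : W ⟶ Z) (hk : k ≫ h = 0) : ∃ r : W ⟶ Y, r ≫ g = k := by
  obtain ⟨r, hr⟩ := Triangle.coyoneda_exact₃ _ hT k hk
  exact ⟨r, hr.symm⟩

lemma dist_isZero₁_iff : IsZero X ↔ IsIso g := Triangle.isZero₁_iff_isIso₂ _ hT
lemma dist_isZero₂_iff : IsZero Y ↔ IsIso h := Triangle.isZero₂_iff_isIso₃ _ hT
lemma dist_isZero₃_iff : IsZero Z ↔ IsIso f := Triangle.isZero₃_iff_isIso₁ _ hT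

lemma dist_rotate : Triangle.mk g h (-f⟦(1 : ℤ)⟧') ∈ distTriang T := rot_of_distTriang _ hT

lemma dist_map (F : T ⥤ T') [F.CommShift ℤ] [F.IsTriangulated] :
    Triangle.mk (F.map f) (F.map g) (F.map h ≫ (F.commShiftIso (1 : ℤ)).hom.app X) ∈
      distTriang T' :=
  F.map_distinguished _ hT

lemma dist_of_iso {X' Y' Z' : T} {f' : X' ⟶ Y'} {g' : Y' ⟶ Z'} {h' : Z' ⟶ X'⟦(1 : ℤ)⟧}
    (a : X ≅ X') (b : Y ≅ Y') (c : Z ≅ Z') (h₁ : f ≫ b.hom = a.hom ≫ f')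
    (h₂ : g ≫ c.hom = b.hom ≫ g') (h₃ : h ≫ a.hom⟦(1 : ℤ)⟧' = c.hom ≫ h') :
    Triangle.mk f' g' h' ∈ distTriang T :=
  isomorphic_distinguished _ hT _ (Triangle.isoMk _ _ a b c h₁ h₂ h₃).symm

end Exact

/-- A full triangulated functor which reflects zero objects is faithful. -/
lemma faithful_of_isZero (F : T ⥤ T') [F.CommShift ℤ] [F.IsTriangulated] [F.Full]
    (hF : ∀ X : T, IsZero (F.obj X) → IsZero X) : F.Faithful := by
  have h₀ : ∀ {X Y : T} (f : X ⟶ Y), F.map f = 0 → f = 0 := by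
    intro X Y f hf
    obtain ⟨Z, g, h, hT⟩ := distinguished_cocone_triangle f
    -- As `F` kills `f`, the image of `g : Y ⟶ Z` has a retraction, which lifts by fullness. The
    -- lifted composite `g ≫ r` becomes the identity under `F`, so its cone is killed and it is an
    -- isomorphism; then `f ≫ g = 0` forces `f = 0`.
    obtain ⟨r, hr⟩ := dist_yoneda₂ (dist_map hT F) (𝟙 (F.obj Y)) ((comp_id _).trans hf)
    obtain ⟨r, rfl⟩ := F.map_surjective r
    have : IsIso (g ≫ r) := by
      obtain ⟨Z', g', h', hT'⟩ := distinguished_cocone_triangle (g ≫ r)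
      have : IsIso (F.map (g ≫ r)) := by
        rw [F.map_comp, hr]
        infer_instance
      exact (dist_isZero₃_iff hT').1 (hF _ ((dist_isZero₃_iff (dist_map hT' F)).2 this))
    rw [← cancel_mono (g ≫ r), zero_comp, ← assoc, dist_comp₁₂ hT, zero_comp]
  exact ⟨fun {X Y f g} h => sub_eq_zero.1 (h₀ _ (by rw [F.map_sub, h, sub_self]))⟩

namespace IsTriangulatedFunctor

lemma comp {F : T ⥤ T'} {G : T' ⥤ T''} (hF : IsTriangulatedFunctor F)
    (hG : IsTriangulatedFunctor G) : IsTriangulatedFunctor (F ⋙ G) := by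
  obtain ⟨_, _⟩ := hF
  obtain ⟨_, _⟩ := hG
  exact ⟨inferInstance, inferInstance⟩

lemma isTriangulated_essImage {F : T ⥤ T'} (hF : IsTriangulatedFunctor F) [F.Full] :
    F.essImage.IsTriangulated := by
  obtain ⟨_, _⟩ := hF
  infer_instance

lemma isTriangulated_inverseImage {F : T ⥤ T'} (hF : IsTriangulatedFunctor F)
    (P : ObjectProperty T') [P.IsTriangulated] [P.IsClosedUnderIsomorphisms] :
    (P.inverseImage F).IsTriangulated := by
  obtain ⟨_, _⟩ := hF
  infer_instance

lemma faithful {F : T ⥤ T'} (hF : IsTriangulatedFunctor F) [F.Full]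
    (h : ∀ X : T, IsZero (F.obj X) → IsZero X) : F.Faithful := by
  obtain ⟨_, _⟩ := hF
  exact faithful_of_isZero F h

end IsTriangulatedFunctor

instance isStableUnderRetracts_rightOrthogonal (P : ObjectProperty T) :
    P.rightOrthogonal.IsStableUnderRetracts where
  of_retract {X Y} r hY := fun Z f hZ => by
    rw [← comp_id f, ← r.retract, ← assoc, hY (f ≫ r.i) hZ, zero_comp]

instance isStableUnderRetracts_leftOrthogonal (P : ObjectProperty T) :
    P.leftOrthogonal.IsStableUnderRetracts where
  of_retract {X Y} r hY := fun Z f hZ => by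
    rw [← id_comp f, ← r.retract, assoc, hY (r.r ≫ f) hZ, comp_zero]

section SOD
variable {A₁ A₂ : ObjectProperty T} [A₁.IsClosedUnderIsomorphisms] [A₁.IsStableUnderShift ℤ]
  [A₂.IsClosedUnderIsomorphisms] [A₂.IsStableUnderShift ℤ]
  (orth : ∀ ⦃X₁ X₂ : T⦄, A₁ X₁ → A₂ X₂ → ∀ f : X₂ ⟶ X₁, f = 0)
  (dec : ∀ X : T, ∃ (L A : T) (f : L ⟶ X) (g : X ⟶ A) (h : A ⟶ L⟦(1 : ℤ)⟧),
    Triangle.mk f g h ∈ distTriang T ∧ A₂ L ∧ A₁ A)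
include orth dec

/-- If `X` receives no morphisms from `A₂`, then `L ⟶ X` vanishes in its decomposition triangle.
Thus the identity of `L⟦1⟧` factors through `A`, where orthogonality makes it zero, and `X ≅ A`. -/
lemma eq_rightOrthogonal : A₁ = A₂.rightOrthogonal := by
  ext X
  refine ⟨fun hX L f hL => orth hX hL f, fun hX => ?_⟩
  obtain ⟨L, A, f, g, h, hT, hL, hA⟩ := dec X
  have hL₀ : IsZero L := by
    obtain ⟨k, hk⟩ := dist_coyoneda₁ hT (𝟙 (L⟦(1 : ℤ)⟧)) (by
      rw [id_comp, hX f hL, Functor.map_zero])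
    have hk₀ : k = 0 := orth hA (A₂.le_shift (1 : ℤ) _ hL) k
    rw [hk₀, zero_comp, eq_comm, ← IsZero.iff_id_eq_zero] at hk
    exact (IsZero.of_iso ((shiftFunctor T (-1 : ℤ)).map_isZero hk)
      (shiftShiftNeg L (1 : ℤ)).symm)
  have : IsIso g := (dist_isZero₁_iff hT).1 hL₀
  exact A₁.prop_of_iso (asIso g).symm hA

lemma eq_leftOrthogonal : A₂ = A₁.leftOrthogonal := by
  ext X
  refine ⟨fun hX L f hL => orth hL hX f, fun hX => ?_⟩
  obtain ⟨L, A, f, g, h, hT, hL, hA⟩ := dec X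
  have hA₀ : IsZero A := by
    obtain ⟨k, hk⟩ := dist_yoneda₃ hT (𝟙 A) (by
      rw [comp_id]
      exact hX g hA)
    have hk₀ : k = 0 := orth hA (A₂.le_shift (1 : ℤ) _ hL) k
    rw [hk₀, comp_zero] at hk
    exact (IsZero.iff_id_eq_zero _).2 hk.symm
  have : IsIso f := (dist_isZero₃_iff hT).1 hA₀
  exact A₂.prop_of_iso (asIso f) hL

/-- The two subcategories are each other's orthogonals, and orthogonals of shift-stable classes are
triangulated. So closure under isomorphisms and shifts is all that has to be known about them
beforehand. -/
lemma isSemiorthogonalDecomposition_of_triangles : IsSemiorthogonalDecomposition A₁ A₂ where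
  isTriangulated₁ := by
    rw [eq_rightOrthogonal orth dec]
    infer_instance
  isTriangulated₂ := by
    rw [eq_leftOrthogonal orth dec]
    infer_instance
  orthogonal := orth
  generate B _ _ h₁ h₂ X := by
    obtain ⟨L, A, f, g, h, hT, hL, hA⟩ := dec X
    exact B.ext_of_isTriangulatedClosed₂ _ hT (h₂ _ hL) (h₁ _ hA)

end SOD

section Quotient
variable [IsTriangulated T] (P : ObjectProperty T) [P.Nonempty]

/-- The objects killed by a Verdier quotient. -/
lemma isZero_verdierQ_obj_iff (X : T) :
    IsZero ((verdierQ P).obj X) ↔ P.triangEnvelope X := by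
  refine ⟨fun h => ?_, fun h => ?_⟩
  · have h₁ : (verdierQ P).map (𝟙 X) = (verdierQ P).map 0 := h.eq_of_src _ _
    rw [MorphismProperty.map_eq_iff_postcomp (verdierQ P) P.triangEnvelope.trW] at h₁
    obtain ⟨Y, s, hs, h₁⟩ := h₁
    rw [id_comp, zero_comp] at h₁
    subst h₁
    -- The zero morphism out of `X` now has its cone `Z` in the thick closure, and `X⟦1⟧` is a
    -- retract of this cone.
    obtain ⟨Z, g, k, hT, hZ⟩ := hs
    obtain ⟨r, hr⟩ := dist_coyoneda₁ hT (𝟙 (X⟦(1 : ℤ)⟧)) (by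
      rw [id_comp, Functor.map_zero])
    have : P.triangEnvelope (X⟦(1 : ℤ)⟧) :=
      P.triangEnvelope.prop_of_retract ⟨r, k, hr⟩ hZ
    exact P.triangEnvelope.prop_of_iso (shiftShiftNeg X (1 : ℤ))
      (P.triangEnvelope.le_shift (-1 : ℤ) _ this)
  · have hW : P.triangEnvelope.trW (0 : 0 ⟶ X) :=
      ObjectProperty.trW.mk _ (contractible_distinguished₁ X) h
    have := Localization.inverts (verdierQ P) _ _ hW
    exact ((verdierQ P).map_isZero (isZero_zero T)).of_iso
      (asIso ((verdierQ P).map (0 : 0 ⟶ X))).symm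

lemma isIso_verdierQ_map_iff {X Y : T} (f : X ⟶ Y) :
    IsIso ((verdierQ P).map f) ↔ P.triangEnvelope.trW f := by
  refine ⟨fun h => ?_, fun h => Localization.inverts (verdierQ P) _ _ h⟩
  obtain ⟨Z, g, k, hT⟩ := distinguished_cocone_triangle f
  exact ⟨Z, g, k, hT, (isZero_verdierQ_obj_iff P Z).1
    ((dist_isZero₃_iff (dist_map hT (verdierQ P))).2 h)⟩

instance verdierQ_essSurj : (verdierQ P).EssSurj := Localization.essSurj _ P.triangEnvelope.trW

lemma isTriangulatedFunctor_verdierQ : IsTriangulatedFunctor (verdierQ P) :=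
  ⟨inferInstance, inferInstance⟩

end Quotient

section Thick
variable (P : ObjectProperty T) [P.IsTriangulated] [P.IsStableUnderRetracts]

lemma triangEnvelope_eq : P.triangEnvelope = P :=
  le_antisymm ((ObjectProperty.triangEnvelope_le_iff _).2 le_rfl) (ObjectProperty.le_triangEnvelope _)

variable [IsTriangulated T]

instance : (verdierQ P).IsLocalization P.trW := by
  have : (verdierQ P).IsLocalization P.triangEnvelope.trW := inferInstance
  rwa [triangEnvelope_eq] at this

lemma isZero_verdierQ_obj_iff_of_thick (X : T) : IsZero ((verdierQ P).obj X) ↔ P X := by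
  have : P.Nonempty := ⟨0, P.prop_of_isZero (isZero_zero T)⟩
  rw [isZero_verdierQ_obj_iff, triangEnvelope_eq]

end Thick

/-- For a semiorthogonal decomposition `⟨A₁, A₂⟩`, the quotient by `A₁` is `A₂`. -/
lemma IsSemiorthogonalDecomposition.isEquivalence [IsTriangulated T] {A₁ A₂ : ObjectProperty T}
    [A₁.Nonempty] (h : IsSemiorthogonalDecomposition A₁ A₂) (F : T' ⥤ T)
    (hF : IsTriangulatedFunctor F) [F.Full] [F.Faithful] (hA : F.essImage = A₂) :
    (F ⋙ verdierQ A₁).IsEquivalence := by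
  have := h.isTriangulated₁
  have := h.isTriangulated₂
  -- The right orthogonal is thick, so passing to the thick closure of `A₁` keeps the orthogonality.
  -- Morphisms out of `A₂` are then unchanged by the quotient.
  have hle : A₁.triangEnvelope ≤ A₂.rightOrthogonal :=
    (ObjectProperty.triangEnvelope_le_iff _).2 fun X hX L f hL => h.orthogonal hX hL f
  have hbij : ∀ X Y : T', Function.Bijective
      ((F ⋙ verdierQ A₁).map : (X ⟶ Y) → _) := fun X Y => by
    have hX : A₁.triangEnvelope.leftOrthogonal (F.obj X) := fun Z f hZ =>
      hle _ hZ f (hA ▸ F.obj_mem_essImage X)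
    exact (hX.map_bijective_of_isTriangulated (verdierQ A₁) (F.obj Y)).comp
      ⟨F.map_injective, F.map_surjective⟩
  have hfull : (F ⋙ verdierQ A₁).Full := ⟨fun {X Y} => (hbij X Y).2⟩
  have hfaithful : (F ⋙ verdierQ A₁).Faithful := ⟨fun {X Y} => @(hbij X Y).1⟩
  have hT := hF.comp (isTriangulatedFunctor_verdierQ A₁)
  have hess := hT.isTriangulated_essImage
  -- The objects whose image is hit form a triangulated subcategory. It contains `A₁`, which becomes
  -- zero, and `A₂`, so it is everything by generation.
  have : (F ⋙ verdierQ A₁).EssSurj := ⟨fun Y => by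
    have hB := (isTriangulatedFunctor_verdierQ A₁).isTriangulated_inverseImage
      (F ⋙ verdierQ A₁).essImage
    have key := h.generate _ hB inferInstance (fun X hX => ?_) (fun X hX => ?_)
      ((verdierQ A₁).objPreimage Y)
    · exact (F ⋙ verdierQ A₁).essImage.prop_of_iso ((verdierQ A₁).objObjPreimageIso Y) key
    · obtain ⟨Z, hZ, hZ'⟩ := hess.toContainsZero.exists_zero
      exact (F ⋙ verdierQ A₁).essImage.prop_of_iso (hZ.iso (isZero_verdierQ_obj A₁ hX)) hZ'
    · rw [← hA] at hX
      obtain ⟨Z, ⟨e⟩⟩ := hX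
      exact ⟨Z, ⟨(verdierQ A₁).mapIso e⟩⟩⟩
  exact {}

end Formal
end MatFac
namespace MatFac

/-! ### Dévissage of bounded complexes -/

section FullSub
variable {T : Type u} [Category.{v} T] [HasZeroObject T] [HasShift T ℤ] [Preadditive T]
  [∀ n : ℤ, (shiftFunctor T n).Additive] [Pretriangulated T]

/-- Distinguished triangles in a full triangulated subcategory. -/
lemma mem_distTriang_fullSubcategory {P : ObjectProperty T} [P.IsTriangulated]
    {X Y Z : P.FullSubcategory} {f : X.obj ⟶ Y.obj} {g : Y.obj ⟶ Z.obj}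
    {h : Z.obj ⟶ X.obj⟦(1 : ℤ)⟧} (hT : Triangle.mk f g h ∈ distTriang T) :
    Triangle.mk (P.homMk f) (P.homMk g)
      (P.homMk (h ≫ (P.ι.commShiftIso (1 : ℤ)).inv.app X) : Z ⟶ X⟦(1 : ℤ)⟧) ∈
        distTriang P.FullSubcategory := by
  change P.ι.mapTriangle.obj _ ∈ distTriang T
  refine isomorphic_distinguished _ hT _ (Triangle.isoMk _ _ (Iso.refl _) (Iso.refl _)
    (Iso.refl _) ?_ ?_ ?_)
  · exact (comp_id _).trans (id_comp _).symm
  · exact (comp_id _).trans (id_comp _).symm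
  · change ((h ≫ (P.ι.commShiftIso (1 : ℤ)).inv.app X) ≫ (P.ι.commShiftIso (1 : ℤ)).hom.app X) ≫
      (shiftFunctor T (1 : ℤ)).map (𝟙 X.obj) = 𝟙 _ ≫ h
    have e : (h ≫ (P.ι.commShiftIso (1 : ℤ)).inv.app X) ≫
        (P.ι.commShiftIso (1 : ℤ)).hom.app X = h :=
      (assoc _ _ _).trans ((h ≫= Iso.inv_hom_id_app (P.ι.commShiftIso (1 : ℤ)) X).trans
        (comp_id _))
    exact (e =≫ _).trans ((h ≫= (shiftFunctor T (1 : ℤ)).map_id X.obj).trans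
      ((comp_id _).trans (id_comp h).symm))

end FullSub

section Devissage
variable {E : Type u} [Category.{v} E] [Preadditive E] [HasZeroObject E]

/-- A splitting in one degree of a short exact sequence of complexes. -/
def splittingEval {K₁ K₂ K₃ : CochainComplex E ℤ} (f : K₁ ⟶ K₂) (g : K₂ ⟶ K₃) (w : f ≫ g = 0)
    (n : ℤ) (r : K₂.X n ⟶ K₁.X n) (s : K₃.X n ⟶ K₂.X n) (h₁ : f.f n ≫ r = 𝟙 _)
    (h₂ : s ≫ g.f n = 𝟙 _) (h₃ : r ≫ f.f n + g.f n ≫ s = 𝟙 _) :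
    ((ShortComplex.mk f g w).map (HomologicalComplex.eval E _ n)).Splitting :=
  ⟨r, s, h₁, h₂, h₃⟩

/-- The subcomplex obtained by dropping the lowest term of a complex. -/
lemma exists_dropLowest (K : CochainComplex E ℤ) (a : ℤ) (ha : ∀ i < a, IsZero (K.X i)) :
    ∃ (L : CochainComplex E ℤ) (ι : L ⟶ K)
      (g : K ⟶ (HomologicalComplex.single E (.up ℤ) a).obj (K.X a)) (w : ι ≫ g = 0),
      (∀ n, Nonempty ((ShortComplex.mk ι g w).map (HomologicalComplex.eval E _ n)).Splitting) ∧
      IsZero (L.X a) ∧ ∀ i, i ≠ a → Nonempty (L.X i ≅ K.X i) := by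
  have H : ∀ i, ∃ (L : E) (ι : L ⟶ K.X i) (r : K.X i ⟶ L), ι ≫ r = 𝟙 L ∧
      (i = a → IsZero L) ∧ (i ≠ a → r ≫ ι = 𝟙 (K.X i)) := fun i => by
    by_cases h : i = a
    · exact ⟨0, 0, 0, (isZero_zero E).eq_of_src _ _, fun _ => isZero_zero E, fun h' => (h' h).elim⟩
    · exact ⟨K.X i, 𝟙 _, 𝟙 _, comp_id _, fun h' => (h h').elim, fun _ => comp_id _⟩
  choose X ι r h₁ h₂ h₃ using H
  -- Cutting off the term in degree `a` loses no differential with another target, and the one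
  -- ending in degree `a` is zero because its source is.
  have hd : ∀ i j, K.d i j ≫ r j ≫ ι j = K.d i j := fun i j => by
    by_cases hj : j = a
    · have : K.d i j = 0 := by
        by_cases hij : i + 1 = j
        · exact (ha i (by omega)).eq_of_src _ _
        · exact K.shape _ _ hij
      rw [this, zero_comp]
    · rw [h₃ j hj, comp_id]
  let L : CochainComplex E ℤ :=
    { X := X
      d := fun i j => ι i ≫ K.d i j ≫ r j
      shape := fun i j hij => by rw [K.shape _ _ hij, zero_comp, comp_zero]
      d_comp_d' := fun i j k _ _ => by
        have := reassoc_of% (hd i j)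
        simp only [assoc, this, K.d_comp_d_assoc, zero_comp, comp_zero] }
  let φ : L ⟶ K := { f := ι, comm' := fun i j _ => by simp [L, hd] }
  let g : K ⟶ (HomologicalComplex.single E (.up ℤ) a).obj (K.X a) :=
    HomologicalComplex.mkHomToSingle (𝟙 _) (fun i (hi : i + 1 = a) =>
      (ha i (by omega)).eq_of_src _ _)
  have hz : ∀ i, i ≠ a → IsZero (((HomologicalComplex.single E (.up ℤ) a).obj (K.X a)).X i) :=
    fun i hi => HomologicalComplex.isZero_single_obj_X _ _ _ _ hi
  have w : φ ≫ g = 0 := by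
    refine HomologicalComplex.hom_ext _ _ fun i => ?_
    by_cases hi : i = a
    · exact (h₂ i hi).eq_of_src _ _
    · exact (hz i hi).eq_of_tgt _ _
  refine ⟨L, φ, g, w, fun n => ?_, h₂ a rfl, fun i hi => ⟨ι i, r i, h₁ i, h₃ i hi⟩⟩
  by_cases hn : n = a
  · subst hn
    have hg : g.f n = (HomologicalComplex.singleObjXSelf _ _ _).inv :=
      (HomologicalComplex.mkHomToSingle_f _ _).trans (id_comp _)
    refine ⟨splittingEval _ _ _ n (r n) (HomologicalComplex.singleObjXSelf (.up ℤ) n (K.X n)).hom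
      (h₁ n) ?_ ?_⟩
    · rw [hg, Iso.hom_inv_id]
    · rw [hg, Iso.inv_hom_id, (h₂ n rfl).eq_of_tgt (r n) 0, zero_comp, zero_add]
  · refine ⟨splittingEval _ _ _ n (r n) 0 (h₁ n) ((hz n hn).eq_of_src _ _) ?_⟩
    rw [comp_zero, add_zero, h₃ n hn]

variable [HasBinaryBiproducts E]

/-- The distinguished triangle in `K^b` of a degreewise split short exact sequence. -/
lemma exists_dist_of_splitting {K₁ K₂ K₃ : Kb E} (f : K₁.obj.as ⟶ K₂.obj.as)
    (g : K₂.obj.as ⟶ K₃.obj.as) (w : f ≫ g = 0)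
    (σ : ∀ n, ((ShortComplex.mk f g w).map (HomologicalComplex.eval E _ n)).Splitting) :
    ∃ h : K₃ ⟶ K₁⟦(1 : ℤ)⟧, Triangle.mk
      ((bounded E).homMk ((HomotopyCategory.quotient E (.up ℤ)).map f) : K₁ ⟶ K₂)
      ((bounded E).homMk ((HomotopyCategory.quotient E (.up ℤ)).map g) : K₂ ⟶ K₃) h ∈
        distTriang (Kb E) := by
  have h := (HomotopyCategory.distinguished_iff_iso_trianglehOfDegreewiseSplit _).2
    ⟨ShortComplex.mk f g w, σ, ⟨Iso.refl _⟩⟩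
  exact ⟨(bounded E).homMk _, mem_distTriang_fullSubcategory h⟩

/-- The shifts of complexes concentrated in one degree. -/
lemma exists_singleKb_shift_iso (X : E) (a : ℤ) (h : bounded E ((HomotopyCategory.quotient E (.up ℤ)).obj
    ((CochainComplex.singleFunctor E a).obj X))) :
    Nonempty ((⟨_, h⟩ : Kb E) ≅ ((singleKb E).obj X)⟦-a⟧) := by
  refine ⟨(bounded E).fullyFaithfulι.preimageIso ?_⟩
  exact (((HomotopyCategory.singleFunctors E).shiftIso (-a) a 0 (by omega)).app X).symm ≪≫
    ((bounded E).ι.commShiftIso (-a)).symm.app ((singleKb E).obj X)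

/-- A triangulated subcategory of `K^b` containing the terms of a complex contains the complex. -/
theorem prop_of_singleKb (P : ObjectProperty (Kb E)) [P.IsTriangulated]
    [P.IsClosedUnderIsomorphisms] (K : Kb E)
    (hK : ∀ i, P ((singleKb E).obj (K.obj.as.X i))) : P K := by
  obtain ⟨a, b, h⟩ := K.property
  -- The induction is on the length of the window of degrees `[a, b]`: removing the lowest term
  -- raises `a` by one, and for `m = 0` the window is empty.
  obtain ⟨m, hm⟩ : ∃ m : ℕ, b < a + m := ⟨(b + 1 - a).toNat, by omega⟩
  induction m generalizing K a with
  | zero =>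
    have hz : IsZero K := by
      have : IsZero K.obj.as := by
        rw [IsZero.iff_id_eq_zero]
        ext i
        exact (h i (by omega)).eq_of_src _ _
      rw [IsZero.iff_id_eq_zero]
      apply ObjectProperty.hom_ext
      exact ((HomotopyCategory.quotient E (.up ℤ)).map_isZero this).eq_of_src _ _
    exact P.prop_of_isZero hz
  | succ m ih =>
    obtain ⟨L, φ, g, w, σ, hL, hL'⟩ := exists_dropLowest K.obj.as a (fun i hi => h i (Or.inl hi))
    have hLb : ∀ i, i < a + 1 ∨ b < i → IsZero (L.X i) := fun i hi => by
      by_cases hia : i = a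
      · exact hia ▸ hL
      · exact (h i (by omega)).of_iso (hL' i hia).some
    let K₁ : Kb E := ⟨(HomotopyCategory.quotient E (.up ℤ)).obj L, a + 1, b, hLb⟩
    have hs : bounded E ((HomotopyCategory.quotient E (.up ℤ)).obj
      ((CochainComplex.singleFunctor E a).obj (K.obj.as.X a))) :=
      ⟨a, a, fun i hi => HomologicalComplex.isZero_single_obj_X _ _ _ _ (by omega)⟩
    obtain ⟨δ, hδ⟩ := exists_dist_of_splitting (K₁ := K₁) (K₂ := K) (K₃ := ⟨_, hs⟩) φ g w
      (fun n => (σ n).some)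
    refine P.ext_of_isTriangulatedClosed₂ _ hδ (ih K₁ (fun i => ?_) (a + 1) hLb (by push_cast at hm; omega)) ?_
    · by_cases hia : i = a
      · exact P.prop_of_isZero ((singleKb E).map_isZero (hia ▸ hL))
      · exact P.prop_of_iso ((singleKb E).mapIso (hL' i hia).some).symm (hK i)
    · exact P.prop_of_iso (exists_singleKb_shift_iso _ _ hs).some.symm (P.le_shift _ _ (hK a))

end Devissage
end MatFac
namespace MatFac

/-! ### Vanishing of morphisms in the homotopy category -/

section Orth
variable {T : Type u} [Category.{v} T] [Preadditive T]

/-- There are no non-zero morphisms from `X` to `Y`. -/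
def Orth (X Y : T) : Prop := ∀ f : X ⟶ Y, f = 0

lemma Orth.of_iso {X Y X' Y' : T} (h : Orth X Y) (e₁ : X ≅ X') (e₂ : Y ≅ Y') : Orth X' Y' :=
  fun f => by
    rw [← cancel_mono e₂.inv, ← cancel_epi e₁.hom, h (e₁.hom ≫ f ≫ e₂.inv), zero_comp, comp_zero]

lemma Orth.map_bijective {D : Type u'} [Category.{v'} D] [Preadditive D] {X Y : T} (F : T ⥤ D)
    [F.PreservesZeroMorphisms] (hF : Function.Surjective (F.map : (X ⟶ Y) → _)) (h : Orth X Y) :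
    Orth (F.obj X) (F.obj Y) := fun f => by
  obtain ⟨f, rfl⟩ := hF f
  rw [h f, F.map_zero]

variable [HasShift T ℤ] [∀ n : ℤ, (shiftFunctor T n).Additive]

lemma Orth.shift {X Y : T} (h : Orth X Y) (n : ℤ) : Orth (X⟦n⟧) (Y⟦n⟧) :=
  h.map_bijective (shiftFunctor T n) (shiftFunctor T n).map_surjective

lemma Orth.of_sub_eq {X Y : T} {a b a' b' : ℤ} (h : Orth (X⟦a⟧) (Y⟦b⟧)) (hab : a - b = a' - b') :
    Orth (X⟦a'⟧) (Y⟦b'⟧) :=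
  (h.shift (a' - a)).of_iso ((shiftFunctorAdd' T a (a' - a) a' (by omega)).symm.app X)
    ((shiftFunctorAdd' T b (a' - a) b' (by omega)).symm.app Y)

lemma orth_shift_right_iff {X Y : T} (b : ℤ) : Orth X (Y⟦b⟧) ↔ Orth (X⟦-b⟧) Y := by
  constructor
  · intro h
    have := (h.of_iso ((shiftFunctorZero T ℤ).symm.app X) (Iso.refl _)).of_sub_eq
      (a' := -b) (b' := 0) (by omega)
    exact this.of_iso (Iso.refl _) ((shiftFunctorZero T ℤ).app Y)
  · intro h
    have := (h.of_iso (Iso.refl _) ((shiftFunctorZero T ℤ).symm.app Y)).of_sub_eq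
      (a' := 0) (b' := b) (by omega)
    exact this.of_iso ((shiftFunctorZero T ℤ).app X) (Iso.refl _)

end Orth

section Single
variable {E : Type u} [Category.{v} E] [Preadditive E] [HasZeroObject E]

open CochainComplex.HomComplex in
-- The target lives in degree `q` only, so a homotopy has a single component `K.X (q + 1) ⟶ X`,
-- namely `χ`.
lemma quotient_map_toSingle_eq_zero {K : CochainComplex E ℤ} {X : E} {q r : ℤ} (hr : q + 1 = r)
    (f : K ⟶ (CochainComplex.singleFunctor E q).obj X) (χ : K.X r ⟶ X)
    (h : f.f q ≫ (HomologicalComplex.singleObjXSelf (.up ℤ) q X).hom = K.d q r ≫ χ) :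
    (HomotopyCategory.quotient E (.up ℤ)).map f = 0 := by
  have ho : Homotopy f 0 := (Cochain.equivHomotopy _ _).symm
    ⟨Cochain.toSingleMk χ (n := -1) (by omega), by
      rw [Cochain.δ_toSingleMk χ (n := -1) (by omega) 0 q (by omega)]
      apply (Cochain.toSingleEquiv (p := q) (q := q) (n := 0) (by omega)).injective
      rw [map_add, Int.negOnePow_zero, one_smul, Cochain.toSingleEquiv_toSingleMk, ← h]
      simp only [Cochain.toSingleEquiv, AddEquiv.coe_mk, Equiv.coe_fn_mk, Cochain.ofHom_v,
        HomologicalComplex.zero_f]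
      exact (add_eq_left.2 zero_comp).symm⟩
  rw [HomotopyCategory.eq_of_homotopy _ _ ho, Functor.map_zero]

open CochainComplex.HomComplex in
lemma quotient_map_fromSingle_eq_zero {K : CochainComplex E ℤ} {X : E} {q r : ℤ} (hr : r + 1 = q)
    (f : (CochainComplex.singleFunctor E q).obj X ⟶ K) (χ : X ⟶ K.X r)
    (h : (HomologicalComplex.singleObjXSelf (.up ℤ) q X).inv ≫ f.f q = χ ≫ K.d r q) :
    (HomotopyCategory.quotient E (.up ℤ)).map f = 0 := by
  have ho : Homotopy f 0 := (Cochain.equivHomotopy _ _).symm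
    ⟨Cochain.fromSingleMk χ (n := -1) (by omega), by
      rw [Cochain.δ_fromSingleMk χ (n := -1) (by omega) 0 q (by omega)]
      apply (Cochain.fromSingleEquiv (p := q) (q := q) (n := 0) (by omega)).injective
      rw [map_add, Cochain.fromSingleEquiv_fromSingleMk, ← h]
      simp only [Cochain.fromSingleEquiv, AddEquiv.coe_mk, Equiv.coe_fn_mk, Cochain.ofHom_v,
        HomologicalComplex.zero_f]
      exact (add_eq_left.2 comp_zero).symm⟩
  rw [HomotopyCategory.eq_of_homotopy _ _ ho, Functor.map_zero]

variable {S : ExactStructure E}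

/-- A chain map to `I` vanishes on boundaries, hence descends to the next cycle object. That object
is an admissible subobject of the following term, so injectivity of `I` extends the map to the
required homotopy. -/
lemma ExactStructure.Acyclic.quotient_map_toSingle_eq_zero {K : CochainComplex E ℤ}
    (hK : S.Acyclic K) {I : E} (hI : S.IsInjective I) (q : ℤ)
    (f : K ⟶ (CochainComplex.singleFunctor E q).obj I) :
    (HomotopyCategory.quotient E (.up ℤ)).map f = 0 := by
  obtain ⟨Z, j, p, hc, hd⟩ := hK
  obtain ⟨i, rfl⟩ : ∃ i, q = i + 1 := ⟨q - 1, by omega⟩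
  let φ := f.f (i + 1) ≫ (HomologicalComplex.singleObjXSelf (.up ℤ) (i + 1) I).hom
  have hφ : K.d i (i + 1) ≫ φ = 0 := by
    have := f.comm i (i + 1)
    rw [CochainComplex.singleFunctor_obj_d, comp_zero] at this
    exact (assoc _ _ _).symm.trans ((this.symm =≫ _).trans zero_comp)
  have := (hc i).epi
  rw [hd, assoc] at hφ
  obtain ⟨ψ, hψ⟩ := (hc (i + 1)).desc φ (by rw [← cancel_epi (p i), hφ, comp_zero])
  obtain ⟨χ, hχ⟩ := hI (j (i + 1 + 1)) (hc _).inflation ψ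
  exact MatFac.quotient_map_toSingle_eq_zero rfl f χ (by rw [hd, assoc, hχ, hψ])

lemma ExactStructure.Acyclic.quotient_map_fromSingle_eq_zero {K : CochainComplex E ℤ}
    (hK : S.Acyclic K) {P : E} (hP : S.IsProjective P) (q : ℤ)
    (f : (CochainComplex.singleFunctor E q).obj P ⟶ K) :
    (HomotopyCategory.quotient E (.up ℤ)).map f = 0 := by
  obtain ⟨Z, j, p, hc, hd⟩ := hK
  obtain ⟨i, rfl⟩ : ∃ i, q = i + 1 := ⟨q - 1, by omega⟩
  let φ := (HomologicalComplex.singleObjXSelf (.up ℤ) (i + 1) P).inv ≫ f.f (i + 1)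
  have hφ : φ ≫ K.d (i + 1) (i + 1 + 1) = 0 := by
    have := f.comm (i + 1) (i + 1 + 1)
    rw [CochainComplex.singleFunctor_obj_d, zero_comp] at this
    exact (assoc _ _ _).trans ((_ ≫= this).trans comp_zero)
  have := (hc (i + 1 + 1)).mono
  rw [hd, ← assoc] at hφ
  obtain ⟨a, ha⟩ := (hc (i + 1)).lift φ (by rw [← cancel_mono (j (i + 1 + 1)), hφ, zero_comp])
  obtain ⟨χ, hχ⟩ := hP (p i) (hc _).deflation a
  exact MatFac.quotient_map_fromSingle_eq_zero rfl f χ (by rw [hd, ← assoc, hχ, ha])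

variable [HasBinaryBiproducts E]

lemma Kb.exists_hom {K L : Kb E} (f : K ⟶ L) : ∃ φ : K.obj.as ⟶ L.obj.as,
    f = (bounded E).homMk ((HomotopyCategory.quotient E (.up ℤ)).map φ) := by
  obtain ⟨φ, hφ⟩ := (HomotopyCategory.quotient E (.up ℤ)).map_surjective
    (X := K.obj.as) (Y := L.obj.as) f.hom
  exact ⟨φ, ObjectProperty.hom_ext _ hφ.symm⟩

/-- There are no non-zero maps from an acyclic complex to an injective object. -/
lemma orth_singleKb_of_isInjective {N : Kb E} (hN : S.acyclicB N) {I : E} (hI : S.IsInjective I) :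
    Orth N ((singleKb E).obj I) := fun f => by
  obtain ⟨φ, rfl⟩ := Kb.exists_hom f
  exact ObjectProperty.hom_ext _
    (ExactStructure.Acyclic.quotient_map_toSingle_eq_zero hN hI 0 φ)

/-- There are no non-zero maps from a projective object to an acyclic complex. -/
lemma orth_singleKb_of_isProjective {N : Kb E} (hN : S.acyclicB N) {P : E}
    (hP : S.IsProjective P) : Orth ((singleKb E).obj P) N := fun f => by
  obtain ⟨φ, rfl⟩ := Kb.exists_hom f
  exact ObjectProperty.hom_ext _
    (ExactStructure.Acyclic.quotient_map_fromSingle_eq_zero hN hP 0 φ)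

lemma orth_shift_of_isZero (K L : Kb E) (m : ℤ)
    (h : ∀ i, IsZero (K.obj.as.X (i + m)) ∨ IsZero (L.obj.as.X i)) : Orth (K⟦m⟧) L := fun f => by
  apply ObjectProperty.hom_ext
  let e : (K⟦m⟧).obj ≅ (HomotopyCategory.quotient E (.up ℤ)).obj (K.obj.as⟦m⟧) :=
    ((bounded E).ι.commShiftIso m).app K ≪≫
      (((HomotopyCategory.quotient E (.up ℤ)).commShiftIso m).app K.obj.as).symm
  let g : (HomotopyCategory.quotient E (.up ℤ)).obj (K.obj.as⟦m⟧) ⟶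
    (HomotopyCategory.quotient E (.up ℤ)).obj L.obj.as := e.inv ≫ f.hom
  have hg : g = 0 := by
    obtain ⟨φ, hφ⟩ := (HomotopyCategory.quotient E (.up ℤ)).map_surjective g
    rw [← hφ, show φ = 0 from ?_, Functor.map_zero]
    refine HomologicalComplex.hom_ext _ _ fun i => ?_
    rcases h i with h | h
    · exact IsZero.eq_of_src (X := (K.obj.as⟦m⟧).X i) h _ _
    · exact h.eq_of_tgt _ _
  have h : f.hom = e.hom ≫ g := (e.hom_inv_id_assoc f.hom).symm
  rw [h, hg]
  exact comp_zero

lemma isZero_singleKb_obj_X (X : E) (i : ℤ) (hi : i ≠ 0) :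
    IsZero (((singleKb E).obj X).obj.as.X i) :=
  HomologicalComplex.isZero_single_obj_X _ _ _ _ hi

lemma orth_singleKb_shift (X Y : E) (m : ℤ) (hm : m ≠ 0) :
    Orth (((singleKb E).obj X)⟦m⟧) ((singleKb E).obj Y) :=
  orth_shift_of_isZero _ _ _ fun i => by
    by_cases hi : i = 0
    · exact Or.inl (isZero_singleKb_obj_X X _ (by omega))
    · exact Or.inr (isZero_singleKb_obj_X Y _ hi)

lemma exists_orth_shift (K : Kb E) : ∃ m : ℕ, ∀ k : ℤ, m ≤ k → ∀ X : E,
    Orth (K⟦k⟧) ((singleKb E).obj X) := by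
  obtain ⟨a, b, h⟩ := K.property
  refine ⟨(b + 1).toNat, fun k hk X => orth_shift_of_isZero _ _ _ fun i => ?_⟩
  by_cases hi : i = 0
  · exact Or.inl (h _ (by omega))
  · exact Or.inr (isZero_singleKb_obj_X X _ hi)

instance singleKb_full : (singleKb E).Full where
  map_surjective {X Y} f := by
    obtain ⟨φ, rfl⟩ := Kb.exists_hom f
    obtain ⟨g, rfl⟩ := (CochainComplex.singleFunctor E 0).map_surjective φ
    exact ⟨g, rfl⟩

instance singleKb_faithful : (singleKb E).Faithful where
  map_injective {X Y} f g h := by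
    apply (CochainComplex.singleFunctor E 0).map_injective
    have h' : (HomotopyCategory.quotient E (.up ℤ)).map ((CochainComplex.singleFunctor E 0).map f) =
      (HomotopyCategory.quotient E (.up ℤ)).map ((CochainComplex.singleFunctor E 0).map g) :=
      congrArg (fun k => k.hom) h
    have ho := HomotopyCategory.homotopyOfEq _ _ h'
    refine HomologicalComplex.hom_ext _ _ fun i => ?_
    rw [ho.comm i]
    simp [dNext, prevD, CochainComplex.singleFunctor_obj_d]

end Single
end MatFac
namespace MatFac

/-! ### Connecting morphisms and negative extensions in the derived category -/

section
variable {E : Type u} [Category.{v} E] [Preadditive E] [HasZeroObject E] [HasBinaryBiproducts E]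

namespace ExactStructure

/-- The bounded acyclic complexes form a thick subcategory, and admissible short exact sequences
are quasi-isomorphic to cones. -/
class HasDerivedTriangles (S : ExactStructure E) : Prop where
  isTriangulated : S.acyclicB.IsTriangulated
  isStableUnderRetracts : S.acyclicB.IsStableUnderRetracts
  exists_cone : ∀ {X Y Z : E} {f : X ⟶ Y} {g : Y ⟶ Z}, S.Conf f g →
    ∃ (M : Kb E) (i : (singleKb E).obj Y ⟶ M) (h : M ⟶ ((singleKb E).obj X)⟦(1 : ℤ)⟧)
      (w : M ⟶ (singleKb E).obj Z), Triangle.mk ((singleKb E).map f) i h ∈ distTriang (Kb E) ∧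
        i ≫ w = (singleKb E).map g ∧ S.acyclicB.trW w

variable (S : ExactStructure E)

/-- The object `X` as an object of the bounded derived category. -/
noncomputable def singleDb : E ⥤ S.Db := singleKb E ⋙ verdierQ S.acyclicB

instance : S.singleDb.Additive := by
  unfold singleDb
  infer_instance

variable [S.HasDerivedTriangles]

instance : S.acyclicB.IsTriangulated := HasDerivedTriangles.isTriangulated
instance : S.acyclicB.IsStableUnderRetracts := HasDerivedTriangles.isStableUnderRetracts

variable {S}

lemma acyclicB.isIso {K L : Kb E} {f : K ⟶ L} (hf : S.acyclicB.trW f) :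
    IsIso ((verdierQ S.acyclicB).map f) :=
  Localization.inverts (verdierQ S.acyclicB) S.acyclicB.trW f hf

lemma rightOrthogonal_singleKb {I : E} (hI : S.IsInjective I) :
    S.acyclicB.rightOrthogonal ((singleKb E).obj I) :=
  fun _ f hN => orth_singleKb_of_isInjective hN hI f

lemma leftOrthogonal_singleKb {P : E} (hP : S.IsProjective P) :
    S.acyclicB.leftOrthogonal ((singleKb E).obj P) :=
  fun _ f hN => orth_singleKb_of_isProjective hN hP f

/-- In the derived category a short exact sequence gives a distinguished triangle. -/
lemma Conf.exists_dist {X Y Z : E} {f : X ⟶ Y} {g : Y ⟶ Z} (h : S.Conf f g) :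
    ∃ δ : S.singleDb.obj Z ⟶ (S.singleDb.obj X)⟦(1 : ℤ)⟧,
      Triangle.mk (S.singleDb.map f) (S.singleDb.map g) δ ∈ distTriang S.Db := by
  obtain ⟨M, i, k, w, hT, hw, hw'⟩ := HasDerivedTriangles.exists_cone h
  have hT' := dist_map hT (verdierQ S.acyclicB)
  have hw₀ : IsIso ((verdierQ S.acyclicB).map w) := acyclicB.isIso hw'
  let e : (verdierQ S.acyclicB).obj M ≅ S.singleDb.obj Z :=
    @asIso _ _ _ _ ((verdierQ S.acyclicB).map w) hw₀
  refine ⟨e.inv ≫ (verdierQ S.acyclicB).map k ≫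
    ((verdierQ S.acyclicB).commShiftIso (1 : ℤ)).hom.app _, dist_of_iso hT'
      (Iso.refl (S.singleDb.obj X)) (Iso.refl (S.singleDb.obj Y)) e ?_ ?_ ?_⟩
  · exact (comp_id _).trans (id_comp _).symm
  · exact ((verdierQ S.acyclicB).map_comp _ _).symm.trans
      ((congrArg (verdierQ S.acyclicB).map hw).trans (id_comp _).symm)
  · refine ((_ ≫= CategoryTheory.Functor.map_id _ _).trans (comp_id _)).trans ?_
    exact (e.hom_inv_id_assoc _).symm

variable [S.IsFrobenius]

/-- `J` is a truncated injective coresolution: hulls in degrees `0, …, m - 1` followed by the `m`-th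
cosyzygy, built as an iterated cocone in `K^b`. A morphism `N ⟶ J` is killed degree by degree, so
vanishing against injectives and, at the end, against one arbitrary object suffices. -/
lemma exists_coresolution (m : ℕ) (B : E) : ∃ (J : Kb E) (t : (singleKb E).obj B ⟶ J),
    IsIso ((verdierQ S.acyclicB).map t) ∧ ∀ N : Kb E,
      (∀ I : E, S.ProjInj I → ∀ k : ℤ, 0 ≤ k → Orth (N⟦k⟧) ((singleKb E).obj I)) →
      (∀ X : E, Orth (N⟦(m : ℤ)⟧) ((singleKb E).obj X)) → Orth N J := by
  induction m generalizing B with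
  | zero =>
    refine ⟨_, 𝟙 _, inferInstance, fun N _ h => ?_⟩
    exact (h B).of_iso ((shiftFunctorZero (Kb E) ℤ).app N) (Iso.refl _)
  | succ m ih =>
    obtain ⟨M, i, k, w, hT, hw, hw'⟩ := HasDerivedTriangles.exists_cone (S.conf_hull B)
    obtain ⟨J', t', ht', hJ'⟩ := ih (S.cosyzygy B)
    have := acyclicB.isIso hw'
    obtain ⟨J, a, κ, hT'⟩ := distinguished_cocone_triangle₁ (i ≫ w ≫ t')
    obtain ⟨t, ht₁, ht₂⟩ := complete_distinguished_triangle_morphism₁ _ _ hT hT' (𝟙 _) (w ≫ t')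
      (id_comp _).symm
    -- That `t` is invertible in `D^b` is the five lemma for the two triangles. For the vanishing,
    -- `f` dies in the hull, so its shift factors through `J'`, to which the induction hypothesis
    -- for `N⟦1⟧` applies.
    refine ⟨J, t, ?_, fun N h₁ h₂ f => ?_⟩
    · have h₃ : IsIso ((verdierQ S.acyclicB).map (w ≫ t')) := by
        rw [Functor.map_comp]
        infer_instance
      have h₂ : IsIso ((verdierQ S.acyclicB).map (𝟙 ((singleKb E).obj (S.hull B)))) :=
        inferInstance
      let φ : Triangle.mk ((singleKb E).map (S.toHull B)) i k ⟶ Triangle.mk a (i ≫ w ≫ t') κ :=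
        { hom₁ := t
          hom₂ := 𝟙 _
          hom₃ := w ≫ t'
          comm₁ := ht₁
          comm₂ := (id_comp _).symm
          comm₃ := ht₂ }
      exact isIso₁_of_isIso₂₃ ((verdierQ S.acyclicB).mapTriangle.map φ)
        ((verdierQ S.acyclicB).map_distinguished _ hT)
        ((verdierQ S.acyclicB).map_distinguished _ hT') h₂ h₃
    · have hN : Orth (N⟦(1 : ℤ)⟧) J' := hJ' _
        (fun I hI k hk => (h₁ I hI (1 + k) (by omega)).of_iso
          ((shiftFunctorAdd (Kb E) (1 : ℤ) k).app N) (Iso.refl _))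
        (fun X => (h₂ X).of_iso
          ((shiftFunctorAdd' (Kb E) (1 : ℤ) m _ (by push_cast; omega)).app N) (Iso.refl _))
      have hf : f ≫ a = 0 := ((h₁ _ (S.projInj_hull B) 0 le_rfl).of_iso
        ((shiftFunctorZero (Kb E) ℤ).app N) (Iso.refl _)) _
      obtain ⟨r, hr⟩ := dist_coyoneda₁ hT' (f⟦(1 : ℤ)⟧') (by
        rw [← Functor.map_comp, hf, Functor.map_zero])
      apply (shiftFunctor (Kb E) (1 : ℤ)).map_injective
      rw [← hr, hN r, zero_comp, Functor.map_zero]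

/-- Negative extension groups vanish. -/
lemma orth_singleDb_shift (A B : E) (j : ℤ) (hj : 0 < j) :
    Orth ((S.singleDb.obj A)⟦j⟧) (S.singleDb.obj B) := by
  suffices h : ∀ f : (verdierQ S.acyclicB).obj (((singleKb E).obj A)⟦j⟧) ⟶
      (verdierQ S.acyclicB).obj ((singleKb E).obj B), f = 0 from
    Orth.of_iso h (((verdierQ S.acyclicB).commShiftIso j).app _) (Iso.refl _)
  intro f
  -- The roof starts at an arbitrary bounded complex `φ.X'`. It has no morphisms to objects after a
  -- large shift. Its morphisms to injectives extend along the denominator to the shifted object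
  -- `A`, and vanish there for degree reasons since `j + k > 0`.
  obtain ⟨φ, rfl⟩ := Localization.exists_rightFraction (verdierQ S.acyclicB) S.acyclicB.trW f
  obtain ⟨m, hm⟩ := exists_orth_shift φ.X'
  obtain ⟨J, t, ht, hJ⟩ := exists_coresolution (S := S) m B
  have hN : Orth φ.X' J := hJ _ (fun I hI k hk g => by
    have hs : S.acyclicB.trW (φ.s⟦k⟧') := ObjectProperty.trW.shift φ.hs k
    have hl := rightOrthogonal_singleKb hI.2
    rw [← ObjectProperty.isLocal_trW] at hl
    obtain ⟨g', rfl⟩ := (hl _ hs).2 g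
    have : g' = 0 := ((orth_singleKb_shift A I (j + k) (by omega)).of_iso
      ((shiftFunctorAdd (Kb E) j k).app _) (Iso.refl _)) g'
    rw [this]
    exact comp_zero) (hm m le_rfl)
  have := acyclicB.isIso φ.hs
  have h₀ : (verdierQ S.acyclicB).map φ.f = 0 := by
    rw [← cancel_mono ((verdierQ S.acyclicB).map t), ← Functor.map_comp, hN (φ.f ≫ t), Functor.map_zero,
      zero_comp]
  rw [← cancel_epi ((verdierQ S.acyclicB).map φ.s), MorphismProperty.RightFraction.map_s_comp_map,
    h₀, comp_zero]

variable (S) in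
/-- The connecting morphisms in the derived category. -/
noncomputable def connectingDb : S.Connecting S.singleDb where
  δ h := h.exists_dist.choose
  dist h := h.exists_dist.choose_spec
  naturality {X Y Z X' Y' Z' f g f' g'} h h' a b c h₁ h₂ := by
    obtain ⟨c', hc₁, hc₂⟩ : ∃ c' : S.singleDb.obj Z ⟶ S.singleDb.obj Z',
        S.singleDb.map g ≫ c' = S.singleDb.map b ≫ S.singleDb.map g' ∧
        h.exists_dist.choose ≫ (S.singleDb.map a)⟦(1 : ℤ)⟧' = c' ≫ h'.exists_dist.choose :=
      complete_distinguished_triangle_morphism _ _ h.exists_dist.choose_spec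
        h'.exists_dist.choose_spec (S.singleDb.map a) (S.singleDb.map b)
        ((S.singleDb.map_comp _ _).symm.trans ((congrArg S.singleDb.map h₁).trans
          (S.singleDb.map_comp _ _)))
    -- The filler `c'` need not be the given `c`. Their difference factors through a morphism from
    -- `X⟦1⟧` to an object in degree zero, which vanishes, so `c' = c` and the chosen connecting
    -- morphisms are natural.
    obtain ⟨r, hr⟩ := dist_yoneda₃ h.exists_dist.choose_spec (c' - S.singleDb.map c) (by
      rw [comp_sub, ← Functor.map_comp, h₂, Functor.map_comp, hc₁, sub_self])
    rw [orth_singleDb_shift X Z' 1 one_pos r, comp_zero, eq_comm, sub_eq_zero] at hr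
    rw [← hr, hc₂]

end ExactStructure
end

section
variable {E : Type u} [Category.{v} E] [Preadditive E] [HasZeroObject E] [HasBinaryBiproducts E]
  {D : Type u'} [Category.{v'} D] [HasZeroObject D] [HasShift D ℤ]
  [Preadditive D] [∀ n : ℤ, (shiftFunctor D n).Additive] [Pretriangulated D]
  {D' : Type u''} [Category.{v''} D'] [HasZeroObject D'] [HasShift D' ℤ]
  [Preadditive D'] [∀ n : ℤ, (shiftFunctor D' n).Additive] [Pretriangulated D']

namespace ExactStructure
variable {S : ExactStructure E}

/-- Connecting morphisms may be composed with a triangulated functor. -/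
noncomputable def Connecting.comp {F : E ⥤ D} (d : S.Connecting F) (G : D ⥤ D') [G.CommShift ℤ]
    [G.IsTriangulated] : S.Connecting (F ⋙ G) where
  δ h := G.map (d.δ h) ≫ (G.commShiftIso (1 : ℤ)).hom.app _
  dist h := dist_map (d.dist h) G
  naturality {X Y Z X' Y' Z' f g f' g'} h h' a b c h₁ h₂ := by
    have h₃ := (G.commShiftIso (1 : ℤ)).hom.naturality (F.map a)
    have h₄ := congrArg G.map (d.naturality h h' a b c h₁ h₂)
    rw [G.map_comp, G.map_comp] at h₄
    refine (assoc _ _ _).trans ((_ ≫= h₃.symm).trans ((assoc _ _ _).symm.trans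
      ((h₄ =≫ _).trans (assoc _ _ _))))

variable (S) [S.HasDerivedTriangles] [S.IsFrobenius]

/-- The connecting morphisms in the singularity category. -/
noncomputable def connectingDsing : S.Connecting (singleKb E ⋙ S.toDsing) :=
  S.connectingDb.comp (verdierQ S.perfect)

theorem isTriangulatedFunctor_stabToDsing : IsTriangulatedFunctor S.stabToDsing :=
  S.connectingDsing.isTriangulatedFunctor _

end ExactStructure
end
end MatFac
namespace MatFac

/-! ### The stable category as a quotient of the bounded derived category -/

section
variable {T : Type u} [Category.{v} T] [HasZeroObject T] [HasShift T ℤ] [Preadditive T]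
  [∀ n : ℤ, (shiftFunctor T n).Additive] [Pretriangulated T]
  {T' : Type u'} [Category.{v'} T'] [HasZeroObject T'] [HasShift T' ℤ] [Preadditive T']
  [∀ n : ℤ, (shiftFunctor T' n).Additive] [Pretriangulated T']

lemma dist_shift {X Y Z : T} {f : X ⟶ Y} {g : Y ⟶ Z} {h : Z ⟶ X⟦(1 : ℤ)⟧}
    (hT : Triangle.mk f g h ∈ distTriang T) :
    Triangle.mk (f⟦(1 : ℤ)⟧') (g⟦(1 : ℤ)⟧') (-h⟦(1 : ℤ)⟧') ∈ distTriang T :=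
  dist_of_iso (dist_rotate (dist_rotate (dist_rotate hT))) (Iso.refl _)
    ⟨-𝟙 _, -𝟙 _, by simp, by simp⟩ (Iso.refl _) (by simp) (by simp) (by simp)

lemma map_eq_of_map_shift_eq (F : T ⥤ T') [F.CommShift ℤ] {X Y : T} {f g : X ⟶ Y}
    (h : F.map (f⟦(1 : ℤ)⟧') = F.map (g⟦(1 : ℤ)⟧')) : F.map f = F.map g := by
  apply (shiftFunctor T' (1 : ℤ)).map_injective
  have h₁ := (F.commShiftIso (1 : ℤ)).hom.naturality f
  have h₂ := (F.commShiftIso (1 : ℤ)).hom.naturality g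
  dsimp at h₁ h₂
  rw [← cancel_epi ((F.commShiftIso (1 : ℤ)).hom.app X), ← h₁, ← h₂, h]

/-- The objects whose shifts of degree at least `m` satisfy `R`. -/
def shiftsFrom (R : ObjectProperty T) (m : ℤ) : ObjectProperty T :=
  fun Z => ∀ k : ℤ, m ≤ k → R (Z⟦k⟧)

variable (R : ObjectProperty T) [R.IsTriangulatedClosed₂] [R.IsStableUnderRetracts]

instance (m : ℤ) : (shiftsFrom R m).IsClosedUnderIsomorphisms :=
  ⟨fun e h k hk => R.prop_of_iso ((shiftFunctor T k).mapIso e) (h k hk)⟩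

instance (m : ℤ) : (shiftsFrom R m).IsTriangulatedClosed₂ :=
  .mk' fun D hD h₁ h₃ k hk =>
    R.ext_of_isTriangulatedClosed₂ _ (Triangle.shift_distinguished D hD k) (h₁ k hk) (h₃ k hk)

/-- The objects whose shifts of large degree satisfy `R`. -/
def shiftsEventually : ObjectProperty T := fun Z => ∃ m : ℤ, shiftsFrom R m Z

instance : (shiftsEventually R).IsStableUnderRetracts where
  of_retract r := fun ⟨m, h⟩ =>
    ⟨m, fun k hk => R.prop_of_retract (r.map (shiftFunctor T k)) (h k hk)⟩

instance : (shiftsEventually R).IsTriangulatedClosed₂ :=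
  .mk' fun D hD ⟨m₁, h₁⟩ ⟨m₃, h₃⟩ => ⟨max m₁ m₃,
    (shiftsFrom R (max m₁ m₃)).ext_of_isTriangulatedClosed₂ D hD
      (fun k hk => h₁ k ((le_max_left _ _).trans hk))
      (fun k hk => h₃ k ((le_max_right _ _).trans hk))⟩

instance : (shiftsEventually R).IsStableUnderShift ℤ where
  isStableUnderShiftBy n := ⟨fun Z ⟨m, h⟩ => ⟨m - n, fun k hk =>
    R.prop_of_iso ((shiftFunctorAdd T n k).app Z) (h (n + k) (by omega))⟩⟩

instance [R.ContainsZero] : (shiftsEventually R).IsTriangulated where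
  exists_zero := ⟨0, isZero_zero T, 0, fun k _ =>
    R.prop_of_isZero ((shiftFunctor T k).map_isZero (isZero_zero T))⟩

end

section
variable {E : Type u} [Category.{v} E] [Preadditive E] [HasZeroObject E] [HasBinaryBiproducts E]

namespace ExactStructure
variable (S : ExactStructure E) [S.HasDerivedTriangles]

/-- Under either orthogonality the morphisms in `D^b` are those of `K^b`, where complexes
concentrated in different degrees have no chain maps between them. -/
lemma orth_singleDb_of_orth {X Y : E} {m : ℤ} (hm : m ≠ 0)
    (h : S.acyclicB.leftOrthogonal ((singleKb E).obj X) ∨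
      S.acyclicB.rightOrthogonal ((singleKb E).obj Y)) :
    Orth (S.singleDb.obj X) ((S.singleDb.obj Y)⟦m⟧) := by
  have h₀ : Orth ((singleKb E).obj X) (((singleKb E).obj Y)⟦m⟧) :=
    (orth_shift_right_iff m).2 (orth_singleKb_shift X Y (-m) (by omega))
  refine (h₀.map_bijective (verdierQ S.acyclicB) ?_).of_iso (Iso.refl _)
    (((verdierQ S.acyclicB).commShiftIso m).app _)
  rcases h with h | h
  · exact (h.map_bijective_of_isTriangulated _ _).2
  · exact ((S.acyclicB.rightOrthogonal.le_shift m _ h).map_bijective_of_isTriangulated _ _).2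

lemma orth_singleDb_of_isProjective {P : E} (hP : S.IsProjective P) (X : E) {m : ℤ} (hm : m ≠ 0) :
    Orth (S.singleDb.obj P) ((S.singleDb.obj X)⟦m⟧) :=
  S.orth_singleDb_of_orth hm (Or.inl (leftOrthogonal_singleKb hP))

lemma orth_singleDb_of_isInjective {I : E} (hI : S.IsInjective I) (X : E) {m : ℤ} (hm : m ≠ 0) :
    Orth (S.singleDb.obj X) ((S.singleDb.obj I)⟦m⟧) :=
  S.orth_singleDb_of_orth hm (Or.inr (rightOrthogonal_singleKb hI))

lemma singleDb_map_bijective {I : E} (hI : S.IsInjective I) (X : E) :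
    Function.Bijective (S.singleDb.map : (X ⟶ I) → _) :=
  ((rightOrthogonal_singleKb hI).map_bijective_of_isTriangulated (verdierQ S.acyclicB)
    ((singleKb E).obj X)).comp ⟨(singleKb E).map_injective, (singleKb E).map_surjective⟩

variable [S.IsFrobenius]

instance singleDb_faithful : S.singleDb.Faithful where
  map_injective {X Y} f g h := by
    have := (S.conf_hull Y).mono
    rw [← cancel_mono (S.toHull Y)]
    apply (S.singleDb_map_bijective (S.projInj_hull Y).2 X).1
    rw [Functor.map_comp, Functor.map_comp, h]

instance singleDb_full : S.singleDb.Full where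
  map_surjective {X Y} φ := by
    obtain ⟨a, ha⟩ := (S.singleDb_map_bijective (S.projInj_hull Y).2 X).2
      (φ ≫ S.singleDb.map (S.toHull Y))
    obtain ⟨b, hb⟩ := (S.conf_hull Y).lift a (S.singleDb.map_injective (by
      rw [Functor.map_comp, ha, assoc, ← Functor.map_comp, (S.conf_hull Y).zero]
      simp))
    refine ⟨b, ?_⟩
    have hT := (S.connectingDb).dist (S.conf_hull Y)
    -- `b` and `φ` agree after embedding in the hull, so the shift of their difference factors
    -- through a morphism `X⟦1⟧ ⟶ S.cosyzygy Y`; that is a negative extension and hence zero.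
    have h₀ : (S.singleDb.map b - φ) ≫ S.singleDb.map (S.toHull Y) = 0 := by
      rw [sub_comp, ← Functor.map_comp, hb, ha, sub_self]
    apply (shiftFunctor S.Db (1 : ℤ)).map_injective
    rw [← sub_eq_zero, ← Functor.map_sub]
    obtain ⟨r, hr⟩ := dist_coyoneda₁ hT ((S.singleDb.map b - φ)⟦(1 : ℤ)⟧') (by
      rw [← Functor.map_comp, h₀, Functor.map_zero])
    rw [← hr, orth_singleDb_shift X _ 1 one_pos r, zero_comp]

omit [S.IsFrobenius] in
/-- The objects `X` in degree zero. -/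
def singles : ObjectProperty S.Db := fun Y => ∃ X : E, Y = S.singleDb.obj X

/-- For a projective-injective object the vanishing starts at `k = 1`. Vanishing for all large `k`
is stable under shifts, extensions and retracts, so it spreads by dévissage to perfect complexes and
then to their thick closure. -/
lemma perfect_le : S.perfect.triangEnvelope ≤ shiftsEventually S.singles.rightOrthogonal := by
  rw [ObjectProperty.triangEnvelope_le_iff]
  rintro Y ⟨K, hK, ⟨e⟩⟩
  refine ObjectProperty.prop_of_iso _ e.symm ?_
  refine prop_of_singleKb ((shiftsEventually S.singles.rightOrthogonal).inverseImage
    (verdierQ S.acyclicB)) K (fun i => ⟨1, ?_⟩)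
  rintro k hk _ f ⟨X, rfl⟩
  exact S.orth_singleDb_of_isInjective (hK i).2 X (m := k) (by omega) f

lemma perfect_singleDb {P : E} (hP : S.ProjInj P) : S.perfect (S.singleDb.obj P) :=
  ⟨_, S.projInj_single hP, ⟨Iso.refl _⟩⟩

/-- The middle term becomes zero in the quotient. The shift of `X` is thereby identified with the
cosyzygy, which makes dimension shifting possible there. -/
lemma isIso_map_connectingDb {X I Y : E} {f : X ⟶ I} {g : I ⟶ Y} (h : S.Conf f g)
    (hI : S.ProjInj I) : IsIso ((verdierQ S.perfect).map (S.connectingDb.δ h)) := by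
  have := (dist_isZero₂_iff (dist_map (S.connectingDb.dist h) (verdierQ S.perfect))).1
    (isZero_verdierQ_obj _ (S.perfect_singleDb hI))
  exact IsIso.of_isIso_comp_right _
    (((verdierQ S.perfect).commShiftIso (1 : ℤ)).hom.app (S.singleDb.obj X))

/-- Fullness by dimension shifting. When `W` receives no morphism from `X`, the numerator `f`
factors through the denominator `s` already in `D^b`, and `singleDb` is full. Otherwise compose both
legs, shifted, with the connecting morphisms from the cosyzygies: this lowers the bound `m` on the
vanishing for the cone. -/
lemma exists_map_comp_eq (m : ℕ) (X Y : E) {Z W : S.Db} (f : S.singleDb.obj X ⟶ Z)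
    (s : S.singleDb.obj Y ⟶ Z) (g : Z ⟶ W) (k : W ⟶ (S.singleDb.obj Y)⟦(1 : ℤ)⟧)
    (hT : Triangle.mk s g k ∈ distTriang S.Db) (hW : S.perfect.triangEnvelope W)
    (hm : shiftsFrom S.singles.rightOrthogonal m W) :
    ∃ h : X ⟶ Y, (verdierQ S.perfect).map (S.singleDb.map h ≫ s) = (verdierQ S.perfect).map f := by
  induction m generalizing X Y Z W with
  | zero =>
    have h₀ : Orth (S.singleDb.obj X) W :=
      Orth.of_iso (fun l => hm 0 le_rfl l ⟨X, rfl⟩) (Iso.refl _) ((shiftFunctorZero _ ℤ).app W)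
    obtain ⟨r, hr⟩ := dist_coyoneda₂ hT f (h₀ _)
    obtain ⟨h, rfl⟩ := S.singleDb.map_surjective r
    exact ⟨h, by rw [hr]⟩
  | succ m ih =>
    let δX := S.connectingDb.δ (S.conf_hull X)
    let δY := S.connectingDb.δ (S.conf_hull Y)
    have hδ := dist_rotate (dist_rotate (S.connectingDb.dist (S.conf_hull Y)))
    have hs := dist_shift hT
    obtain ⟨W₁, g₁, k₁, hT₁⟩ := distinguished_cocone_triangle (δY ≫ s⟦(1 : ℤ)⟧')
    -- The octahedron presents the new cone `W₁` as an extension of `W⟦1⟧` by the shifted hull of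
    -- `Y`. The first has its vanishing range improved by one, the second has no positive
    -- extensions.
    let o := Triangulated.someOctahedron rfl hδ hs hT₁
    have hJ : S.perfect.triangEnvelope ((S.singleDb.obj (S.hull Y))⟦(1 : ℤ)⟧) :=
      S.perfect.triangEnvelope.le_shift (1 : ℤ) _
        (S.perfect.le_triangEnvelope _ (S.perfect_singleDb (S.projInj_hull Y)))
    obtain ⟨h₁, hh₁⟩ := ih (S.cosyzygy X) (S.cosyzygy Y) (δX ≫ f⟦(1 : ℤ)⟧') _ g₁ k₁ hT₁
      (S.perfect.triangEnvelope.ext_of_isTriangulatedClosed₂ _ o.mem hJ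
        (S.perfect.triangEnvelope.le_shift (1 : ℤ) _ hW))
      ((shiftsFrom S.singles.rightOrthogonal m).ext_of_isTriangulatedClosed₂ _ o.mem (by
        rintro k hk _ u ⟨A, rfl⟩
        exact ((S.orth_singleDb_of_isInjective (S.projInj_hull Y).2 A (m := 1 + k)
          (by omega)).of_iso (Iso.refl _) ((shiftFunctorAdd _ (1 : ℤ) k).app _)) u) (by
        intro k hk
        exact S.singles.rightOrthogonal.prop_of_iso ((shiftFunctorAdd _ (1 : ℤ) k).app _)
          (hm (1 + k) (by push_cast; omega))))
    -- The map of cosyzygies comes, stably, from a map `X ⟶ Y` because the suspension is full.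
    -- Stable equality is enough, since projective-injectives are zero in the quotient.
    obtain ⟨h', hh'⟩ := S.susp.map_surjective (X := S.toStab.obj X) (Y := S.toStab.obj Y)
      (S.toStab.map h₁)
    obtain ⟨h, rfl⟩ := S.toStab.map_surjective h'
    have e₁ : (verdierQ S.perfect).map (S.singleDb.map (S.mapCosyzygy h)) =
      (verdierQ S.perfect).map (S.singleDb.map h₁) := congrArg S.stabToDsing.map hh'
    have e₂ := S.connectingDb.naturality (S.conf_hull X) (S.conf_hull Y) h (S.mapHull h)
      (S.mapCosyzygy h) (S.toHull_mapHull h) (S.fromHull_mapCosyzygy h)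
    have := S.isIso_map_connectingDb (S.conf_hull X) (S.projInj_hull X)
    refine ⟨h, map_eq_of_map_shift_eq (verdierQ S.perfect) ?_⟩
    have e₃ : δX ≫ (S.singleDb.map h ≫ s)⟦(1 : ℤ)⟧' =
        S.singleDb.map (S.mapCosyzygy h) ≫ δY ≫ s⟦(1 : ℤ)⟧' := by
      rw [Functor.map_comp, reassoc_of% e₂]
    rw [← cancel_epi ((verdierQ S.perfect).map δX), ← Functor.map_comp, ← Functor.map_comp,
      ← hh₁, e₃, Functor.map_comp, Functor.map_comp _ (S.singleDb.map h₁), e₁]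

end ExactStructure
end
end MatFac
namespace MatFac

section
variable {E : Type u} [Category.{v} E] [Preadditive E] [HasZeroObject E] [HasBinaryBiproducts E]

namespace ExactStructure
variable (S : ExactStructure E) [S.HasDerivedTriangles] [S.IsFrobenius]

instance stabToDsing_full : S.stabToDsing.Full where
  map_surjective {X Y} φ := by
    obtain ⟨X, rfl⟩ := Stab.exists_rep X
    obtain ⟨Y, rfl⟩ := Stab.exists_rep Y
    obtain ⟨z, hz⟩ := Localization.exists_leftFraction (verdierQ S.perfect)
      S.perfect.triangEnvelope.trW
      (show (verdierQ S.perfect).obj (S.singleDb.obj X) ⟶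
        (verdierQ S.perfect).obj (S.singleDb.obj Y) from φ)
    obtain ⟨W, g, k, hT, hW⟩ := z.hs
    -- The bound is an integer; truncating it to a natural number only makes it larger, which is
    -- harmless.
    obtain ⟨m, hm⟩ := S.perfect_le W hW
    obtain ⟨h, hh⟩ := S.exists_map_comp_eq m.toNat X Y z.f z.s g k hT hW
      (fun k hk => hm k (m.self_le_toNat.trans hk))
    refine ⟨S.toStab.map h, ?_⟩
    have := (isIso_verdierQ_map_iff S.perfect z.s).2 z.hs
    have h₁ : (verdierQ S.perfect).map (S.singleDb.map h) = z.map _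
        (Localization.inverts _ _) := by
      rw [← cancel_mono ((verdierQ S.perfect).map z.s), ← Functor.map_comp, hh,
        MorphismProperty.LeftFraction.map_comp_map_s]
    exact h₁.trans hz.symm

/-- Downward dimension shifting: for `u : A ⟶ X⟦k⟧` the vanishing one step higher, applied to the
cosyzygy of `A`, makes `u` extend to the hull of `A`. That hull is projective and has no morphisms
to `X⟦k⟧` when `k ≠ 0`. -/
lemma shiftsFrom_one_singleDb (X : E) (m : ℕ)
    (hm : shiftsFrom S.singles.rightOrthogonal (m + 1 : ℤ) (S.singleDb.obj X)) :
    shiftsFrom S.singles.rightOrthogonal 1 (S.singleDb.obj X) := by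
  induction m with
  | zero => simpa using hm
  | succ m ih =>
    refine ih fun k hk => ?_
    rintro _ u ⟨A, rfl⟩
    have hT := dist_rotate (dist_rotate (S.connectingDb.dist (S.conf_hull A)))
    have h₀ : S.connectingDb.δ (S.conf_hull A) ≫ u⟦(1 : ℤ)⟧' = 0 :=
      (Orth.of_iso (fun l => hm (k + 1) (by push_cast; omega) l ⟨_, rfl⟩) (Iso.refl _)
        ((shiftFunctorAdd _ k (1 : ℤ)).app _)) _
    obtain ⟨r, hr⟩ := dist_yoneda₂ hT _ h₀
    apply (shiftFunctor S.Db (1 : ℤ)).map_injective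
    rw [← hr, ((S.orth_singleDb_of_isProjective (S.projInj_hull A).1 X (m := k)
      (by omega)).shift 1) r, comp_zero, Functor.map_zero]

/-- An object killed by the quotient lies in the thick closure of the perfect complexes, so `Hom(A,
X[k]) = 0` for large `k` and then for all `k ≥ 1`. In particular the sequence of its hull splits,
and `X` is a summand of a projective-injective object. -/
lemma isZero_of_isZero_stabToDsing_obj (X : S.Stab) (h : IsZero (S.stabToDsing.obj X)) :
    IsZero X := by
  obtain ⟨X, rfl⟩ := Stab.exists_rep X
  obtain ⟨m, hm⟩ := S.perfect_le _
    ((isZero_verdierQ_obj_iff S.perfect (S.singleDb.obj X)).1 h)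
  have h₁ := S.shiftsFrom_one_singleDb X m.toNat (fun k hk => hm k (by
    have := m.self_le_toNat
    omega))
  have hδ : S.connectingDb.δ (S.conf_hull X) = 0 := h₁ 1 le_rfl _ ⟨_, rfl⟩
  obtain ⟨r, hr⟩ := dist_yoneda₂
    (dist_rotate (dist_rotate (S.connectingDb.dist (S.conf_hull X)))) (𝟙 _)
      ((hδ =≫ _).trans zero_comp)
  obtain ⟨r, rfl⟩ := (shiftFunctor S.Db (1 : ℤ)).map_surjective r
  obtain ⟨r, rfl⟩ := S.singleDb.map_surjective r
  -- The sign is the one introduced by rotating the triangle.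
  have h₂ : S.toHull X ≫ (-r) = 𝟙 X := by
    apply S.singleDb.map_injective
    apply (shiftFunctor S.Db (1 : ℤ)).map_injective
    rw [CategoryTheory.Functor.map_id, CategoryTheory.Functor.map_id, ← hr]
    simp
  have h₃ : IsZero (S.toStab.obj (S.hull X)) := S.isZero_toStab_obj (S.projInj_hull X)
  rw [IsZero.iff_id_eq_zero, ← CategoryTheory.Functor.map_id, ← h₂, Functor.map_comp,
    h₃.eq_zero_of_tgt (S.toStab.map (S.toHull X)), zero_comp]

instance stabToDsing_faithful : S.stabToDsing.Faithful :=
  S.isTriangulatedFunctor_stabToDsing.faithful S.isZero_of_isZero_stabToDsing_obj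

lemma isTriangulatedFunctor_toDsing : IsTriangulatedFunctor S.toDsing :=
  (isTriangulatedFunctor_verdierQ _).comp (isTriangulatedFunctor_verdierQ _)

instance : S.toDsing.EssSurj := by
  unfold toDsing
  infer_instance

/-- The essential image is a triangulated subcategory, because the functor is full and triangulated,
and it contains every object in degree zero; dévissage does the rest. -/
instance stabToDsing_essSurj : S.stabToDsing.EssSurj where
  mem_essImage D := by
    have := S.isTriangulatedFunctor_stabToDsing.isTriangulated_essImage
    have := S.isTriangulatedFunctor_toDsing.isTriangulated_inverseImage S.stabToDsing.essImage
    exact S.stabToDsing.essImage.prop_of_iso (S.toDsing.objObjPreimageIso D)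
      (prop_of_singleKb (S.stabToDsing.essImage.inverseImage S.toDsing)
        (S.toDsing.objPreimage D) fun i => ⟨S.toStab.obj _, ⟨Iso.refl _⟩⟩)

theorem isEquivalence_stabToDsing : S.stabToDsing.IsEquivalence where

end ExactStructure
end
end MatFac
namespace MatFac

/-! ### Functors between stable categories of factorizations -/

section
variable {E : Type u} [Category.{v} E] [Preadditive E] [HasZeroObject E] [HasBinaryBiproducts E]
  {E' : Type u'} [Category.{v'} E'] [Preadditive E'] [HasZeroObject E'] [HasBinaryBiproducts E']
  {D : Type u''} [Category.{v''} D] [HasZeroObject D] [HasShift D ℤ]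
  [Preadditive D] [∀ n : ℤ, (shiftFunctor D n).Additive] [Pretriangulated D]

namespace ExactStructure

/-- Connecting morphisms may be composed with an exact functor. -/
def Connecting.precomp {S : ExactStructure E} {S' : ExactStructure E'} {F : E' ⥤ D}
    (d : S'.Connecting F) (G : E ⥤ E')
    (hG : ∀ {X Y Z : E} {f : X ⟶ Y} {g : Y ⟶ Z}, S.Conf f g → S'.Conf (G.map f) (G.map g)) :
    S.Connecting (G ⋙ F) where
  δ h := d.δ (hG h)
  dist h := d.dist (hG h)
  naturality h h' a b c h₁ h₂ := d.naturality (hG h) (hG h') (G.map a) (G.map b) (G.map c)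
    ((G.map_comp _ _).symm.trans ((congrArg G.map h₁).trans (G.map_comp _ _)))
    ((G.map_comp _ _).symm.trans ((congrArg G.map h₂).trans (G.map_comp _ _)))

variable (S : ExactStructure E) [S.IsFrobenius]

lemma Conf.exists_toCosyzygy {S : ExactStructure E} [S.IsFrobenius] {X Y Z : E} {f : X ⟶ Y}
    {g : Y ⟶ Z} (h : S.Conf f g) : ∃ z : Z ⟶ S.cosyzygy X, ∃ y : Y ⟶ S.hull X,
      f ≫ y = S.toHull X ∧ g ≫ z = y ≫ S.fromHull X := by
  obtain ⟨y, z, h₁, h₂⟩ := h.exists_map (S.conf_hull X).zero (S.projInj_hull X).2 (𝟙 X)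
  exact ⟨z, y, by simpa using h₁, h₂⟩

/-- The connecting morphisms in the stable category. -/
noncomputable def connectingStab : S.Connecting S.toStab where
  δ h := -S.toSusp h.exists_toCosyzygy.choose ≫ S.shiftIso.inv.app _
  dist h := by
    obtain ⟨y, h₁, h₂⟩ := h.exists_toCosyzygy.choose_spec
    have := (mk_mem_distTriang_iff _ _ _).2 (h.stdDist h₁ h₂)
    rwa [neg_comp] at this
  naturality {X Y Z X' Y' Z' f g f' g'} h h' a b c h₁ h₂ := by
    obtain ⟨y, hy₁, hy₂⟩ := h.exists_toCosyzygy.choose_spec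
    obtain ⟨y', hy'₁, hy'₂⟩ := h'.exists_toCosyzygy.choose_spec
    have e := S.shiftIso.inv.naturality (S.toStab.map a)
    rw [comp_neg, neg_comp, assoc, ← e, ← assoc, toSusp_susp, ← assoc, map_toSusp]
    congr 2
    have := h.epi
    obtain ⟨s, hs⟩ := h.desc (y ≫ S.mapHull a - b ≫ y') (by
      rw [comp_sub, reassoc_of% hy₁, reassoc_of% h₁, toHull_mapHull, hy'₁, sub_self])
    refine toSusp_eq (S.projInj_hull X') s (S.fromHull X') ?_
    rw [← cancel_epi g, ← assoc g s, hs, comp_sub, ← assoc g c, h₂, assoc, hy'₂, ← assoc, hy₂,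
      assoc, fromHull_mapCosyzygy, sub_comp, assoc, assoc]

end ExactStructure
end

section
variable {C : Type u} [Category.{v} C] {D : Type u'} [Category.{v'} D] {n : ℕ}
  {W : 𝟭 C ⟶ 𝟭 C} {V : 𝟭 D ⟶ 𝟭 D}

namespace MF

section
variable (F : C ⥤ D) (hF : ∀ X, F.map (W.app X) = V.app (F.obj X))

instance [F.Faithful] : (mapMF (n := n) F hF).Faithful where
  map_injective h := hom_ext (fun i => F.map_injective (congr_f h i))

instance [F.Full] [F.Faithful] : (mapMF (n := n) F hF).Full where
  map_surjective {M N} f := by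
    let φ : ∀ i, F.obj (M.X i) ⟶ F.obj (N.X i) := f.f
    refine ⟨⟨fun i => F.preimage (φ i), fun i => F.map_injective ?_⟩,
      hom_ext (fun i => F.map_preimage _)⟩
    rw [F.map_comp, F.map_comp, F.map_preimage, F.map_preimage]
    exact f.comm i
end

variable [Preadditive C] [Preadditive D] (F : C ⥤ D) [F.Additive]
  (hF : ∀ X, F.map (W.app X) = V.app (F.obj X))
  [HasFiniteBiproducts C] [HasFiniteBiproducts D] [NeZero n]
  [HasZeroObject C] [HasZeroObject D] [HasBinaryBiproducts C] [HasBinaryBiproducts D]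

omit [HasFiniteBiproducts C] [HasFiniteBiproducts D] [NeZero n] in
lemma gradedExact_conf_iff {X Y Z : MF n W} {f : X ⟶ Y} {g : Y ⟶ Z} :
    (gradedExact n W).Conf f g ↔ Nonempty (SplitData f.f g.f) :=
  ⟨fun h => splitData_of_gradedSplit h.2,
    fun ⟨σ⟩ => ⟨hom_ext σ.fg, gradedSplit_mk (hom_ext σ.fg) σ⟩⟩

omit [HasFiniteBiproducts C] [HasFiniteBiproducts D] [NeZero n] in
lemma conf_mapMF {X Y Z : MF n W} {f : X ⟶ Y} {g : Y ⟶ Z} (h : (gradedExact n W).Conf f g) :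
    (gradedExact n V).Conf ((mapMF F hF).map f) ((mapMF F hF).map g) := by
  obtain ⟨σ⟩ := gradedExact_conf_iff.1 h
  exact gradedExact_conf_iff.2 ⟨⟨fun i => F.map (σ.r i), fun i => F.map (σ.s i),
    fun i => (F.map_comp _ _).symm.trans ((congrArg F.map (σ.fr i)).trans (F.map_id _)),
    fun i => (F.map_comp _ _).symm.trans ((congrArg F.map (σ.sg i)).trans (F.map_id _)),
    fun i => (congrArg₂ (· + ·) (F.map_comp _ _).symm (F.map_comp _ _).symm).trans
      (F.map_add.symm.trans ((congrArg F.map (σ.tot i)).trans (F.map_id _)))⟩⟩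

variable [IsIdempotentComplete C] [IsIdempotentComplete D]

theorem isTriangulatedFunctor_stabMap : IsTriangulatedFunctor (stabMap (n := n) F hF) :=
  ((gradedExact n V).connectingStab.precomp (mapMF F hF)
    (conf_mapMF F hF)).isTriangulatedFunctor _

instance stabMap_full [F.Full] [F.Faithful] : (stabMap (n := n) F hF).Full where
  map_surjective {M N} φ := by
    obtain ⟨M, rfl⟩ := ExactStructure.Stab.exists_rep M
    obtain ⟨N, rfl⟩ := ExactStructure.Stab.exists_rep N
    obtain ⟨f, hf⟩ := (gradedExact n V).toStab.map_surjective
      (X := (mapMF F hF).obj M) (Y := (mapMF F hF).obj N) φ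
    obtain ⟨f, rfl⟩ := (mapMF F hF).map_surjective f
    exact ⟨(gradedExact n W).toStab.map f, hf⟩

instance stabMap_faithful [F.Full] [F.Faithful] : (stabMap (n := n) F hF).Faithful where
  map_injective {M N} φ ψ h := by
    obtain ⟨M, rfl⟩ := ExactStructure.Stab.exists_rep M
    obtain ⟨N, rfl⟩ := ExactStructure.Stab.exists_rep N
    obtain ⟨f, rfl⟩ := (gradedExact n W).toStab.map_surjective φ
    obtain ⟨g, rfl⟩ := (gradedExact n W).toStab.map_surjective ψ
    have h' : (gradedExact n V).toStab.map ((mapMF F hF).map f) =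
      (gradedExact n V).toStab.map ((mapMF F hF).map g) := h
    obtain ⟨P, s, t, hP, hst⟩ := (ExactStructure.toStab_map_eq_iff _ _ _).1 h'
    -- The projective-injective object through which the difference factors need not come from `C`.
    -- Injectivity lets it be replaced by the image of the trivial factorization on the components
    -- of `M`, and fullness then lifts the second map.
    obtain ⟨Q, q, w, hq⟩ := inflation_toTriv M
    obtain ⟨s', rfl⟩ := hP.2 _ (conf_mapMF F hF ⟨w, hq⟩).inflation s
    obtain ⟨u, hu⟩ := (mapMF F hF).map_surjective (s' ≫ t)
    refine (ExactStructure.toStab_map_eq_iff _ _ _).2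
      ⟨_, toTriv (Y := M.X) M (fun i => 𝟙 _), u,
        ⟨isProjective_triv _, isInjective_triv _⟩, (mapMF F hF).map_injective ?_⟩
    rw [Functor.map_sub, hst, Functor.map_comp, hu, assoc]

end MF
end

section
variable {C : Type u} [Category.{v} C] [Abelian C] (n : ℕ) [NeZero n] (W : 𝟭 C ⟶ 𝟭 C)

namespace MF

instance : (isProjective C).ι.Additive where

theorem isTriangulatedFunctor_stabIncl : IsTriangulatedFunctor (stabIncl n W) :=
  isTriangulatedFunctor_stabMap _ _

instance : (stabIncl n W).Full :=
  stabMap_full (W := restrictProj W) (V := W) (isProjective C).ι (fun _ => rfl)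

instance : (stabIncl n W).Faithful :=
  stabMap_faithful (W := restrictProj W) (V := W) (isProjective C).ι (fun _ => rfl)

end MF
end
end MatFac
namespace MatFac

/-! ### The abelian category of factorizations -/

section
variable {C : Type u} [Category.{v} C] {n : ℕ} {W : 𝟭 C ⟶ 𝟭 C}

namespace MF

lemma isIso_of_f {M N : MF n W} (f : M ⟶ N) (h : ∀ i, IsIso (f.f i)) : IsIso f :=
  ⟨(isoMk (fun i => asIso (f.f i)) f.comm).inv, (isoMk (fun i => asIso (f.f i)) f.comm).hom_inv_id,
    (isoMk (fun i => asIso (f.f i)) f.comm).inv_hom_id⟩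

variable [Abelian C] {M N : MF n W} (f : M ⟶ N)

/-- The componentwise kernel of a morphism. -/
noncomputable def ker : MF n W where
  X i := kernel (f.f i)
  d i := kernel.map (f.f i) (f.f (i + 1)) (M.d i) (N.d i) (f.comm i)
  dpow_eq i := by
    rw [← cancel_mono (kernel.ι (f.f i))]
    exact M.dpow_eq_comp (fun i => kernel.ι (f.f i)) (fun i => by simp) i

/-- The inclusion of the componentwise kernel. -/
noncomputable def kerι : ker f ⟶ M := ⟨fun i => kernel.ι (f.f i), fun i => by simp [ker]⟩

lemma kerι_comp : kerι f ≫ f = 0 := hom_ext (fun i => kernel.condition (f.f i))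

/-- The componentwise cokernel of a morphism. -/
noncomputable def coker : MF n W where
  X i := cokernel (f.f i)
  d i := cokernel.map (f.f i) (f.f (i + 1)) (M.d i) (N.d i) (f.comm i)
  dpow_eq i := by
    rw [← cancel_epi (cokernel.π (f.f i))]
    exact N.comp_dpow_eq (fun i => cokernel.π (f.f i)) (fun i => by simp) i

/-- The projection to the componentwise cokernel. -/
noncomputable def cokerπ : N ⟶ coker f := ⟨fun i => cokernel.π (f.f i), fun i => by simp [coker]⟩

lemma comp_cokerπ : f ≫ cokerπ f = 0 := hom_ext (fun i => cokernel.condition (f.f i))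

/-- The componentwise kernel is a kernel. -/
noncomputable def isLimitKer : IsLimit (KernelFork.ofι (kerι f) (kerι_comp f)) :=
  have : Mono (kerι f) := mono_of_f _ (fun i => inferInstanceAs (Mono (kernel.ι (f.f i))))
  KernelFork.IsLimit.ofι' _ _ (fun {A} k hk =>
    ⟨⟨fun i => kernel.lift (f.f i) (k.f i) (congr_f hk i), fun i => by
      have h : kernel.lift (f.f i) (k.f i) (congr_f hk i) ≫
          kernel.map (f.f i) (f.f (i + 1)) (M.d i) (N.d i) (f.comm i) =
          A.d i ≫ kernel.lift (f.f (i + 1)) (k.f (i + 1)) (congr_f hk (i + 1)) := by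
        rw [← cancel_mono (kernel.ι (f.f (i + 1)))]
        simp [k.comm]
      exact h⟩,
      hom_ext (fun i => kernel.lift_ι (f.f i) (k.f i) (congr_f hk i))⟩)

/-- The componentwise cokernel is a cokernel. -/
noncomputable def isColimitCoker : IsColimit (CokernelCofork.ofπ (cokerπ f) (comp_cokerπ f)) :=
  have : Epi (cokerπ f) := epi_of_f _ (fun i => inferInstanceAs (Epi (cokernel.π (f.f i))))
  CokernelCofork.IsColimit.ofπ' _ _ (fun {A} k hk =>
    ⟨⟨fun i => cokernel.desc (f.f i) (k.f i) (congr_f hk i), fun i => by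
      have h : cokernel.desc (f.f i) (k.f i) (congr_f hk i) ≫ A.d i =
          cokernel.map (f.f i) (f.f (i + 1)) (M.d i) (N.d i) (f.comm i) ≫
            cokernel.desc (f.f (i + 1)) (k.f (i + 1)) (congr_f hk (i + 1)) := by
        rw [← cancel_epi (cokernel.π (f.f i))]
        simp [k.comm]
      exact h⟩,
      hom_ext (fun i => cokernel.π_desc (f.f i) (k.f i) (congr_f hk i))⟩)

instance : HasKernels (MF n W) := ⟨fun f => ⟨_, isLimitKer f⟩⟩
instance : HasCokernels (MF n W) := ⟨fun f => ⟨_, isColimitCoker f⟩⟩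

instance (i : ZMod n) : PreservesLimit (parallelPair f 0) (eval W i) :=
  preservesLimit_of_preserves_limit_cone (isLimitKer f)
    ((KernelFork.isLimitMapConeEquiv _ (eval W i)).symm (kernelIsKernel (f.f i)))

instance (i : ZMod n) : PreservesColimit (parallelPair f 0) (eval W i) :=
  preservesColimit_of_preserves_colimit_cocone (isColimitCoker f)
    ((CokernelCofork.isColimitMapCoconeEquiv _ (eval W i)).symm (cokernelIsCokernel (f.f i)))

/-- Kernels and cokernels are computed in components, so the components of the comparison are the
comparisons in `C`. -/
instance : IsIso (Abelian.coimageImageComparison f) := isIso_of_f _ (fun i => by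
  have e := Abelian.PreservesCoimageImageComparison.iso (eval W i) f
  exact ((MorphismProperty.isomorphisms C).arrow_iso_iff e).2
    (inferInstanceAs (IsIso (Abelian.coimageImageComparison ((eval W i).map f)))))

instance : HasFiniteProducts (MF n W) := hasFiniteProducts_of_has_binary_and_terminal

instance : IsNormalMonoCategory (MF n W) :=
  Abelian.OfCoimageImageComparisonIsIso.isNormalMonoCategory
instance : IsNormalEpiCategory (MF n W) :=
  Abelian.OfCoimageImageComparisonIsIso.isNormalEpiCategory

noncomputable instance : Abelian (MF n W) where

instance (i : ZMod n) : PreservesFiniteLimits (eval W i) :=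
  Functor.preservesFiniteLimits_of_preservesKernels _

instance (i : ZMod n) : PreservesFiniteColimits (eval W i) :=
  Functor.preservesFiniteColimits_of_preservesCokernels _

lemma mono_iff : Mono f ↔ ∀ i, Mono (f.f i) :=
  ⟨fun _ i => inferInstanceAs (Mono ((eval W i).map f)), mono_of_f f⟩

lemma epi_iff : Epi f ↔ ∀ i, Epi (f.f i) :=
  ⟨fun _ i => inferInstanceAs (Epi ((eval W i).map f)), epi_of_f f⟩

lemma isZero_iff {M : MF n W} : IsZero M ↔ ∀ i, IsZero (M.X i) :=
  ⟨fun h i => (eval W i).map_isZero h, fun h =>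
    (IsZero.iff_id_eq_zero _).2 (hom_ext (fun i => (h i).eq_of_src _ _))⟩

lemma exact_iff (S : ShortComplex (MF n W)) : S.Exact ↔ ∀ i, (S.map (eval W i)).Exact := by
  refine ⟨fun h i => h.map (eval W i), fun h => ?_⟩
  rw [ShortComplex.exact_iff_isZero_homology, isZero_iff]
  exact fun i => ((ShortComplex.exact_iff_isZero_homology _).1 (h i)).of_iso
    (S.mapHomologyIso (eval W i)).symm

lemma acyclicAb_iff (K : CochainComplex (MF n W) ℤ) : AcyclicAb K ↔ K.Acyclic :=
  ⟨fun h j => (exact_iff _).2 (fun i => h i j), fun h i j => (exact_iff _).1 (h j) i⟩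

lemma isProjectiveAb_iff (P : MF n W) : IsProjectiveAb P ↔ Projective P :=
  ⟨fun h => ⟨fun u g _ => h g ((epi_iff g).1 inferInstance) u⟩, fun _ _ _ g hg u =>
    have := epi_of_f g hg
    ⟨Projective.factorThru u g, Projective.factorThru_comp _ _⟩⟩

end MF
end
end MatFac
namespace MatFac

/-! ### Acyclicity as contractibility of components -/

section
variable {C : Type u} [Category.{v} C] [Preadditive C]

lemma nonempty_homotopy_id_zero_iff (L : CochainComplex C ℤ) :
    Nonempty (Homotopy (𝟙 L) 0) ↔ ∃ h : ∀ k, L.X (k + 1) ⟶ L.X k,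
      ∀ k, h k ≫ L.d k (k + 1) + L.d (k + 1) (k + 1 + 1) ≫ h (k + 1) = 𝟙 _ := by
  constructor
  · rintro ⟨H⟩
    refine ⟨fun k => H.hom (k + 1) k, fun k => ?_⟩
    have h₁ : (ComplexShape.up ℤ).Rel k (k + 1) := rfl
    have h₂ : (ComplexShape.up ℤ).Rel (k + 1) (k + 1 + 1) := rfl
    have := H.comm (k + 1)
    rw [dNext_eq _ h₂, prevD_eq _ h₁] at this
    simpa [add_comm] using this.symm
  · rintro ⟨h, hh⟩
    let H : ∀ i j, (ComplexShape.up ℤ).Rel j i → (L.X i ⟶ L.X j) := fun i j hij =>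
      eqToHom (congrArg L.X hij.symm) ≫ h j
    have : 𝟙 L = Homotopy.nullHomotopicMap' H := by
      ext i
      obtain ⟨k, rfl⟩ : ∃ k, i = k + 1 := ⟨i - 1, by omega⟩
      have h₁ : (ComplexShape.up ℤ).Rel k (k + 1) := rfl
      have h₂ : (ComplexShape.up ℤ).Rel (k + 1) (k + 1 + 1) := rfl
      rw [Homotopy.nullHomotopicMap'_f h₁ h₂]
      simpa [H, add_comm] using (hh k).symm
    rw [this]
    exact ⟨Homotopy.nullHomotopy' _⟩

/-- The projection onto the kernel `Z₀` is `𝟙 - d₀ ≫ s₀`, and the section on `Z₁` is the restriction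
of `s₀`. Only the homotopy identity at `X₁` enters. -/
lemma exists_splitting_of_contraction {X₀ X₁ X₂ Z₀ Z₁ : C} {d₀ : X₀ ⟶ X₁} {d₁ : X₁ ⟶ X₂}
    {ι₀ : Z₀ ⟶ X₀} {ι₁ : Z₁ ⟶ X₁} {p : X₀ ⟶ Z₁} (hd : d₀ ≫ d₁ = 0) (w₀ : ι₀ ≫ d₀ = 0)
    (h₀ : IsLimit (KernelFork.ofι ι₀ w₀)) [Mono ι₀] [Mono ι₁] (w₁ : ι₁ ≫ d₁ = 0)
    (hp : p ≫ ι₁ = d₀) (s₀ : X₁ ⟶ X₀) (s₁ : X₂ ⟶ X₁) (hs : s₀ ≫ d₀ + d₁ ≫ s₁ = 𝟙 X₁) :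
    ∃ (r : X₀ ⟶ Z₀) (s : Z₁ ⟶ X₀), ι₀ ≫ r = 𝟙 _ ∧ s ≫ p = 𝟙 _ ∧ r ≫ ι₀ + p ≫ s = 𝟙 _ := by
  have h₁ : s₀ ≫ d₀ = 𝟙 X₁ - d₁ ≫ s₁ := eq_sub_of_add_eq hs
  obtain ⟨r, hr⟩ := KernelFork.IsLimit.lift' h₀ (𝟙 _ - d₀ ≫ s₀) (by
    rw [sub_comp, assoc, h₁, comp_sub, reassoc_of% hd]
    simp)
  have hr : r ≫ ι₀ = 𝟙 _ - d₀ ≫ s₀ := hr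
  refine ⟨r, ι₁ ≫ s₀, ?_, ?_, ?_⟩
  · rw [← cancel_mono ι₀, assoc, hr, comp_sub, reassoc_of% w₀]
    simp
  · rw [← cancel_mono ι₁, assoc, assoc, hp, h₁, comp_sub, reassoc_of% w₁]
    simp
  · rw [hr, reassoc_of% hp]
    simp

end

section
variable {C : Type u} [Category.{v} C] [Abelian C] {n : ℕ} {W : 𝟭 C ⟶ 𝟭 C}

namespace MF

/-- Componentwise splittings of the sequences of cycles assemble to contracting homotopies.
Conversely the cycles formed in the abelian category of factorizations give the sequences, and the
contractions split them; neither the homotopies nor the splittings need to commute with the maps of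
the factorizations. -/
lemma acyclic_iff (K : CochainComplex (MF n W) ℤ) : (gradedExact n W).Acyclic K ↔
    ∀ i, Nonempty (Homotopy (𝟙 (((eval W i).mapHomologicalComplex (.up ℤ)).obj K)) 0) := by
  simp only [nonempty_homotopy_id_zero_iff]
  constructor
  · rintro ⟨Z, j, p, hc, hd⟩ i
    have σ : ∀ k, SplitData (j k).f (p k).f := fun k => (gradedExact_conf_iff.1 (hc k)).some
    refine ⟨fun k => (σ (k + 1)).r i ≫ (σ k).s i, fun k => ?_⟩
    have e : ∀ k, (K.d k (k + 1)).f i = (p k).f i ≫ (j (k + 1)).f i := fun k => congr_f (hd k) i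
    change ((σ (k + 1)).r i ≫ (σ k).s i) ≫ (K.d k (k + 1)).f i +
      (K.d (k + 1) (k + 1 + 1)).f i ≫ (σ (k + 1 + 1)).r i ≫ (σ (k + 1)).s i = 𝟙 _
    rw [e, e, assoc, reassoc_of% ((σ k).sg i), assoc, reassoc_of% ((σ (k + 1 + 1)).fr i),
      (σ (k + 1)).tot]
  · intro h
    choose s hs using h
    refine ⟨fun k => K.cycles k, fun k => K.iCycles k, fun k => K.toCycles k (k + 1), fun k => ?_,
      fun k => (K.toCycles_i _ _).symm⟩
    have hk : ∀ k, (ComplexShape.up ℤ).next k = k + 1 := fun k => CochainComplex.next ℤ k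
    have key : ∀ i, ∃ (r : (K.X k).X i ⟶ (K.cycles k).X i)
        (s : (K.cycles (k + 1)).X i ⟶ (K.X k).X i), (K.iCycles k).f i ≫ r = 𝟙 _ ∧
        s ≫ (K.toCycles k (k + 1)).f i = 𝟙 _ ∧
        r ≫ (K.iCycles k).f i + (K.toCycles k (k + 1)).f i ≫ s = 𝟙 _ := by
      intro i
      have m₀ := (mono_iff (K.iCycles k)).1 inferInstance i
      have m₁ := (mono_iff (K.iCycles (k + 1))).1 inferInstance i
      exact exists_splitting_of_contraction (d₀ := (K.d k (k + 1)).f i)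
        (congr_f (K.d_comp_d k (k + 1) (k + 1 + 1)) i)
        (congr_f (K.iCycles_d k (k + 1)) i)
        (KernelFork.mapIsLimit _ (K.cyclesIsKernel k (k + 1) (hk k)) (eval W i))
        (congr_f (K.iCycles_d (k + 1) (k + 1 + 1)) i) (congr_f (K.toCycles_i k (k + 1)) i)
        (s i k) (s i (k + 1)) (hs i k)
    choose r s h₁ h₂ h₃ using key
    exact gradedExact_conf_iff.2 ⟨⟨r, s, h₁, h₂, h₃⟩⟩

/-- The components of complexes, as triangulated functors of homotopy categories. -/
noncomputable abbrev evalK (W : 𝟭 C ⟶ 𝟭 C) (i : ZMod n) :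
    HomotopyCategory (MF n W) (.up ℤ) ⥤ HomotopyCategory C (.up ℤ) :=
  (eval W i).mapHomotopyCategory (.up ℤ)

lemma acyclic_iff_isZero (K : HomotopyCategory (MF n W) (.up ℤ)) :
    (gradedExact n W).Acyclic K.as ↔ ∀ i, IsZero ((evalK W i).obj K) := by
  rw [acyclic_iff]
  exact forall_congr' fun i => (HomotopyCategory.isZero_quotient_obj_iff _).symm

end MF
end

section
variable {T : Type u} [Category.{v} T] [HasZeroObject T] [HasShift T ℤ] [Preadditive T]
  [∀ n : ℤ, (shiftFunctor T n).Additive] [Pretriangulated T]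
  {T' : Type u'} [Category.{v'} T'] [HasZeroObject T'] [HasShift T' ℤ] [Preadditive T']
  [∀ n : ℤ, (shiftFunctor T' n).Additive] [Pretriangulated T']

/-- The objects that are annihilated by a family of functors. -/
def jointKernel {I : Type*} (F : I → T ⥤ T') : ObjectProperty T :=
  fun X => ∀ i, IsZero ((F i).obj X)

variable {I : Type*} (F : I → T ⥤ T')

instance [∀ i, (F i).PreservesZeroMorphisms] : (jointKernel F).IsStableUnderRetracts where
  of_retract r h i := by
    have := (r.map (F i)).retract
    rw [IsZero.iff_id_eq_zero, ← this, (h i).eq_zero_of_src (r.map (F i)).r, comp_zero]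

instance [∀ i, (F i).CommShift ℤ] [∀ i, (F i).IsTriangulated] :
    (jointKernel F).IsTriangulated where
  exists_zero := ⟨0, isZero_zero T, fun i => (F i).map_isZero (isZero_zero T)⟩
  isStableUnderShiftBy m := ⟨fun X h i =>
    ((shiftFunctor T' m).map_isZero (h i)).of_iso (((F i).commShiftIso m).app X)⟩
  toIsTriangulatedClosed₂ := .mk' fun D hD h₁ h₃ i => by
    have := dist_map (show Triangle.mk D.mor₁ D.mor₂ D.mor₃ ∈ _ from hD) (F i)
    have h : IsIso ((F i).map D.mor₁) := ⟨0, (h₁ i).eq_of_src _ _, by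
      obtain ⟨r, hr⟩ := dist_coyoneda₂ this (𝟙 _) ((h₃ i).eq_of_tgt _ _)
      rw [zero_comp, ← hr, (h₁ i).eq_of_src ((F i).map D.mor₁) 0, comp_zero]⟩
    exact (h₁ i).of_iso (@asIso _ _ _ _ _ h).symm

lemma jointKernel_trW_iff [∀ i, (F i).CommShift ℤ] [∀ i, (F i).IsTriangulated] {X Y : T}
    (f : X ⟶ Y) : (jointKernel F).trW f ↔ ∀ i, IsIso ((F i).map f) := by
  constructor
  · rintro ⟨Z, g, h, hT, hZ⟩ i
    exact (dist_isZero₃_iff (dist_map hT (F i))).1 (hZ i)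
  · intro hf
    obtain ⟨Z, g, h, hT⟩ := distinguished_cocone_triangle f
    exact ⟨Z, g, h, hT, fun i => (dist_isZero₃_iff (dist_map hT (F i))).2 (hf i)⟩

/-- As `f` has a retraction, `h` vanishes, so `i` is an epimorphism; the inverse of `w` is `s ≫ i`.
-/
lemma isIso_of_splitting {X Y Z M : T} {f : X ⟶ Y} {i : Y ⟶ M} {h : M ⟶ X⟦(1 : ℤ)⟧}
    (hT : Triangle.mk f i h ∈ distTriang T) {g : Y ⟶ Z} {w : M ⟶ Z} (hw : i ≫ w = g)
    {r : Y ⟶ X} {s : Z ⟶ Y} (h₁ : f ≫ r = 𝟙 X) (h₂ : s ≫ g = 𝟙 Z) (h₃ : r ≫ f + g ≫ s = 𝟙 Y) :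
    IsIso w := by
  have hh : h = 0 := by
    have := dist_comp₃₁ hT
    rw [← comp_id h, ← CategoryTheory.Functor.map_id, ← h₁, Functor.map_comp, reassoc_of% this,
      zero_comp]
  obtain ⟨t, ht⟩ := dist_coyoneda₃ hT (𝟙 M) (by rw [hh, comp_zero])
  have : Epi i := epi_of_epi_fac ht
  refine ⟨s ≫ i, ?_, by rw [assoc, hw, h₂]⟩
  have hfi := dist_comp₁₂ hT
  rw [← cancel_epi i, reassoc_of% hw, ← assoc, eq_sub_of_add_eq' h₃, sub_comp, assoc, hfi]
  simp

lemma isIso_of_splitting_of_iso {X Y Z M : T} {f : X ⟶ Y} {i : Y ⟶ M} {h : M ⟶ X⟦(1 : ℤ)⟧}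
    (hT : Triangle.mk f i h ∈ distTriang T) {g : Y ⟶ Z} {w : M ⟶ Z} (hw : i ≫ w = g)
    {X' Y' Z' : T} (a : X ≅ X') (b : Y ≅ Y') (c : Z ≅ Z') {f' : X' ⟶ Y'} {g' : Y' ⟶ Z'}
    (hf : f ≫ b.hom = a.hom ≫ f') (hg : g ≫ c.hom = b.hom ≫ g')
    {r : Y' ⟶ X'} {s : Z' ⟶ Y'} (h₁ : f' ≫ r = 𝟙 X') (h₂ : s ≫ g' = 𝟙 Z')
    (h₃ : r ≫ f' + g' ≫ s = 𝟙 Y') : IsIso w := by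
  have hg' : g = b.hom ≫ g' ≫ c.inv := by rw [← assoc, Iso.eq_comp_inv, hg]
  have hf' : f = a.hom ≫ f' ≫ b.inv := by rw [← assoc, Iso.eq_comp_inv, hf]
  refine isIso_of_splitting hT hw (r := b.hom ≫ r ≫ a.inv) (s := c.hom ≫ s ≫ b.inv) ?_ ?_ ?_
  · rw [reassoc_of% hf, reassoc_of% h₁, Iso.hom_inv_id]
  · rw [hg', assoc, assoc, Iso.inv_hom_id_assoc, reassoc_of% h₂, Iso.hom_inv_id]
  · rw [hf', assoc, assoc, Iso.inv_hom_id_assoc, reassoc_of% hg, ← comp_add, ← assoc r,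
      ← assoc g', ← add_comp, h₃, id_comp, Iso.hom_inv_id]

end
end MatFac
namespace MatFac

section
variable {C : Type u} [Category.{v} C] [Abelian C] {n : ℕ}

namespace MF

/-- The component functors on the bounded homotopy category. -/
noncomputable abbrev evalKb (W : 𝟭 C ⟶ 𝟭 C) (i : ZMod n) :
    Kb (MF n W) ⥤ HomotopyCategory C (.up ℤ) :=
  (bounded (MF n W)).ι ⋙ evalK W i

/-- The component functors on the bounded above homotopy category. -/
noncomputable abbrev evalKminus (W : 𝟭 C ⟶ 𝟭 C) (i : ZMod n) :
    Kminus (MF n W) ⥤ HomotopyCategory C (.up ℤ) :=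
  (boundedAbove (MF n W)).ι ⋙ evalK W i

variable (W : 𝟭 C ⟶ 𝟭 C)

/-- As a common kernel of triangulated functors, the class of acyclic complexes is thick without
further work. -/
lemma acyclicB_eq : (gradedExact n W).acyclicB = jointKernel (evalKb W) := by
  ext K
  exact acyclic_iff_isZero K.obj

lemma acyclicMinus_eq : (gradedExact n W).acyclicMinus = jointKernel (evalKminus W) := by
  ext K
  exact acyclic_iff_isZero K.obj

/-- The components of a complex concentrated in degree zero. -/
noncomputable def singleKbEvalIso (i : ZMod n) : singleKb (MF n W) ⋙ evalKb W i ≅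
    eval W i ⋙ HomotopyCategory.singleFunctor C 0 :=
  Functor.isoWhiskerRight
    (HomologicalComplex.singleMapHomologicalComplex (eval W i) (.up ℤ) 0)
    (HomotopyCategory.quotient C (.up ℤ))

instance : (gradedExact n W).acyclicMinus.IsTriangulated := by
  rw [acyclicMinus_eq]
  infer_instance

instance : (gradedExact n W).acyclicMinus.IsStableUnderRetracts := by
  rw [acyclicMinus_eq]
  infer_instance

instance : (gradedExact n W).HasDerivedTriangles where
  isTriangulated := by
    rw [acyclicB_eq]
    infer_instance
  isStableUnderRetracts := by
    rw [acyclicB_eq]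
    infer_instance
  exists_cone {X Y Z f g} hfg := by
    obtain ⟨M, i, h, hT⟩ := distinguished_cocone_triangle ((singleKb (MF n W)).map f)
    obtain ⟨w, hw⟩ := dist_yoneda₂ hT ((singleKb (MF n W)).map g) (by
      rw [← Functor.map_comp, hfg.zero, Functor.map_zero])
    refine ⟨M, i, h, w, hT, hw, ?_⟩
    obtain ⟨σ⟩ := gradedExact_conf_iff.1 hfg
    -- Whether the cone of `w` is acyclic can be tested on components, where the admissible sequence
    -- is split and its cone is the third term.
    rw [acyclicB_eq, jointKernel_trW_iff]
    intro k
    let e := singleKbEvalIso W k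
    let G : C ⥤ HomotopyCategory C (.up ℤ) := HomotopyCategory.singleFunctor C 0
    exact isIso_of_splitting_of_iso (dist_map hT (evalKb W k))
      (((evalKb W k).map_comp _ _).symm.trans (congrArg (evalKb W k).map hw))
      (e.app X) (e.app Y) (e.app Z) (e.hom.naturality f) (e.hom.naturality g)
      (r := G.map (σ.r k)) (s := G.map (σ.s k))
      ((G.map_comp _ _).symm.trans ((congrArg G.map (σ.fr k)).trans (G.map_id _)))
      ((G.map_comp _ _).symm.trans ((congrArg G.map (σ.sg k)).trans (G.map_id _)))
      ((congrArg₂ (· + ·) (G.map_comp _ _).symm (G.map_comp _ _).symm).trans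
        (G.map_add.symm.trans ((congrArg G.map (σ.tot k)).trans (G.map_id _))))

end MF
end
end MatFac
namespace MatFac

/-! ### Factorizations with projective components -/

section
variable {C : Type u} [Category.{v} C] [Abelian C] {n : ℕ}

namespace MF

variable (n) in
/-- The factorizations with projective components. -/
def projComp (W : 𝟭 C ⟶ 𝟭 C) : ObjectProperty (MF n W) := fun M => ∀ i, Projective (M.X i)

variable {W : 𝟭 C ⟶ 𝟭 C}

lemma projComp.of_conf {M N L : MF n W} {f : M ⟶ N} {g : N ⟶ L} (h : (gradedExact n W).Conf f g)
    (hN : projComp n W N) : projComp n W M ∧ projComp n W L := by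
  obtain ⟨σ⟩ := gradedExact_conf_iff.1 h
  exact ⟨fun i => have := hN i; Retract.projective (Y := N.X i) ⟨f.f i, σ.r i, σ.fr i⟩,
    fun i => have := hN i; Retract.projective (Y := N.X i) ⟨σ.s i, g.f i, σ.sg i⟩⟩

variable [NeZero n]

lemma projective_biproduct {Y : ZMod n → C} (hY : ∀ i, Projective (Y i)) : Projective (⨁ Y) :=
  ⟨fun f e _ => ⟨biproduct.desc (fun i => Projective.factorThru (biproduct.ι Y i ≫ f) e),
    biproduct.hom_ext' _ _ (fun i => by simp)⟩⟩

lemma projComp_triv {Y : ZMod n → C} (hY : ∀ i, Projective (Y i)) : projComp n W (triv W Y) :=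
  fun _ => projective_biproduct hY

/-- A morphism out of the trivial factorization is a family of morphisms `Y i ⟶ M.X (i + 1)`, so it
lifts as soon as each of these does. -/
lemma projective_triv {Y : ZMod n → C} (hY : ∀ i, Projective (Y i)) : Projective (triv W Y) := by
  rw [← isProjectiveAb_iff]
  intro N L g hg u
  let t : ∀ i, Y i ⟶ N.X (i + 1) := fun i => Projective.factorThru
    (biproduct.ι Y i ≫ (show (⨁ Y) ⟶ L.X (i + 1) from u.f (i + 1))) (g.f (i + 1))
  refine ⟨fromTriv N t, ?_⟩
  rw [fromTriv_comp]
  simp only [t, Projective.factorThru_comp]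
  exact fromTriv_ι u

lemma epi_fromTriv {Y : ZMod n → C} (M : MF n W) (t : ∀ i, Y i ⟶ M.X (i + 1))
    (ht : ∀ i, Epi (t i)) : Epi (fromTriv M t) := epi_of_f _ (fun j => by
  obtain ⟨i, rfl⟩ : ∃ i, j = i + 1 := ⟨j - 1, by ring⟩
  have h := ι_fromTrivF M t i (i + 1)
  have e : (i + 1 - (i + 1)).val = 0 := by simp
  rw [dpow_congr M.d (i + 1) (i + 1) e (add_val_sub _ _), dpow_zero, comp_id] at h
  have : Epi (biproduct.ι Y i ≫ fromTrivF M t (i + 1)) := by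
    rw [h]
    exact ht i
  exact epi_of_epi (biproduct.ι Y i) (fromTrivF M t (i + 1)))

lemma projInj_triv (Y : ZMod n → C) : (gradedExact n W).ProjInj (triv W Y) :=
  ⟨isProjective_triv Y, isInjective_triv Y⟩

section
variable [EnoughProjectives C]

lemma exists_epi_from_triv (M : MF n W) : ∃ (Y : ZMod n → C) (g : triv W Y ⟶ M),
    (∀ i, Projective (Y i)) ∧ Epi g :=
  ⟨fun i => Projective.over (M.X (i + 1)), fromTriv M (fun i => Projective.π _),
    fun _ => inferInstance, epi_fromTriv _ _ (fun _ => inferInstance)⟩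

instance : EnoughProjectives (MF n W) where
  presentation M := by
    obtain ⟨Y, g, hY, hg⟩ := exists_epi_from_triv M
    exact ⟨{ p := triv W Y, projective := projective_triv hY, f := g }⟩

/-- A projective factorization is a retract of a trivial one on projective objects, whose components
are sums of these. -/
lemma projComp_of_projective (P : MF n W) [Projective P] : projComp n W P := fun i => by
  obtain ⟨Y, g, hY, hg⟩ := exists_epi_from_triv P
  have := projComp_triv (W := W) hY i
  exact Retract.projective (Y := (triv W Y).X i)
    ((⟨Projective.factorThru (𝟙 P) g, g, Projective.factorThru_comp _ _⟩ :
      Retract P (triv W Y)).map (eval W i))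

end

/-- Here `T` is both projective for the abelian structure and projective-injective for the split
one, while the kernel stays in the class. This is the step of dimension shifting against `𝒦`;
`projComp.exists_conf_to` is its counterpart for the quotient by the perfect complexes. -/
lemma projComp.exists_conf_from {M : MF n W} (hM : projComp n W M) :
    ∃ (M' T : MF n W) (f : M' ⟶ T) (g : T ⟶ M), (gradedExact n W).Conf f g ∧ projComp n W M' ∧
      Projective T ∧ (gradedExact n W).ProjInj T := by
  obtain ⟨M', f, w, h⟩ := deflation_fromTriv M
  have hc : (gradedExact n W).Conf f _ := ⟨w, h⟩
  have hY : ∀ i, Projective (M.X (i + 1)) := fun i => hM (i + 1)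
  exact ⟨M', _, f, _, hc, (projComp.of_conf hc (projComp_triv hY)).1, projective_triv hY,
    projInj_triv _⟩

lemma projComp.exists_conf_to {M : MF n W} (hM : projComp n W M) :
    ∃ (T M' : MF n W) (f : M ⟶ T) (g : T ⟶ M'), (gradedExact n W).Conf f g ∧ projComp n W M' ∧
      (gradedExact n W).ProjInj T := by
  obtain ⟨M', g, w, h⟩ := inflation_toTriv M
  have hc : (gradedExact n W).Conf _ g := ⟨w, h⟩
  exact ⟨_, M', _, g, hc, (projComp.of_conf hc (projComp_triv hM)).2, projInj_triv _⟩

/-- A factorization with projective components is literally a factorization in the category of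
projectives, for the restricted `W`. -/
lemma stabIncl_essImage_iff (X : StabMF n W) : (stabIncl n W).essImage X ↔
    ∃ M, projComp n W M ∧ Nonempty ((gradedExact n W).toStab.obj M ≅ X) := by
  constructor
  · rintro ⟨M, ⟨e⟩⟩
    obtain ⟨M, rfl⟩ := ExactStructure.Stab.exists_rep M
    exact ⟨_, fun i => (M.X i).property, ⟨e⟩⟩
  · rintro ⟨M, hM, ⟨e⟩⟩
    let M' : MF n (restrictProj W) :=
      { X := fun i => ⟨M.X i, hM i⟩
        d := fun i => ObjectProperty.homMk (M.d i)
        dpow_eq := fun i => by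
          apply (isProjective C).ι.map_injective
          rw [map_dpow]
          exact M.dpow_eq i }
    exact ⟨(gradedExact n _).toStab.obj M', ⟨e⟩⟩

end MF
end
end MatFac
namespace MatFac

/-! ### Comparison of the bounded and bounded above derived categories -/

section
variable {T : Type u} [Category.{v} T] [HasZeroObject T] [HasShift T ℤ] [Preadditive T]
  [∀ n : ℤ, (shiftFunctor T n).Additive] [Pretriangulated T] [IsTriangulated T]
  {T' : Type u'} [Category.{v'} T'] [HasZeroObject T'] [HasShift T' ℤ] [Preadditive T']
  [∀ n : ℤ, (shiftFunctor T' n).Additive] [Pretriangulated T']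
  (P : ObjectProperty T) [P.IsTriangulated] [P.IsStableUnderRetracts]
  (F : T ⥤ T') [F.CommShift ℤ] [F.IsTriangulated] (hF : ∀ X, P X → IsZero (F.obj X))

omit [IsTriangulated T] [P.IsTriangulated] [P.IsStableUnderRetracts] in
include hF in
lemma isInvertedBy_trW : P.trW.IsInvertedBy F := by
  rintro X Y f ⟨Z, g, h, hT, hZ⟩
  exact (dist_isZero₃_iff (dist_map hT F)).1 (hF Z hZ)

/-- The functor induced on a Verdier quotient. -/
noncomputable def verdierLift : VerdierQuot P ⥤ T' :=
  Localization.lift F (isInvertedBy_trW P F hF) (verdierQ P)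

noncomputable instance : Localization.Lifting (verdierQ P) P.trW F (verdierLift P F hF) :=
  inferInstanceAs (Localization.Lifting (verdierQ P) P.trW F
    (Localization.lift F (isInvertedBy_trW P F hF) (verdierQ P)))

/-- The functor induced on a Verdier quotient extends the given one. -/
noncomputable def verdierLiftIso : verdierQ P ⋙ verdierLift P F hF ≅ F :=
  Localization.Lifting.iso (verdierQ P) P.trW F (verdierLift P F hF)

noncomputable instance : (verdierLift P F hF).CommShift ℤ :=
  Functor.commShiftOfLocalization (verdierQ P) P.trW ℤ F (verdierLift P F hF)

instance : NatTrans.CommShift (verdierLiftIso P F hF).hom ℤ :=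
  NatTrans.commShift_iso_hom_of_localization (verdierQ P) P.trW ℤ F (verdierLift P F hF)

instance : (verdierLift P F hF).IsTriangulated := by
  have := Localization.essSurj_mapArrow (verdierQ P) P.trW
  exact Functor.isTriangulated_of_precomp_iso (verdierLiftIso P F hF)

end

section
variable {E : Type u} [Category.{v} E] [Preadditive E] [HasZeroObject E] [HasBinaryBiproducts E]

variable (E) in
/-- The inclusion of bounded complexes into bounded above complexes. -/
noncomputable abbrev kbToKminus : Kb E ⥤ Kminus E :=
  (boundedAbove E).lift (bounded E).ι (fun K => bounded_le_boundedAbove E _ K.property)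

namespace ExactStructure
variable (S : ExactStructure E) [S.HasDerivedTriangles] [S.acyclicMinus.IsTriangulated]
  [S.acyclicMinus.IsStableUnderRetracts]

/-- The composite `K^b ⥤ K⁻ ⥤ D⁻`. -/
noncomputable abbrev kbToDminus : Kb E ⥤ S.Dminus := kbToKminus E ⋙ verdierQ S.acyclicMinus

/-- Acyclicity is the same condition on the underlying complex in both settings, and the acyclic
complexes in `K⁻` are thick. -/
lemma isZero_kbToDminus_obj_iff (K : Kb E) : IsZero (S.kbToDminus.obj K) ↔ S.acyclicB K :=
  isZero_verdierQ_obj_iff_of_thick _ _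

/-- The functor `D^b ⥤ D⁻`. -/
noncomputable def toDminus : S.Db ⥤ S.Dminus :=
  verdierLift S.acyclicB S.kbToDminus fun K hK => (S.isZero_kbToDminus_obj_iff K).2 hK

noncomputable instance : S.toDminus.CommShift ℤ :=
  inferInstanceAs ((verdierLift S.acyclicB _ _).CommShift ℤ)

instance : S.toDminus.IsTriangulated :=
  inferInstanceAs ((verdierLift S.acyclicB _ _).IsTriangulated)

/-- The functor `D^b ⥤ D⁻` on the images of complexes. -/
noncomputable def toDminusIso : verdierQ S.acyclicB ⋙ S.toDminus ≅ S.kbToDminus :=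
  verdierLiftIso _ _ _

/-- Apart from its being triangulated, this is the only property of `D^b ⥤ D⁻` that is needed; no
full faithfulness enters. -/
lemma isZero_of_isZero_toDminus_obj (X : S.Db) (h : IsZero (S.toDminus.obj X)) : IsZero X := by
  let e := (verdierQ S.acyclicB).objObjPreimageIso X
  have h₁ : IsZero (S.kbToDminus.obj ((verdierQ S.acyclicB).objPreimage X)) :=
    h.of_iso ((S.toDminusIso.app _).symm ≪≫ S.toDminus.mapIso e)
  exact (isZero_verdierQ_obj S.acyclicB ((S.isZero_kbToDminus_obj_iff _).1 h₁)).of_iso e.symm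

end ExactStructure
end
end MatFac
namespace MatFac

/-! ### Bounded above complexes of projectives -/

section
variable {A : Type u} [Category.{v} A] [Abelian A]

/-- The bounded above complexes of projective objects. -/
def projTerms (A : Type u) [Category.{v} A] [Abelian A] :
    ObjectProperty (HomotopyCategory A (.up ℤ)) :=
  fun K => boundedAbove A K ∧ ∀ i, Projective (K.as.X i)

instance : (projTerms A).IsTriangulated := isTriangulated_of_cone _
  ⟨⟨0, fun i _ => (HomologicalComplex.eval A (.up ℤ) i).map_isZero (isZero_zero _)⟩,
    fun i => ((HomologicalComplex.eval A (.up ℤ) i).map_isZero (isZero_zero _)).projective⟩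
  (fun K n ⟨⟨b, hb⟩, h⟩ => ⟨⟨b - n, fun i hi => hb (i + n) (by lia)⟩, fun i => h (i + n)⟩)
  (fun K L f ⟨⟨b, hb⟩, h⟩ ⟨⟨b', hb'⟩, h'⟩ => ⟨⟨max b b', fun i hi =>
    (CochainComplex.mappingCone.isZero_X_iff f i).2
      ⟨hb _ (by have := le_max_left b b'; lia), hb' _ (by have := le_max_right b b'; lia)⟩⟩,
    fun i => by
      have h₁ : Projective (K.X (i + 1)) := h (i + 1)
      have h₂ : Projective (L.X i) := h' i
      exact Projective.of_iso (HomologicalComplex.homotopyCofiber.XIsoBiprod f i (i + 1) rfl).symm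
        inferInstance⟩)

lemma projTerms_le : projTerms A ≤ (HomotopyCategory.subcategoryAcyclic A).leftOrthogonal := by
  rintro K ⟨⟨b, hb⟩, h⟩
  have h₁ : CochainComplex.IsStrictlyLE K.as b := by
    rw [CochainComplex.isStrictlyLE_iff]
    exact hb
  have := h
  have h₂ := CochainComplex.isKProjective_of_projective K.as b
  exact CochainComplex.IsKProjective.leftOrthogonal K.as

/-- The bounded above complexes that are homotopy equivalent to complexes of projectives. -/
def projMinus (A : Type u) [Category.{v} A] [Abelian A] : ObjectProperty (Kminus A) :=
  (projTerms A).isoClosure.inverseImage (boundedAbove A).ι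

instance : (projMinus A).IsTriangulated := by
  unfold projMinus
  infer_instance

/-- The exact bounded above complexes. -/
def exactMinus (A : Type u) [Category.{v} A] [Abelian A] : ObjectProperty (Kminus A) :=
  (HomotopyCategory.subcategoryAcyclic A).inverseImage (boundedAbove A).ι

lemma projMinus_le : projMinus A ≤ (exactMinus A).leftOrthogonal := fun K hK L f hL => by
  have h := (ObjectProperty.isoClosure_le_iff _ _).2 (projTerms_le (A := A)) _ hK
  exact ObjectProperty.hom_ext _ (h f.hom hL)

end

section
variable {C : Type u} [Category.{v} C] [Abelian C] {n : ℕ} (W : 𝟭 C ⟶ 𝟭 C)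

namespace MF

/-- Contractible components are in particular exact. Hence complexes of projective factorizations,
being orthogonal to all exact complexes, are orthogonal to the acyclic ones. -/
lemma acyclicMinus_le : (gradedExact n W).acyclicMinus ≤ exactMinus (MF n W) := by
  intro K hK
  refine (HomotopyCategory.quotient_obj_mem_subcategoryAcyclic_iff_acyclic K.obj.as).2 ?_
  rw [← acyclicAb_iff]
  intro i
  have h := (acyclic_iff K.obj.as).1 hK i
  have h' : IsZero ((HomotopyCategory.quotient C (.up ℤ)).obj _) :=
    (HomotopyCategory.isZero_quotient_obj_iff _).2 h
  exact (HomotopyCategory.quotient_obj_mem_subcategoryAcyclic_iff_acyclic _).1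
    (ObjectProperty.prop_of_isZero _ h')

/-- The functor from complexes of projective factorizations to `D⁻`. -/
noncomputable abbrev projMinusToDminus :
    (projMinus (MF n W)).FullSubcategory ⥤ (gradedExact n W).Dminus :=
  (projMinus (MF n W)).ι ⋙ verdierQ (gradedExact n W).acyclicMinus

variable {W} in
lemma projMinus_map_bijective {P : Kminus (MF n W)} (hP : projMinus (MF n W) P)
    (K : Kminus (MF n W)) : Function.Bijective
      ((verdierQ (gradedExact n W).acyclicMinus).map : (P ⟶ K) → _) :=
  (show (gradedExact n W).acyclicMinus.leftOrthogonal P from fun L f hL =>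
    projMinus_le P hP f (acyclicMinus_le W L hL)).map_bijective_of_isTriangulated _ _

instance : (projMinusToDminus (n := n) W).Full where
  map_surjective {P Q} f := by
    obtain ⟨g, hg⟩ := (projMinus_map_bijective P.property Q.obj).2 f
    exact ⟨ObjectProperty.homMk g, hg⟩

variable [NeZero n]

variable {W} in
lemma projDb_iff (Y : (gradedExact n W).Db) :
    projDb n W Y ↔ (projMinusToDminus W).essImage ((gradedExact n W).toDminus.obj Y) := by
  constructor
  · rintro ⟨K, P, hP, ⟨e⟩, ⟨e'⟩⟩
    refine ⟨⟨P, ObjectProperty.le_isoClosure _ _ ⟨P.property, fun i =>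
      (isProjectiveAb_iff _).1 (hP i)⟩⟩, ⟨e'.symm ≪≫ ?_⟩⟩
    exact ((gradedExact n W).toDminusIso.app K).symm ≪≫ (gradedExact n W).toDminus.mapIso e.symm
  · rintro ⟨⟨P, P', ⟨hb, hp⟩, ⟨a⟩⟩, ⟨e⟩⟩
    let a' : P ≅ ⟨P', hb⟩ := (boundedAbove (MF n W)).ι.preimageIso a
    let b := (verdierQ (gradedExact n W).acyclicB).objObjPreimageIso Y
    refine ⟨_, ⟨P', hb⟩, fun i => (isProjectiveAb_iff _).2 (hp i), ⟨b.symm⟩, ⟨?_⟩⟩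
    exact ((gradedExact n W).toDminusIso.app _).symm ≪≫ (gradedExact n W).toDminus.mapIso b ≪≫
      e.symm ≪≫ (verdierQ (gradedExact n W).acyclicMinus).mapIso a'

/-- In this form `𝒫` is visibly triangulated and closed under isomorphisms: it is the preimage,
under a triangulated functor, of the essential image of a full one. -/
lemma projDb_eq : projDb n W =
    (projMinusToDminus W).essImage.inverseImage (gradedExact n W).toDminus := by
  ext Y
  exact projDb_iff Y

instance : (projDb n W).IsTriangulated := by
  rw [projDb_eq]
  have h₀ : (projMinusToDminus (n := n) W).IsTriangulated := inferInstance
  have h : (projMinusToDminus (n := n) W).essImage.IsTriangulated := inferInstance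
  infer_instance

instance : (projDb n W).IsClosedUnderIsomorphisms := by
  rw [projDb_eq]
  infer_instance

end MF
end
end MatFac
namespace MatFac

/-! ### Projective resolutions and orthogonality to exact complexes -/

section
variable {C : Type u} [Category.{v} C] [Abelian C] {n : ℕ} {W : 𝟭 C ⟶ 𝟭 C}

namespace MF

lemma evalK_mem_subcategoryAcyclic {K : HomotopyCategory (MF n W) (.up ℤ)}
    (h : HomotopyCategory.subcategoryAcyclic (MF n W) K) (i : ZMod n) :
    HomotopyCategory.subcategoryAcyclic C ((evalK W i).obj K) :=
  (HomotopyCategory.quotient_obj_mem_subcategoryAcyclic_iff_acyclic _).2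
    ((acyclicAb_iff K.as).2
      ((HomotopyCategory.quotient_obj_mem_subcategoryAcyclic_iff_acyclic K.as).1 h) i)

lemma projTerms_evalK {K : HomotopyCategory (MF n W) (.up ℤ)} (hb : boundedAbove (MF n W) K)
    (h : ∀ j, projComp n W (K.as.X j)) (i : ZMod n) : projTerms C ((evalK W i).obj K) := by
  obtain ⟨b, hb⟩ := hb
  exact ⟨⟨b, fun j hj => (eval W i).map_isZero (hb j hj)⟩, fun j => h j i⟩

/-- Each component of the cone is exact and is also a cone of bounded above complexes of
projectives, hence left orthogonal to exact complexes. It is orthogonal to itself, so contractible.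
-/
lemma trW_acyclicMinus {P Q : Kminus (MF n W)} (f : P ⟶ Q) (hf : (exactMinus (MF n W)).trW f)
    (hP : ∀ j, projComp n W (P.obj.as.X j)) (hQ : ∀ j, projComp n W (Q.obj.as.X j)) :
    (gradedExact n W).acyclicMinus.trW f := by
  obtain ⟨Z, g, h, hT, hZ⟩ := hf
  refine ⟨Z, g, h, hT, ?_⟩
  rw [acyclicMinus_eq]
  intro i
  have h₁ := projTerms_le _ (projTerms_evalK P.property hP i)
  have h₂ := projTerms_le _ (projTerms_evalK Q.property hQ i)
  have h₃ := (HomotopyCategory.subcategoryAcyclic C).leftOrthogonal.ext_of_isTriangulatedClosed₃ _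
    (dist_map hT (evalKminus W i)) h₁ h₂
  rw [IsZero.iff_id_eq_zero]
  exact h₃ _ (evalK_mem_subcategoryAcyclic hZ i)

lemma projComp_single {M : MF n W} (hM : projComp n W M) (j : ℤ) :
    projComp n W (((singleKb (MF n W)).obj M).obj.as.X j) := by
  change projComp n W (((HomologicalComplex.single (MF n W) (.up ℤ) 0).obj M).X j)
  intro i
  by_cases h : j = 0
  · subst h
    have := hM i
    exact Projective.of_iso
      ((eval W i).mapIso (HomologicalComplex.singleObjXSelf (.up ℤ) 0 M).symm) this
  · exact ((eval W i).map_isZero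
      (HomologicalComplex.isZero_single_obj_X _ _ _ _ h)).projective

variable [NeZero n] [EnoughProjectives C]

/-- Factorizations with projective components have resolutions by projective factorizations that
are homotopy equivalences in each component. -/
lemma projDb_singleDb {M : MF n W} (hM : projComp n W M) :
    projDb n W ((gradedExact n W).singleDb.obj M) := by
  let R := projectiveResolution M
  let P : Kminus (MF n W) := ⟨(HomotopyCategory.quotient _ _).obj R.cochainComplex, 0, fun i hi =>
    CochainComplex.isZero_of_isStrictlyLE R.cochainComplex 0 i hi⟩
  have hP : ∀ i, Projective (P.obj.as.X i) := fun i =>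
    inferInstanceAs (Projective (R.cochainComplex.X i))
  let φ : P ⟶ (kbToKminus (MF n W)).obj ((singleKb (MF n W)).obj M) :=
    ObjectProperty.homMk ((HomotopyCategory.quotient _ _).map R.π')
  have hφ : (exactMinus (MF n W)).trW φ := by
    rw [exactMinus, ObjectProperty.inverseImage_trW_iff,
      ← HomotopyCategory.quasiIso_eq_trW_subcategoryAcyclic]
    refine (HomotopyCategory.quotient_map_mem_quasiIso_iff R.π').2 ?_
    rw [HomologicalComplex.mem_quasiIso_iff]
    infer_instance
  -- The augmentation is a priori inverted only for the abelian structure. Projectivity of the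
  -- components on both sides makes it invertible in `D⁻` for the split structure.
  have hφ' := trW_acyclicMinus φ hφ (fun j => have := hP j; projComp_of_projective _)
    (fun j => projComp_single hM j)
  have := Localization.inverts (verdierQ (gradedExact n W).acyclicMinus) _ φ hφ'
  exact ⟨_, P, fun i => (isProjectiveAb_iff _).2 (hP i), ⟨Iso.refl _⟩,
    ⟨(asIso ((verdierQ (gradedExact n W).acyclicMinus).map φ)).symm⟩⟩

end MF
end

section
variable {C : Type u} [Category.{v} C] [Abelian C] {n : ℕ} [NeZero n] {W : 𝟭 C ⟶ 𝟭 C}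

/-- The exact bounded complexes. -/
def exactB (A : Type u) [Category.{v} A] [Abelian A] : ObjectProperty (Kb A) :=
  (HomotopyCategory.subcategoryAcyclic A).inverseImage (bounded A).ι

instance (A : Type u) [Category.{v} A] [Abelian A] : (exactB A).IsTriangulated := by
  unfold exactB
  infer_instance

instance (A : Type u) [Category.{v} A] [Abelian A] : (exactB A).IsClosedUnderIsomorphisms := by
  unfold exactB
  infer_instance

namespace MF

omit [NeZero n] in
lemma exactB_iff (K : Kb (MF n W)) : exactB (MF n W) K ↔ AcyclicAb K.obj.as :=
  (HomotopyCategory.quotient_obj_mem_subcategoryAcyclic_iff_acyclic K.obj.as).trans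
    (acyclicAb_iff _).symm

instance : (acyclicDb n W).IsClosedUnderIsomorphisms where
  of_iso e := fun ⟨K, hK, ⟨e'⟩⟩ => ⟨K, hK, ⟨e.symm ≪≫ e'⟩⟩

instance : (acyclicDb n W).IsStableUnderShift ℤ where
  isStableUnderShiftBy m := ⟨fun Y ⟨K, hK, ⟨e⟩⟩ => ⟨K⟦m⟧, (exactB_iff _).1
    ((exactB (MF n W)).le_shift m _ ((exactB_iff K).2 hK)),
    ⟨(shiftFunctor _ m).mapIso e ≪≫
      (((verdierQ (gradedExact n W).acyclicB).commShiftIso m).symm.app K)⟩⟩⟩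

/-- Morphisms from `T` in `D^b` are those in `K^b`, as `T` is projective for the split structure
too. In `K^b` they vanish because `T` is projective in the abelian category and the target is exact.
-/
lemma orth_singleDb_of_projective {T : MF n W} [hT : Projective T]
    {Y : (gradedExact n W).Db} (hY : acyclicDb n W Y) :
    Orth ((gradedExact n W).singleDb.obj T) Y := by
  obtain ⟨K, hK, ⟨e⟩⟩ := hY
  have h₁ : Orth ((singleKb (MF n W)).obj T) K := fun f => by
    refine ObjectProperty.hom_ext _ (projTerms_le (A := MF n W) _ ?_ f.hom ((exactB_iff K).2 hK))
    refine ⟨bounded_le_boundedAbove _ _ ((singleKb (MF n W)).obj T).property, fun j => ?_⟩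
    change Projective (((HomologicalComplex.single (MF n W) (.up ℤ) 0).obj T).X j)
    by_cases h : j = 0
    · subst h
      exact Projective.of_iso (HomologicalComplex.singleObjXSelf (.up ℤ) 0 T).symm hT
    · exact (HomologicalComplex.isZero_single_obj_X _ _ _ _ h).projective
  have h₂ : (gradedExact n W).IsProjective T := fun M N g hg u => by
    obtain ⟨Q, f, ⟨σ⟩⟩ := exists_splitData_of_deflation hg
    exact (isProjectiveAb_iff T).2 hT g σ.epi u
  exact (h₁.map_bijective (verdierQ (gradedExact n W).acyclicB)
    ((ExactStructure.leftOrthogonal_singleKb h₂).map_bijective_of_isTriangulated _ _).2).of_iso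
      (Iso.refl _) e.symm

/-- The factorizations with projective components are left orthogonal to the exact complexes. -/
lemma orth_singleDb_of_projComp {M : MF n W} (hM : projComp n W M)
    {Y : (gradedExact n W).Db} (hY : acyclicDb n W Y) (m : ℕ)
    (hm : ∀ X, Orth (((gradedExact n W).singleDb.obj X)⟦(m : ℤ)⟧) Y) :
    Orth ((gradedExact n W).singleDb.obj M) Y := by
  induction m generalizing M Y with
  | zero => exact (hm M).of_iso ((shiftFunctorZero _ ℤ).app _) (Iso.refl _)
  | succ m ih =>
    -- Morphisms `T ⟶ Y` vanish, so a morphism `M ⟶ Y` factors through `M'⟦1⟧ ⟶ Y`. Equivalently one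
    -- has `M' ⟶ Y⟦-1⟧`, and the vanishing bound of `Y⟦-1⟧` is smaller by one.
    obtain ⟨M', T, f, g, hc, hM', hT, -⟩ := hM.exists_conf_from
    have h := ih hM' ((acyclicDb n W).le_shift (-1 : ℤ) _ hY) (fun X =>
      (orth_shift_right_iff (-1 : ℤ)).2 ((hm X).of_iso
        ((shiftFunctorAdd' _ (m : ℤ) (- -1) _ (by push_cast; ring)).app _) (Iso.refl _)))
    intro φ
    obtain ⟨r, hr⟩ := dist_yoneda₃ ((gradedExact n W).connectingDb.dist hc) φ
      (orth_singleDb_of_projective hY _)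
    rw [← hr, (((orth_shift_right_iff (-1 : ℤ)).1 h).of_iso
      ((shiftFunctor _ (- -1 : ℤ)).mapIso (Iso.refl _)) (Iso.refl _)) r, comp_zero]

end MF
end

section
variable {E : Type u} [Category.{v} E] [Preadditive E] [HasZeroObject E] [HasBinaryBiproducts E]
  (S : ExactStructure E) [S.HasDerivedTriangles] [S.IsFrobenius]

/-- The objects that receive no morphisms from highly shifted objects of the exact category. -/
def ExactStructure.orthEventually : ObjectProperty S.Db := fun Y =>
  ∃ m : ℕ, ∀ k : ℤ, m ≤ k → ∀ X : E, Orth ((S.singleDb.obj X)⟦k⟧) Y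

instance : S.orthEventually.IsClosedUnderIsomorphisms where
  of_iso e := fun ⟨m, h⟩ => ⟨m, fun k hk X => (h k hk X).of_iso (Iso.refl _) e⟩

instance : S.orthEventually.IsTriangulated where
  exists_zero := ⟨0, isZero_zero _, 0, fun _ _ _ f => (isZero_zero _).eq_of_tgt _ _⟩
  isStableUnderShiftBy a := ⟨fun Y ⟨m, h⟩ => ⟨(m + a).toNat, fun k hk X =>
    (orth_shift_right_iff a).2 ((h (k + -a) (by omega) X).of_iso
      ((shiftFunctorAdd _ k (-a)).app _) (Iso.refl _))⟩⟩
  toIsTriangulatedClosed₂ := .mk' fun D hD ⟨m₁, h₁⟩ ⟨m₃, h₃⟩ => ⟨max m₁ m₃, fun k hk X f => by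
    have hk' : (m₁ : ℤ) ≤ k ∧ (m₃ : ℤ) ≤ k := by omega
    obtain ⟨r, rfl⟩ := Triangle.coyoneda_exact₂ D hD f (h₃ k hk'.2 X _)
    rw [h₁ k hk'.1 X r, zero_comp]⟩

/-- For an object in degree zero this is the vanishing of negative extensions; dévissage gives a
bound for every `Y`. It starts the induction in `orth_singleDb_of_projComp`. -/
lemma ExactStructure.exists_orth_singleDb (Y : S.Db) : S.orthEventually Y := by
  refine S.orthEventually.prop_of_iso ((verdierQ S.acyclicB).objObjPreimageIso Y)
    (prop_of_singleKb (S.orthEventually.inverseImage (verdierQ S.acyclicB)) _ fun i => ?_)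
  exact ⟨1, fun k hk X => S.orth_singleDb_shift X _ k (by omega)⟩

end

section
variable {C : Type u} [Category.{v} C] [Abelian C] {n : ℕ} [NeZero n] {W : 𝟭 C ⟶ 𝟭 C}

namespace MF

lemma leftOrthogonal_singleDb {M : MF n W} (hM : projComp n W M) :
    (acyclicDb n W).leftOrthogonal ((gradedExact n W).singleDb.obj M) := fun Y f hY => by
  obtain ⟨m, hm⟩ := (gradedExact n W).exists_orth_singleDb Y
  exact orth_singleDb_of_projComp hM hY m (hm m le_rfl) f

end MF
end
end MatFac
namespace MatFac

/-! ### The semiorthogonal decomposition of the bounded derived category -/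

section
variable {T : Type u} [Category.{v} T] [HasZeroObject T] [HasShift T ℤ] [Preadditive T]
  [∀ n : ℤ, (shiftFunctor T n).Additive] [Pretriangulated T] [IsTriangulated T]

/-- The image of a larger thick subcategory in a Verdier quotient is triangulated. -/
lemma isTriangulated_verdierImage {P Q : ObjectProperty T} [P.IsTriangulated]
    [P.IsStableUnderRetracts] [Q.IsTriangulated] [Q.IsStableUnderRetracts] (h : P ≤ Q) :
    ObjectProperty.IsTriangulated (C := VerdierQuot P)
      (fun Y => ∃ K, Q K ∧ Nonempty (Y ≅ (verdierQ P).obj K)) := by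
  have hQ : ∀ K, P K → IsZero ((verdierQ Q).obj K) := fun K hK =>
    (isZero_verdierQ_obj_iff_of_thick Q K).2 (h K hK)
  let F := verdierLift P (verdierQ Q) hQ
  let e : ∀ K, F.obj ((verdierQ P).obj K) ≅ (verdierQ Q).obj K :=
    (verdierLiftIso P (verdierQ Q) hQ).app
  -- The image of `Q` is the kernel of the induced functor from the quotient by `P` to the quotient
  -- by `Q`.
  have key : (fun Y => ∃ K, Q K ∧ Nonempty (Y ≅ (verdierQ P).obj K)) =
      jointKernel (fun _ : Unit => F) := by
    ext Y
    constructor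
    · rintro ⟨K, hK, ⟨a⟩⟩ -
      exact ((isZero_verdierQ_obj_iff_of_thick Q K).2 hK).of_iso (F.mapIso a ≪≫ e K)
    · intro hY
      let a := (verdierQ P).objObjPreimageIso Y
      exact ⟨_, (isZero_verdierQ_obj_iff_of_thick Q _).1
        ((hY ()).of_iso ((e _).symm ≪≫ F.mapIso a)), ⟨a.symm⟩⟩
  rw [key]
  infer_instance

/-- Extensions of two orthogonal triangulated subcategories form a triangulated subcategory. -/
lemma isTriangulated_extensionProduct {A₁ A₂ : ObjectProperty T} [A₁.IsTriangulated]
    [A₂.IsTriangulated] [A₁.IsClosedUnderIsomorphisms] [A₂.IsClosedUnderIsomorphisms]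
    (h : A₂ ≤ A₁.leftOrthogonal) : (ObjectProperty.extensionProduct A₂ A₁).IsTriangulated := by
  -- An extension in the other order has zero connecting morphism by orthogonality, so it is a
  -- direct sum, and the summands may be exchanged.
  have h₁ : ObjectProperty.extensionProduct A₁ A₂ ≤ ObjectProperty.extensionProduct A₂ A₁ := by
    rintro X ⟨A, L, f, g, k, hT, hA, hL⟩
    have hk : k = 0 := h L hL k (A₁.le_shift (1 : ℤ) _ hA)
    obtain ⟨e, -, -⟩ := exists_iso_binaryBiproduct_of_distTriang _ hT hk
    refine ObjectProperty.prop_of_iso _ (biprod.braiding L A ≪≫ e.symm)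
      ⟨L, A, _, _, _, binaryBiproductTriangle_distinguished L A, hL, hA⟩
  -- With `*` for extensions, `A₂ * A₁ * A₂ * A₁ ⊆ A₂ * A₂ * A₁ * A₁ ⊆ A₂ * A₁`.
  have h₂ : ObjectProperty.extensionProduct (ObjectProperty.extensionProduct A₂ A₁)
      (ObjectProperty.extensionProduct A₂ A₁) ≤ ObjectProperty.extensionProduct A₂ A₁ := by
    rw [ObjectProperty.extensionProduct_assoc, ← ObjectProperty.extensionProduct_assoc A₁ A₂]
    refine (ObjectProperty.monotone_extensionProduct_right _
      (ObjectProperty.monotone_extensionProduct_left _ h₁)).trans ?_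
    rw [ObjectProperty.extensionProduct_assoc, ← ObjectProperty.extensionProduct_assoc A₂ A₂]
    exact (ObjectProperty.monotone_extensionProduct_left _
      (ObjectProperty.extensionProduct_le_of_isTriangulatedClosed₂ le_rfl le_rfl)).trans
      (ObjectProperty.monotone_extensionProduct_right _
        (ObjectProperty.extensionProduct_le_of_isTriangulatedClosed₂ le_rfl le_rfl))
  exact
    { exists_zero := ⟨0, isZero_zero T, ObjectProperty.le_extensionProduct_left _ _
        (A₂.prop_of_isZero (isZero_zero T))⟩
      toIsTriangulatedClosed₂ := .mk' fun D hD hX hZ => h₂ _ ⟨_, _, _, _, _, hD, hX, hZ⟩ }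

end

section
variable {A : Type u} [Category.{v} A] [Abelian A]

instance : (exactB A).IsStableUnderRetracts where
  of_retract {X Y} r h := by
    refine (HomotopyCategory.mem_subcategoryAcyclic_iff X.obj).2 fun j => ?_
    have hY := (HomotopyCategory.mem_subcategoryAcyclic_iff Y.obj).1 h j
    exact IsZero.of_mono ((r.map ((bounded A).ι ⋙
      HomotopyCategory.homologyFunctor A (.up ℤ) j)).i) hY

/-- A short exact sequence gives a triangle up to an exact complex. -/
lemma exists_dist_of_shortExact {S : ShortComplex A} (hS : S.ShortExact) :
    ∃ (Z : Kb A) (i : (singleKb A).obj S.X₂ ⟶ Z) (h : Z ⟶ ((singleKb A).obj S.X₁)⟦(1 : ℤ)⟧)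
      (w : Z ⟶ (singleKb A).obj S.X₃),
      Triangle.mk ((singleKb A).map S.f) i h ∈ distTriang (Kb A) ∧ (exactB A).trW w := by
  let S' := S.map (HomologicalComplex.single A (.up ℤ) 0)
  have hS' : S'.ShortExact := hS.map_of_exact _
  have hT := HomotopyCategory.mappingCone_triangleh_distinguished S'.f
  let Z : Kb A := ⟨(HomotopyCategory.quotient _ _).obj (CochainComplex.mappingCone S'.f), -1, 0,
    fun i hi => (CochainComplex.mappingCone.isZero_X_iff S'.f i).2
      ⟨HomologicalComplex.isZero_single_obj_X _ _ _ _ (by omega),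
        HomologicalComplex.isZero_single_obj_X _ _ _ _ (by omega)⟩⟩
  have := CochainComplex.mappingCone.quasiIso_descShortComplex hS'
  let w : Z ⟶ (singleKb A).obj S.X₃ := ObjectProperty.homMk
    ((HomotopyCategory.quotient _ _).map (CochainComplex.mappingCone.descShortComplex S'))
  refine ⟨Z, _, _, w, mem_distTriang_fullSubcategory (X := (singleKb A).obj S.X₁)
    (Y := (singleKb A).obj S.X₂) (Z := Z) hT, ?_⟩
  rw [exactB, ObjectProperty.inverseImage_trW_iff,
    ← HomotopyCategory.quasiIso_eq_trW_subcategoryAcyclic]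
  refine (HomotopyCategory.quotient_map_mem_quasiIso_iff
    (CochainComplex.mappingCone.descShortComplex S')).2 ?_
  rw [HomologicalComplex.mem_quasiIso_iff]
  infer_instance

end

section
variable {C : Type u} [Category.{v} C] [Abelian C] {n : ℕ} [NeZero n] {W : 𝟭 C ⟶ 𝟭 C}

namespace MF

omit [NeZero n] in
lemma acyclicB_le : (gradedExact n W).acyclicB ≤ exactB (MF n W) := fun K hK =>
  acyclicMinus_le W ((kbToKminus (MF n W)).obj K) hK

instance : (acyclicDb n W).IsTriangulated := by
  have h := isTriangulated_verdierImage (acyclicB_le (n := n) (W := W))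
  have e : acyclicDb n W = fun Y => ∃ K, exactB (MF n W) K ∧
      Nonempty (Y ≅ (verdierQ (gradedExact n W).acyclicB).obj K) := by
    ext Y
    simp only [exactB_iff]
    rfl
  rw [e]
  exact h

variable [EnoughProjectives C]

/-- A triangulated subcategory of `D^b` containing the exact complexes and the factorizations with
projective components contains the factorizations with components of finite projective
dimension. -/
lemma prop_singleDb_of_hasProjectiveDimensionLT (D : ObjectProperty (gradedExact n W).Db)
    [D.IsTriangulated] [D.IsClosedUnderIsomorphisms] (hK : acyclicDb n W ≤ D)
    (hP : ∀ M, projComp n W M → D ((gradedExact n W).singleDb.obj M)) (d : ℕ) (M : MF n W)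
    (hM : ∀ i, HasProjectiveDimensionLT (M.X i) (d + 1)) :
    D ((gradedExact n W).singleDb.obj M) := by
  induction d generalizing M with
  | zero =>
    refine hP M fun i => ?_
    have : HasProjectiveDimensionLT (M.X i) 1 := hM i
    infer_instance
  | succ d ih =>
    -- Covering by a trivial factorization on projectives lowers the projective dimension of all
    -- components at once. The kernel sequence is not split in components, so it gives a triangle
    -- only up to an object of `𝒦`, which `D` contains.
    obtain ⟨Y, g, hY, hg⟩ := exists_epi_from_triv M
    let S := ShortComplex.mk (kernel.ι g) g (kernel.condition g)
    have hS : S.ShortExact := { exact := ShortComplex.exact_kernel g }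
    have h₁ := ih S.X₁ fun i => by
      have : Projective ((triv W Y).X i) := projComp_triv hY i
      have hi := hS.map_of_exact (eval W i)
      exact hi.hasProjectiveDimensionLT_X₁ (d + 1)
        (inferInstanceAs (HasProjectiveDimensionLT ((triv W Y).X i) (d + 1))) (hM i)
    have h₂ : D ((gradedExact n W).singleDb.obj S.X₂) := hP _ (projComp_triv hY)
    obtain ⟨Z, i, h, w, hT, K, p, q, hT', hK'⟩ := exists_dist_of_shortExact hS
    have h₃ := D.ext_of_isTriangulatedClosed₃ _
      (dist_map hT (verdierQ (gradedExact n W).acyclicB)) h₁ h₂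
    exact D.ext_of_isTriangulatedClosed₂ _
      (dist_map hT' (verdierQ (gradedExact n W).acyclicB)) h₃
      (hK _ ⟨K, (exactB_iff K).1 hK', ⟨Iso.refl _⟩⟩)

/-- A triangulated subcategory of `D^b` containing the exact complexes and the factorizations with
projective components is everything. -/
lemma prop_of_projComp (hpd : ∀ X : C, ∃ d, HasProjectiveDimensionLT X d)
    (D : ObjectProperty (gradedExact n W).Db) [D.IsTriangulated] [D.IsClosedUnderIsomorphisms]
    (hK : acyclicDb n W ≤ D) (hP : ∀ M, projComp n W M → D ((gradedExact n W).singleDb.obj M))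
    (X : (gradedExact n W).Db) : D X := by
  refine D.prop_of_iso ((verdierQ (gradedExact n W).acyclicB).objObjPreimageIso X)
    (prop_of_singleKb (D.inverseImage (verdierQ (gradedExact n W).acyclicB)) _ fun j => ?_)
  choose d hd using hpd
  let M : MF n W := ((verdierQ (gradedExact n W).acyclicB).objPreimage X).obj.as.X j
  -- A common bound exists because a factorization has only `n` components.
  refine prop_singleDb_of_hasProjectiveDimensionLT D hK hP
    (Finset.univ.sup fun i => d (M.X i)) M fun i => ?_
  have := hd (M.X i)
  exact hasProjectiveDimensionLT_of_ge (M.X i) (d (M.X i)) _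
    ((Finset.le_sup (f := fun i => d (M.X i)) (Finset.mem_univ i)).trans (Nat.le_succ _))

omit [EnoughProjectives C] in
-- In `D⁻` such an `X` is isomorphic both to a complex of projectives and to an exact complex.
-- Morphisms from the first to the second are computed in `K⁻`, where they vanish, so the identity
-- of `X` is zero in `D⁻`.
lemma isZero_of_projDb_of_acyclicDb {X : (gradedExact n W).Db} (h₁ : projDb n W X)
    (h₂ : acyclicDb n W X) : IsZero X := by
  apply (gradedExact n W).isZero_of_isZero_toDminus_obj
  obtain ⟨P, ⟨a⟩⟩ := (projDb_iff X).1 h₁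
  obtain ⟨K, hK, ⟨b⟩⟩ := h₂
  have h := ((gradedExact n W).toDminus.mapIso b ≪≫ (gradedExact n W).toDminusIso.app K)
  have h₀ : Orth P.obj ((kbToKminus (MF n W)).obj K) := fun f =>
    projMinus_le _ P.property f ((exactB_iff K).2 hK)
  have h₀' := h₀.map_bijective (verdierQ (gradedExact n W).acyclicMinus)
    (projMinus_map_bijective P.property _).2
  rw [IsZero.iff_id_eq_zero]
  have h₃ : a.hom ≫ h.hom = 0 := h₀' _
  rw [← cancel_epi a.hom, ← cancel_mono h.hom, comp_id, h₃]
  simp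

/-- A triangulated subcategory orthogonal to `𝒦` and containing the factorizations with projective
components provides the triangles of a semiorthogonal decomposition. -/
lemma exists_dist_of_projComp (hpd : ∀ X : C, ∃ d, HasProjectiveDimensionLT X d)
    (G : ObjectProperty (gradedExact n W).Db) [G.IsTriangulated] [G.IsClosedUnderIsomorphisms]
    (hG : G ≤ (acyclicDb n W).leftOrthogonal)
    (hP : ∀ M, projComp n W M → G ((gradedExact n W).singleDb.obj M))
    (X : (gradedExact n W).Db) :
    ∃ (L A : (gradedExact n W).Db) (f : L ⟶ X) (g : X ⟶ A) (h : A ⟶ L⟦(1 : ℤ)⟧),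
      Triangle.mk f g h ∈ distTriang _ ∧ G L ∧ acyclicDb n W A := by
  have := isTriangulated_extensionProduct hG
  exact prop_of_projComp hpd (ObjectProperty.extensionProduct G (acyclicDb n W))
    (ObjectProperty.le_extensionProduct_right _)
    (fun M hM => ObjectProperty.le_extensionProduct_left _ _ (hP M hM)) X

/-- In the triangle `L → X → A` of an object `X` of `𝒫`, the third term lies in `𝒫` and in `𝒦`,
hence is zero, so `X ≅ L`. This minimality yields both the orthogonality of `𝒫` to `𝒦` and its
description in the stable category. -/
lemma projDb_le (hpd : ∀ X : C, ∃ d, HasProjectiveDimensionLT X d)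
    (G : ObjectProperty (gradedExact n W).Db) [G.IsTriangulated] [G.IsClosedUnderIsomorphisms]
    (hG : G ≤ projDb n W ⊓ (acyclicDb n W).leftOrthogonal)
    (hP : ∀ M, projComp n W M → G ((gradedExact n W).singleDb.obj M)) : projDb n W ≤ G := by
  intro X hX
  obtain ⟨L, A, f, g, h, hT, hL, hA⟩ :=
    exists_dist_of_projComp hpd G (hG.trans inf_le_right) hP X
  have hA₀ := isZero_of_projDb_of_acyclicDb
    ((projDb n W).ext_of_isTriangulatedClosed₃ _ hT (hG _ hL).1 hX) hA
  have : IsIso f := (dist_isZero₃_iff hT).1 hA₀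
  exact G.prop_of_iso (asIso f) hL

/-- Minimality is applied to the part of `𝒫` that is orthogonal to `𝒦`: it is triangulated and
contains the factorizations with projective components. -/
lemma projDb_le_leftOrthogonal (hpd : ∀ X : C, ∃ d, HasProjectiveDimensionLT X d) :
    projDb n W ≤ (acyclicDb n W).leftOrthogonal :=
  (projDb_le hpd (projDb n W ⊓ (acyclicDb n W).leftOrthogonal) le_rfl
    fun _ hM => ⟨projDb_singleDb hM, leftOrthogonal_singleDb hM⟩).trans inf_le_right

theorem isSemiorthogonalDecomposition_acyclicDb_projDb
    (hpd : ∀ X : C, ∃ d, HasProjectiveDimensionLT X d) :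
    IsSemiorthogonalDecomposition (acyclicDb n W) (projDb n W) :=
  isSemiorthogonalDecomposition_of_triangles
    (fun _ _ h₁ h₂ f => projDb_le_leftOrthogonal hpd _ h₂ f h₁)
    (exists_dist_of_projComp hpd (projDb n W) (projDb_le_leftOrthogonal hpd)
      fun _ hM => projDb_singleDb hM)

end MF
end
end MatFac
namespace MatFac

/-! ### Descent to the stable category -/

section
variable {T : Type u} [Category.{v} T] [HasZeroObject T] [HasShift T ℤ] [Preadditive T]
  [∀ n : ℤ, (shiftFunctor T n).Additive] [Pretriangulated T]
  {T' : Type u'} [Category.{v'} T'] [HasZeroObject T'] [HasShift T' ℤ] [Preadditive T']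
  [∀ n : ℤ, (shiftFunctor T' n).Additive] [Pretriangulated T']

lemma IsTriangulatedFunctor.map_shift_iso {F : T ⥤ T'} (hF : IsTriangulatedFunctor F) (X : T)
    (m : ℤ) : Nonempty (F.obj (X⟦m⟧) ≅ (F.obj X)⟦m⟧) := by
  obtain ⟨_, _⟩ := hF
  exact ⟨(F.commShiftIso m).app X⟩

/-- Distinguished triangles lift along full triangulated functors. -/
lemma IsTriangulatedFunctor.exists_dist {F : T ⥤ T'} (hF : IsTriangulatedFunctor F) [F.Full]
    {L X : T} {L' Y A : T'} (a : F.obj L ≅ L') (b : F.obj X ≅ Y) {f : L' ⟶ Y} {g : Y ⟶ A}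
    {h : A ⟶ L'⟦(1 : ℤ)⟧} (hT : Triangle.mk f g h ∈ distTriang T') :
    ∃ (B : T) (f' : L ⟶ X) (g' : X ⟶ B) (h' : B ⟶ L⟦(1 : ℤ)⟧),
      Triangle.mk f' g' h' ∈ distTriang T ∧ Nonempty (F.obj B ≅ A) := by
  obtain ⟨_, _⟩ := hF
  obtain ⟨f', hf'⟩ := F.map_surjective (a.hom ≫ f ≫ b.inv)
  obtain ⟨B, g', h', hT'⟩ := distinguished_cocone_triangle f'
  refine ⟨B, f', g', h', hT', ⟨Triangle.π₃.mapIso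
    (isoTriangleOfIso₁₂ _ _ (dist_map hT' F) hT a b ?_)⟩⟩
  change F.map f' ≫ b.hom = a.hom ≫ f
  rw [hf', assoc, assoc, Iso.inv_hom_id, comp_id]

end

section
variable {C : Type u} [Category.{v} C] [Abelian C] {n : ℕ} [NeZero n] {W : 𝟭 C ⟶ 𝟭 C}

namespace MF

/-- If `R` receives no morphism from `M`, then `f` factors through `A` and vanishes by orthogonality
in `D^b`. Otherwise the hull of `M` by a trivial factorization has a cokernel with projective
components, and its connecting morphism, invertible in the quotient, moves the problem to `A⟦1⟧` and
`R⟦1⟧`, where the bound is smaller. -/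
lemma dsing_map_eq_zero (m : ℕ) {M : MF n W} (hM : projComp n W M)
    {A Z R : (gradedExact n W).Db} (hA : acyclicDb n W A)
    (f : (gradedExact n W).singleDb.obj M ⟶ Z) (s : A ⟶ Z) (g : Z ⟶ R) (k : R ⟶ A⟦(1 : ℤ)⟧)
    (hT : Triangle.mk s g k ∈ distTriang (gradedExact n W).Db)
    (hm : shiftsFrom (gradedExact n W).singles.rightOrthogonal m R) :
    (verdierQ (gradedExact n W).perfect).map f = 0 := by
  induction m generalizing M A Z R with
  | zero =>
    have h₀ : Orth ((gradedExact n W).singleDb.obj M) R :=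
      Orth.of_iso (fun l => hm 0 le_rfl l ⟨M, rfl⟩) (Iso.refl _) ((shiftFunctorZero _ ℤ).app R)
    obtain ⟨r, rfl⟩ := dist_coyoneda₂ hT f (h₀ _)
    rw [leftOrthogonal_singleDb hM r hA, zero_comp, Functor.map_zero]
  | succ m ih =>
    obtain ⟨T, M', i, p, hc, hM', hI⟩ := hM.exists_conf_to
    have h := ih hM' ((acyclicDb n W).le_shift (1 : ℤ) _ hA)
      ((gradedExact n W).connectingDb.δ hc ≫ f⟦(1 : ℤ)⟧') _ _ _ (dist_shift hT) (by
        intro j hj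
        exact (gradedExact n W).singles.rightOrthogonal.prop_of_iso
          ((shiftFunctorAdd _ (1 : ℤ) j).app _) (hm (1 + j) (by push_cast; omega)))
    have := (gradedExact n W).isIso_map_connectingDb hc hI
    rw [Functor.map_comp] at h
    have h₁ : (verdierQ (gradedExact n W).perfect).map (f⟦(1 : ℤ)⟧') = 0 := by
      rw [← cancel_epi ((verdierQ (gradedExact n W).perfect).map
        ((gradedExact n W).connectingDb.δ hc)), h, comp_zero]
    have h₂ := map_eq_of_map_shift_eq (verdierQ (gradedExact n W).perfect) (f := f) (g := 0) (by
      rw [h₁, Functor.map_zero, Functor.map_zero])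
    rw [h₂, Functor.map_zero]

/-- The factorizations with projective components are left orthogonal to the exact complexes in
the quotient by the perfect complexes. -/
lemma orth_dsing {M : MF n W} (hM : projComp n W M) {A : (gradedExact n W).Db}
    (hA : acyclicDb n W A) :
    Orth ((verdierQ (gradedExact n W).perfect).obj ((gradedExact n W).singleDb.obj M))
      ((verdierQ (gradedExact n W).perfect).obj A) := by
  intro φ
  obtain ⟨z, hz⟩ := Localization.exists_leftFraction (verdierQ (gradedExact n W).perfect)
    (gradedExact n W).perfect.triangEnvelope.trW φ
  obtain ⟨R, g, k, hT, hR⟩ := z.hs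
  obtain ⟨m, hm⟩ := (gradedExact n W).perfect_le R hR
  have h := dsing_map_eq_zero m.toNat hM hA z.f z.s g k hT
    (fun k hk => hm k (m.self_le_toNat.trans hk))
  have := (isIso_verdierQ_map_iff (gradedExact n W).perfect z.s).2 z.hs
  rw [hz, ← cancel_mono ((verdierQ (gradedExact n W).perfect).map z.s),
    MorphismProperty.LeftFraction.map_comp_map_s, h, zero_comp]

variable [EnoughProjectives C] (hpd : ∀ X : C, ∃ d, HasProjectiveDimensionLT X d)
include hpd

/-- The objects of `𝒫` come from factorizations with projective components. -/
lemma exists_stabIncl_iso {Y : (gradedExact n W).Db} (hY : projDb n W Y) :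
    (stabIncl n W ⋙ (gradedExact n W).stabToDsing).essImage
      ((verdierQ (gradedExact n W).perfect).obj Y) := by
  have h₁ := ((isTriangulatedFunctor_stabIncl n W).comp
    (gradedExact n W).isTriangulatedFunctor_stabToDsing).isTriangulated_essImage
  have h₂ := (isTriangulatedFunctor_verdierQ (gradedExact n W).perfect).isTriangulated_inverseImage
    (stabIncl n W ⋙ (gradedExact n W).stabToDsing).essImage
  have h₃ := projDb_le_leftOrthogonal (n := n) (W := W) hpd
  -- By minimality of `𝒫` it suffices that the objects of `𝒫` with this property form a triangulated
  -- subcategory containing the factorizations with projective components.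
  refine (projDb_le hpd (projDb n W ⊓ ((stabIncl n W ⋙
    (gradedExact n W).stabToDsing).essImage.inverseImage (verdierQ (gradedExact n W).perfect)))
    (inf_le_left.trans (le_inf le_rfl h₃)) (fun M hM => ⟨projDb_singleDb hM, ?_⟩) Y hY).2
  obtain ⟨N, ⟨e⟩⟩ := (stabIncl_essImage_iff _).2 ⟨M, hM, ⟨Iso.refl _⟩⟩
  exact ⟨N, ⟨(gradedExact n W).stabToDsing.mapIso e⟩⟩

theorem stabIncl_essImage_iff_totProj (X : StabMF n W) :
    (stabIncl n W).essImage X ↔ totProj n W X := by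
  constructor
  · intro h
    obtain ⟨M, hM, ⟨e⟩⟩ := (stabIncl_essImage_iff _).1 h
    exact ⟨_, projDb_singleDb hM, ⟨(gradedExact n W).stabToDsing.mapIso e.symm⟩⟩
  · rintro ⟨Y, hY, ⟨e⟩⟩
    obtain ⟨N, ⟨e'⟩⟩ := exists_stabIncl_iso hpd hY
    exact ⟨N, ⟨(gradedExact n W).stabToDsing.preimageIso (e' ≪≫ e.symm)⟩⟩

omit hpd [EnoughProjectives C] in
instance : (totAcyclic n W).IsClosedUnderIsomorphisms where
  of_iso a := fun ⟨Y, hY, ⟨e⟩⟩ => ⟨Y, hY, ⟨(gradedExact n W).stabToDsing.mapIso a.symm ≪≫ e⟩⟩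

omit hpd [EnoughProjectives C] in
instance : (totAcyclic n W).IsStableUnderShift ℤ where
  isStableUnderShiftBy m := ⟨fun X ⟨Y, hY, ⟨e⟩⟩ => by
    obtain ⟨a⟩ := (gradedExact n W).isTriangulatedFunctor_stabToDsing.map_shift_iso X m
    exact ⟨Y⟦m⟧, (acyclicDb n W).le_shift m _ hY, ⟨a ≪≫ (shiftFunctor _ m).mapIso e ≪≫
      (((verdierQ (gradedExact n W).perfect).commShiftIso m).app Y).symm⟩⟩⟩

/-- Orthogonality is `orth_dsing`, transported along the equivalence. The triangle of `B[0]` in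
`D^b` is passed to the quotient; its first term comes from `StabProj`, so the triangle lifts to the
stable category, and the third term of the lift is in `Tot(𝒦)` by definition. -/
theorem isSemiorthogonalDecomposition_totAcyclic :
    IsSemiorthogonalDecomposition (totAcyclic n W) (stabIncl n W).essImage := by
  have := (isTriangulatedFunctor_stabIncl n W).isTriangulated_essImage
  refine isSemiorthogonalDecomposition_of_triangles ?_ fun X => ?_
  · rintro X₁ X₂ ⟨A, hA, ⟨a⟩⟩ h₂ f
    obtain ⟨M, hM, ⟨e⟩⟩ := (stabIncl_essImage_iff _).1 h₂
    apply (gradedExact n W).stabToDsing.map_injective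
    rw [Functor.map_zero]
    exact (orth_dsing hM hA).of_iso ((gradedExact n W).stabToDsing.mapIso e) a.symm _
  · obtain ⟨B, rfl⟩ := ExactStructure.Stab.exists_rep X
    obtain ⟨L, A, f, g, h, hT, hL, hA⟩ := exists_dist_of_projComp hpd (projDb n W)
      (projDb_le_leftOrthogonal hpd) (fun _ hM => projDb_singleDb hM)
      ((gradedExact n W).singleDb.obj B)
    obtain ⟨N, ⟨e⟩⟩ := exists_stabIncl_iso hpd hL
    obtain ⟨A', f', g', h', hT', ⟨a⟩⟩ :=
      (gradedExact n W).isTriangulatedFunctor_stabToDsing.exists_dist (L := (stabIncl n W).obj N)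
        (X := (gradedExact n W).toStab.obj B) e (Iso.refl _)
        (dist_map hT (verdierQ (gradedExact n W).perfect))
    exact ⟨_, A', f', g', h', hT', (stabIncl n W).obj_mem_essImage N, A, hA, ⟨a⟩⟩

end MF
end
end MatFac

theorem mainTheorem3 {C : Type u} [Category.{v} C] [Abelian C] [EnoughProjectives C]
    (hpd : ∀ X : C, ∃ d : ℕ, HasProjectiveDimensionLT X d)
    (n : ℕ) [NeZero n] (W : 𝟭 C ⟶ 𝟭 C) :
    -- the decomposition `D^b(MF) = ⟨𝒦, K⁻(Proj) ∩ D^b(MF)⟩` that descends to the stable category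
    IsSemiorthogonalDecomposition (acyclicDb n W) (projDb n W) ∧
    -- `D^b(MF) / K^b(ProjInj) ≅ Stab(MF)`, by `X[0] ↤ X`
    (IsTriangulatedFunctor (gradedExact n W).stabToDsing ∧
      (gradedExact n W).stabToDsing.IsEquivalence) ∧
    -- `Stab(MF_proj)` is a full triangulated subcategory of `Stab(MF)`
    (IsTriangulatedFunctor (stabIncl n W) ∧ (stabIncl n W).Full ∧ (stabIncl n W).Faithful) ∧
    -- it is the image of the component `K⁻(Proj) ∩ D^b(MF)`
    (∀ M : StabMF n W, (stabIncl n W).essImage M ↔ totProj n W M) ∧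
    -- the induced decomposition of `Stab(MF)` into `Tot(𝒦)` and `Stab(MF_proj)`
    IsSemiorthogonalDecomposition (totAcyclic n W) (stabIncl n W).essImage ∧
    -- `Stab(MF_proj) ≅ D^abs(MF)`
    (IsTriangulatedFunctor (stabIncl n W ⋙ toDabs n W) ∧
      (stabIncl n W ⋙ toDabs n W).IsEquivalence) := by
  have h₅ := MatFac.MF.isSemiorthogonalDecomposition_totAcyclic (n := n) (W := W) hpd
  have h₃ := MatFac.MF.isTriangulatedFunctor_stabIncl n W
  exact ⟨MatFac.MF.isSemiorthogonalDecomposition_acyclicDb_projDb hpd,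
    ⟨(gradedExact n W).isTriangulatedFunctor_stabToDsing,
      (gradedExact n W).isEquivalence_stabToDsing⟩,
    ⟨h₃, inferInstance, inferInstance⟩,
    MatFac.MF.stabIncl_essImage_iff_totProj hpd, h₅,
    h₃.comp (MatFac.isTriangulatedFunctor_verdierQ _), h₅.isEquivalence _ h₃ rfl⟩
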